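/- **Model.** Fix a block $\mathcal D_k=\{s_1,\dots,s_d\}\subset\mathbb R^2$ of distinct sites and thresholds $u_1,\dots,u_d\in\mathbb R$. The parameter is $\theta=(\omega,\zeta,\beta_1,\beta_2,\beta_3)\in\Theta\subseteq\mathbb R^p$; put $\alpha=2e^\omega/(1+e^\omega)$, $\phi=e^\zeta$, $\gamma(h)=(\|h\|/\phi)^\alpha$. Replicate $i$ has covariates $z_i=(z_{i1}(s_j),z_{i2}(s_j),z_{i3}(s_j))_{j\le d}$; the $z_i$ are independent copies of a bounded random array (constant covariates included). Let $\mu_i(s_j)=z_{i1}(s_j)^\top\beta_1$, $\sigma_i(s_j)=\exp(z_{i2}(s_j)^\top\beta_2)$, $\xi_i(s_j)=z_{i3}(s_j)^\top\beta_3$. Under $\theta$, the outcomes are $$Y_i(s_j)=\mu_i(s_j)+\frac{\sigma_i(s_j)}{\xi_i(s_j)}\bigl\{X_i(s_j)^{\xi_i(s_j)}-1\bigr\}$$ (read as the limit $\mu_i(s_j)+\sigma_i(s_j)\log X_i(s_j)$ if $\xi_i(s_j)=0$), where $X_i$, independent of $z_i$, is the unit Fréchet Brown–Resnick process with semivariogram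 $\gamma$ at the sites: $P(X_i(s_j)\le x_j\ \forall j)=\exp\{-E\max_j e^{W_j-\mathrm{Var}(W_j)/2}/x_j\}$ for all $x_j>0$, with $W$ centred Gaussian and $E(W_j-W_l)^2=2\gamma(s_j-s_l)$. The data consist of independent replicates such that each pair $\bigl(z_i,(\max\{Y_i(s_j),u_j\})_j\bigr)$ has its model law under the true value $\theta_0$ (outcomes below the thresholds need not follow the model). **Censored pairwise score.** For sites $s_j,s_l$ let $a=\{2\gamma(s_j-s_l)\}^{1/2}$ and $$V(x,x')=\tfrac1x\Phi\bigl(\tfrac a2-\tfrac1a\log\tfrac x{x'}\bigr)+\tfrac1{x'}\Phi\bigl(\tfrac a2-\tfrac1a\log\tfrac{x'}x\bigr).$$ Let $x_{ij}$ and $u_{ij}$ be the images of $y_{ij}=Y_i(s_j)$ and $u_j$ under $y\mapsto\{1+\xi_i(s_j)(y-\mu_i(s_j))/\sigma_i(s_j)\}^{1/\xi_i(s_j)}$ (its limit $\exp\{(y-\mu_i(s_j))/\sigma_i(s_j)\}$ if $\xi_i(s_j)=0$), and $J_{ij}$ the derivative of this map at $y_{ij}$. The contribution of the pair is $$g=\begin{cases}\dfrac{\partial^2e^{-V(x_{ij},x_{il})}}{\partial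 x_{ij}\,\partial x_{il}}J_{ij}J_{il},&y_{ij}>u_j,\ y_{il}>u_l,\\[4pt] \dfrac{\partial e^{-V(x_{ij},u_{il})}}{\partial x_{ij}}J_{ij},&y_{ij}>u_j,\ y_{il}\le u_l,\\[4pt] \dfrac{\partial e^{-V(u_{ij},x_{il})}}{\partial x_{il}}J_{il},&y_{ij}\le u_j,\ y_{il}>u_l,\\[4pt] e^{-V(u_{ij},u_{il})},&y_{ij}\le u_j,\ y_{il}\le u_l.\end{cases}$$ Let $\psi_{ik}(\theta)=\nabla_\theta\sum_{j<l}\log g$, summed over the pairs of sites in $\mathcal D_k$, $\mathcal{CCL}_k=\frac1n\sum_{i\le n}\sum_{j<l}\log g$, $\Psi_k(\theta)=\frac1n\sum_{i\le n}\psi_{ik}(\theta)$, $i_k(\theta)=E_\theta\{\nabla_\theta\Psi_k(\theta)\}$ and $c_k(\theta)=\mathrm{Var}_\theta\{\sqrt n\,\Psi_k(\theta)\}$. **Conditions (C1).** (i) The support of $(z_i,(\max\{Y_i(s_j),u_j\})_j)$ is the same for all $\theta\in\Theta$, and on it $1+\xi_i(s_j)(u_j-\mu_i(s_j))/\sigma_i(s_j)>0$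 for all $j$ and all $\theta\in\Theta$, so that $u_{ij}$ is defined. (ii) At every point of this support, $\psi_{ik}$ is twice continuously differentiable in $\theta$ on $\Theta$. (iii) $\theta_0$ is an interior point of $\Theta$ and the unique $\theta\in\Theta$ at which $E_{\theta_0}\{\Psi_k(\theta)\}$ exists and is $0$. (iv) $c_k(\theta)$ is finite and positive definite for every $\theta\in\Theta$. (v) In a neighbourhood of $\theta_0$, $i_k(\theta)$ exists and is differentiable with uniformly bounded first derivative. **Theorem.** Under (C1), $i_k(\theta_0)$ is invertible, and as $n\to\infty$ with $\mathcal D_k$ fixed: 1. There is a sequence of estimators (measurable functions of the first $n$ replicates) that converges to $\theta_0$ in probability and that, with probability tending to one, lies in $\Theta$, solves $\Psi_k(\theta)=0$ and is a local maximum of $\mathcal{CCL}_k$. 2. Let $\widehat\theta_k$ be any sequence of random vectors with $P\{\widehat\theta_k\in\Theta,\ \Psi_k(\widehat\theta_k)=0\}\to1$ which does not escape from the interior of $\Theta$: for every $\varepsilon>0$ there is a compact subset of the interior of $\Theta$ that contains $\widehat\theta_k$ with probability at least $1-\varepsilon$ for all large $n$ (any sequence that is consistent for $\theta_0$ has this property).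 Then $\widehat\theta_k\to\theta_0$ in probability, $\sqrt n\,\|\widehat\theta_k-\theta_0\|$ is bounded in probability, and $$\sqrt n\,(\widehat\theta_k-\theta_0)\xrightarrow{d}\mathcal N\Bigl(0,\ \bigl\{i_k(\theta_0)^\top c_k(\theta_0)^{-1}i_k(\theta_0)\bigr\}^{-1}\Bigr).$$ -/

import Mathlib

open MeasureTheory ProbabilityTheory Filter Topology Set

noncomputable section

namespace MaxStable

/-! ### Parameters -/

/-- Coordinates of the parameter: two dependence parameters `ω, ζ` and the marginal regression
coefficients `β₁, β₂, β₃`. -/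
abbrev ParamIdx (q₁ q₂ q₃ : ℕ) : Type := Fin 2 ⊕ Fin q₁ ⊕ Fin q₂ ⊕ Fin q₃

/-- The parameter `θ = (ω, ζ, β₁, β₂, β₃) ∈ ℝᵖ`, `p = 2 + q₁ + q₂ + q₃`. -/
abbrev Param (q₁ q₂ q₃ : ℕ) : Type := EuclideanSpace ℝ (ParamIdx q₁ q₂ q₃)

/-- The covariates `(z₁(s_j), z₂(s_j), z₃(s_j))` of one replicate at the `d` sites. -/
abbrev Design (d q₁ q₂ q₃ : ℕ) : Type :=
  Fin d → (Fin q₁ → ℝ) × (Fin q₂ → ℝ) × (Fin q₃ → ℝ)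

/-- One replicate: its covariates and its outcomes at the `d` sites. -/
abbrev Obs (d q₁ q₂ q₃ : ℕ) : Type := Design d q₁ q₂ q₃ × (Fin d → ℝ)

variable {d q₁ q₂ q₃ : ℕ}

/-- `ω = log (α / (2 - α))`. -/
def omega (θ : Param q₁ q₂ q₃) : ℝ := θ (Sum.inl 0)

/-- `ζ = log φ`. -/
def zeta (θ : Param q₁ q₂ q₃) : ℝ := θ (Sum.inl 1)

/-- Location `μ(s_j; β₁) = z₁(s_j)ᵀ β₁`. -/
def gevLoc (θ : Param q₁ q₂ q₃) (z : Design d q₁ q₂ q₃) (j : Fin d) : ℝ :=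
  ∑ i, (z j).1 i * θ (Sum.inr (Sum.inl i))

/-- Scale `σ(s_j; β₂) = exp (z₂(s_j)ᵀ β₂)`. -/
def gevScale (θ : Param q₁ q₂ q₃) (z : Design d q₁ q₂ q₃) (j : Fin d) : ℝ :=
  Real.exp (∑ i, (z j).2.1 i * θ (Sum.inr (Sum.inr (Sum.inl i))))

/-- Shape `ξ(s_j; β₃) = z₃(s_j)ᵀ β₃`. -/
def gevShape (θ : Param q₁ q₂ q₃) (z : Design d q₁ q₂ q₃) (j : Fin d) : ℝ :=
  ∑ i, (z j).2.2 i * θ (Sum.inr (Sum.inr (Sum.inr i)))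

/-! ### The Brown–Resnick process at finitely many sites -/

/-- Smoothness `α = 2 exp ω / (1 + exp ω)`. -/
def smoothness (ω : ℝ) : ℝ := 2 * Real.exp ω / (1 + Real.exp ω)

/-- The isotropic semivariogram `γ(h) = (‖h‖ / φ) ^ α`, `φ = exp ζ`. -/
def semivariogram (ω ζ : ℝ) (h : EuclideanSpace ℝ (Fin 2)) : ℝ :=
  (‖h‖ / Real.exp ζ) ^ smoothness ω

/-- `ρ` is the law, at the sites `s₁, …, s_d`, of the Brown–Resnick max-stable process with unit
Fréchet margins and semivariogram `γ`: for a centred Gaussian vector `W` with variogram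
`E (W_j - W_l)² = 2 γ(s_j - s_l)` and all positive `x`,
`ρ {X ≤ x} = exp (-V(x))`, where `V(x) = E max_j exp (W_j - Var W_j / 2) / x_j`.
(`V`, hence `ρ`, does not depend on the choice of `W`.) -/
def IsBrownResnick (s : Fin d → EuclideanSpace ℝ (Fin 2)) (ω ζ : ℝ)
    (ρ : Measure (Fin d → ℝ)) : Prop :=
  IsProbabilityMeasure ρ ∧
  ∃ G : Measure (Fin d → ℝ), IsGaussian G ∧
    (∀ j, ∫ w, w j ∂G = 0) ∧
    (∀ j l, ∫ w, (w j - w l) ^ 2 ∂G = 2 * semivariogram ω ζ (s j - s l)) ∧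
    ∀ x : Fin d → ℝ, (∀ j, 0 < x j) →
      ρ.real {y | ∀ j, y j ≤ x j} =
        Real.exp (-∫ w, ⨆ j, Real.exp (w j - Var[fun w' => w' j; G] / 2) / x j ∂G)

/-! ### Margins -/

/-- From a unit Fréchet value `x` to the GEV scale: `μ + (σ / ξ) (x ^ ξ - 1)`, read as its limit
`μ + σ log x` if `ξ = 0`. -/
def fromFrechet (μ σ ξ x : ℝ) : ℝ :=
  if ξ = 0 then μ + σ * Real.log x else μ + σ / ξ * (x ^ ξ - 1)

/-- From the GEV scale to the unit Fréchet scale: `{1 + ξ (y - μ) / σ} ^ (1 / ξ)`, read as its limit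
`exp ((y - μ) / σ)` if `ξ = 0`. -/
def toFrechet (μ σ ξ y : ℝ) : ℝ :=
  if ξ = 0 then Real.exp ((y - μ) / σ) else (1 + ξ * (y - μ) / σ) ^ (1 / ξ)

/-- The Jacobian `J(y)`, the derivative of `toFrechet` in `y`. -/
def jacobian (μ σ ξ y : ℝ) : ℝ := deriv (toFrechet μ σ ξ) y

/-! ### The censored pairwise likelihood -/

/-- The standard normal distribution function `Φ`. -/
def stdNormalCDF (t : ℝ) : ℝ := cdf (gaussianReal 0 1) t

/-- The bivariate Brown–Resnick exponent measure with `a = (2 γ(s₁ - s₂)) ^ (1/2)`. -/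
def pairExponent (a x₁ x₂ : ℝ) : ℝ :=
  1 / x₁ * stdNormalCDF (a / 2 - 1 / a * Real.log (x₁ / x₂)) +
    1 / x₂ * stdNormalCDF (a / 2 - 1 / a * Real.log (x₂ / x₁))

/-- The bivariate distribution function `exp (-V(x₁, x₂))`. -/
def pairCDF (a x₁ x₂ : ℝ) : ℝ := Real.exp (-pairExponent a x₁ x₂)

/-- A block `D_k`: the sites, the thresholds at the sites, and the law of the covariates. -/
structure Block (d q₁ q₂ q₃ : ℕ) where
  /-- the observation sites -/
  site : Fin d → EuclideanSpace ℝ (Fin 2)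
  /-- the thresholds `u(s_j)` -/
  thr : Fin d → ℝ
  /-- the law of the covariates of one replicate (a point mass if covariates are fixed) -/
  covLaw : Measure (Design d q₁ q₂ q₃)

variable (B : Block d q₁ q₂ q₃)

/-- `a_{jl} = {2 γ(s_j - s_l)} ^ (1/2)`. -/
def pairDep (θ : Param q₁ q₂ q₃) (j l : Fin d) : ℝ :=
  Real.sqrt (2 * semivariogram (omega θ) (zeta θ) (B.site j - B.site l))

/-- The outcome at site `j` on the unit Fréchet scale. -/
def frechetObs (θ : Param q₁ q₂ q₃) (o : Obs d q₁ q₂ q₃) (j : Fin d) : ℝ :=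
  toFrechet (gevLoc θ o.1 j) (gevScale θ o.1 j) (gevShape θ o.1 j) (o.2 j)

/-- The threshold at site `j` on the unit Fréchet scale. -/
def frechetThr (θ : Param q₁ q₂ q₃) (z : Design d q₁ q₂ q₃) (j : Fin d) : ℝ :=
  toFrechet (gevLoc θ z j) (gevScale θ z j) (gevShape θ z j) (B.thr j)

/-- The Jacobian at the outcome at site `j`. -/
def jacobianObs (θ : Param q₁ q₂ q₃) (o : Obs d q₁ q₂ q₃) (j : Fin d) : ℝ :=
  jacobian (gevLoc θ o.1 j) (gevScale θ o.1 j) (gevShape θ o.1 j) (o.2 j)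

open Classical in
/-- The censored likelihood contribution `g` of the pair of sites `(j, l)`. -/
def pairLik (θ : Param q₁ q₂ q₃) (o : Obs d q₁ q₂ q₃) (j l : Fin d) : ℝ :=
  let F : ℝ → ℝ → ℝ := pairCDF (pairDep B θ j l)
  let xj := frechetObs θ o j
  let xl := frechetObs θ o l
  let uj := frechetThr B θ o.1 j
  let ul := frechetThr B θ o.1 l
  if B.thr j < o.2 j then
    if B.thr l < o.2 l then
      deriv (fun s => deriv (fun t => F s t) xl) xj * jacobianObs θ o j * jacobianObs θ o l
    else deriv (fun s => F s ul) xj * jacobianObs θ o j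
  else
    if B.thr l < o.2 l then deriv (fun t => F uj t) xl * jacobianObs θ o l
    else F uj ul

/-- The log censored composite likelihood of one replicate: the sum over all pairs of sites. -/
def logLik (θ : Param q₁ q₂ q₃) (o : Obs d q₁ q₂ q₃) : ℝ :=
  ∑ j : Fin d, ∑ l ∈ Finset.Ioi j, Real.log (pairLik B θ o j l)

/-- The score contribution `ψ(θ)` of one replicate: the gradient in `θ` of `logLik`. -/
def score (θ : Param q₁ q₂ q₃) (o : Obs d q₁ q₂ q₃) : Param q₁ q₂ q₃ :=
  gradient (fun θ' => logLik B θ' o) θ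

/-- The log censored composite likelihood of `n` replicates. -/
def ccl {n : ℕ} (data : Fin n → Obs d q₁ q₂ q₃) (θ : Param q₁ q₂ q₃) : ℝ :=
  (n : ℝ)⁻¹ * ∑ i, logLik B θ (data i)

/-- The censored composite score `Ψ(θ) = n⁻¹ ∑ᵢ ψᵢ(θ)` of `n` replicates. -/
def compositeScore {n : ℕ} (data : Fin n → Obs d q₁ q₂ q₃) (θ : Param q₁ q₂ q₃) :
    Param q₁ q₂ q₃ :=
  (n : ℝ)⁻¹ • ∑ i, score B θ (data i)

/-! ### The model and the matrices -/

/-- Censoring from below at the thresholds. The likelihood sees an outcome only through this. -/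
def censor (o : Obs d q₁ q₂ q₃) : Obs d q₁ q₂ q₃ := (o.1, fun j => max (o.2 j) (B.thr j))

/-- The law under `θ` of one censored replicate: covariates `z` from their law, an independent
Brown–Resnick vector `x` from `ρ ω ζ`, outcomes obtained from `x` by the GEV transformations. -/
def obsLaw (ρ : ℝ → ℝ → Measure (Fin d → ℝ)) (θ : Param q₁ q₂ q₃) :
    Measure (Obs d q₁ q₂ q₃) :=
  (B.covLaw.prod (ρ (omega θ) (zeta θ))).map fun zx =>
    censor B (zx.1, fun j =>
      fromFrechet (gevLoc θ zx.1 j) (gevScale θ zx.1 j) (gevShape θ zx.1 j) (zx.2 j))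

/-- The entry `∂ψ_a / ∂θ_b` of the Jacobian matrix of the score contribution. -/
def scoreDeriv (θ : Param q₁ q₂ q₃) (a b : ParamIdx q₁ q₂ q₃) (o : Obs d q₁ q₂ q₃) : ℝ :=
  (fderiv ℝ (fun θ' => score B θ' o) θ (EuclideanSpace.single b 1)) a

/-- The sensitivity matrix `i(θ) = E_θ {∇ Ψ(θ)}` (the same for every sample size, as replicates are
identically distributed). -/
def sensitivity (ρ : ℝ → ℝ → Measure (Fin d → ℝ)) (θ : Param q₁ q₂ q₃) :
    Matrix (ParamIdx q₁ q₂ q₃) (ParamIdx q₁ q₂ q₃) ℝ :=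
  Matrix.of fun a b => ∫ o, scoreDeriv B θ a b o ∂(obsLaw B ρ θ)

/-- The variability matrix `c(θ) = Var_θ {√n Ψ(θ)}`, that is `Var_θ {ψ(θ)}`, as replicates are
independent and identically distributed. -/
def variability (ρ : ℝ → ℝ → Measure (Fin d → ℝ)) (θ : Param q₁ q₂ q₃) :
    Matrix (ParamIdx q₁ q₂ q₃) (ParamIdx q₁ q₂ q₃) ℝ :=
  Matrix.of fun a b => cov[fun o => score B θ o a, fun o => score B θ o b; obsLaw B ρ θ]

/-! ### The regularity conditions -/

/-- The regularity conditions on the censored composite score at the true value `θ₀`. -/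
structure Regular (ρ : ℝ → ℝ → Measure (Fin d → ℝ)) (Θ : Set (Param q₁ q₂ q₃))
    (θ₀ : Param q₁ q₂ q₃) : Prop where
  /-- The support of the (censored) outcomes does not depend on the parameter. -/
  support_eq : ∀ θ ∈ Θ, (obsLaw B ρ θ).support = (obsLaw B ρ θ₀).support
  /-- The thresholds on the Fréchet scale are well defined. -/
  thr_valid : ∀ θ ∈ Θ, ∀ o ∈ (obsLaw B ρ θ₀).support, ∀ j,
    0 < 1 + gevShape θ o.1 j * (B.thr j - gevLoc θ o.1 j) / gevScale θ o.1 j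
  /-- The score is twice continuously differentiable in the parameter, everywhere on the sample
  space (and is a genuine gradient). -/
  smooth : ∀ θ ∈ Θ, ∀ o ∈ (obsLaw B ρ θ₀).support,
    (∀ᶠ θ' in 𝓝 θ, DifferentiableAt ℝ (fun τ => logLik B τ o) θ') ∧
      ContDiffAt ℝ 2 (fun τ => score B τ o) θ
  /-- The true value is an interior point of the parameter space. -/
  interior : θ₀ ∈ interior Θ
  /-- The true value is the unique zero of the expected score in the parameter space. -/
  unique_zero : ∀ θ ∈ Θ,
    (Integrable (score B θ) (obsLaw B ρ θ₀) ∧ ∫ o, score B θ o ∂(obsLaw B ρ θ₀) = 0) ↔ θ = θ₀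
  /-- The variability matrix is finite. -/
  var_finite : ∀ θ ∈ Θ, MemLp (score B θ) 2 (obsLaw B ρ θ)
  /-- The variability matrix is positive definite. -/
  var_posDef : ∀ θ ∈ Θ, (variability B ρ θ).PosDef
  /-- The sensitivity matrix exists near the true value, and its first derivative is uniformly
  bounded there. -/
  sens_deriv : ∃ C : ℝ, ∀ᶠ θ in 𝓝 θ₀, ∀ a b,
    Integrable (scoreDeriv B θ a b) (obsLaw B ρ θ) ∧
      DifferentiableAt ℝ (fun τ => sensitivity B ρ τ a b) θ ∧
      ‖fderiv ℝ (fun τ => sensitivity B ρ τ a b) θ‖ ≤ C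

end MaxStable

end

/-!
The proof is the classical one for M-estimators: at `θ₀` the score satisfies a law of large numbers
and a central limit theorem, its derivative converges to the sensitivity matrix, and the score
equation is inverted near `θ₀`. What is specific to the model is the verification of the two
analytic facts that this argument needs: integrable envelopes and a definite sensitivity matrix.

*Integrable envelopes* (`WellInside.exists_smoothLik`, `WellInside.integrable_pow`). If the shape
`ξ` were negative somewhere in the support of the covariates, then the margin would have a finite
upper endpoint that moves with the parameter, against the constancy of the support. Hence `ξ ≥ 0` on
`Θ`, and, as this persists under perturbation of the shape coefficients, `ξ ≥ δ ‖z₃‖` at distance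
`δ` from the complement of `Θ` (`gevShape_nonneg`, `mul_norm_le_gevShape`). Locally in the
parameter, the logarithm of an outcome on the Fréchet scale is then comparable with the
parameter-free quantity `log (1 + ‖z₃‖ r) / ‖z₃‖`, where `r` is the excess over the threshold (read
as `r` if `z₃ = 0`); its sum over the sites is `tailBound`, which has moments of all orders, as a
unit Fréchet variable has a moment of order `1/2`. The log-likelihood of a pair is a composition of
functions such as `exp`, `log Φ`, and `log (1 + ε x) / ε`, each of which solves a first-order
differential equation that expresses its derivative through functions of the same kind. So, by
induction on the order, all derivatives in the parameter are bounded by powers of `1 + tailBound`;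
the predicate `Tame` records this, with measurability in the observation.

*Negative definite sensitivity* (`SmoothLik.sensitivity_neg`). The contribution of a pair is the
density of the pair of censored outcomes given the covariates, with respect to a product of measures
with an atom at each threshold (`map_pair_eq_withDensity`). It rests on the bivariate margins of the
Brown–Resnick law, which follow from exponential tilting of the Gaussian vector
(`IsBrownResnick.measureReal_pair`). Hence the likelihood ratio of each pair has expectation one and
its Kullback–Leibler divergence dominates the squared Hellinger distance. If the quadratic form of
the sensitivity matrix were nonnegative in a direction `v`, then the divergences, being nonnegative
and with sum `O(t³)` along `θ₀ + t v`, would each be `O(t³)`, so that the log-likelihood of every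
pair has almost surely a vanishing derivative in the direction `v`. The score would then have
no variance in that direction, against the positive definiteness of the variability matrix.

*Asymptotics of zeros* (`NearlyLinear`). With probability tending to one, the mean score is, on a
fixed small ball about `θ₀`, a Lipschitz-small perturbation of the coercive map given by the
sensitivity matrix (`SmoothLik.exists_whp_nearlyLinear`). So it has there exactly one zero, near
which it is monotone; the zero is a local maximum of the likelihood and depends measurably on the
data. The mean score has no zeros on compact sets of other parameters in the interior of `Θ`
(`whp_sampleMean_score_ne_zero`), which makes other sequences of zeros consistent if they do not
leave compact subsets of the interior. For consistent zeros, `√n (θ̂ - θ₀)` differs from the image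
of the normalized score under minus the inverse of the sensitivity matrix by a term that vanishes in
probability (`tendstoInDistribution_of_consistent`).
-/

set_option linter.unusedSectionVars false

noncomputable section

namespace MaxStable

/-! ### Functions with polynomially bounded derivatives -/

section Tame

variable {ι : Type*} [Fintype ι] {O : Type*} [MeasurableSpace O]

/-- The linear form on `EuclideanSpace ℝ ι` with coordinates `c`. -/
def covec (c : ι → ℝ) : EuclideanSpace ℝ ι →L[ℝ] ℝ := ∑ a, c a • EuclideanSpace.proj a

@[simp] lemma covec_apply (c : ι → ℝ) (v : EuclideanSpace ℝ ι) : covec c v = ∑ a, c a * v a := by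
  simp [covec]

/-- `f θ o` is measurable in the observation `o` and bounded by a power of `1 + M o`, uniformly in
`θ ∈ U` and `o ∈ S`. -/
def PolyBdd (U : Set (EuclideanSpace ℝ ι)) (S : Set O) (M : O → ℝ)
    (f : EuclideanSpace ℝ ι → O → ℝ) : Prop :=
  (∀ θ ∈ U, Measurable (f θ)) ∧
    ∃ C : ℝ, ∃ k : ℕ, 0 ≤ C ∧ ∀ o ∈ S, ∀ θ ∈ U, |f θ o| ≤ C * (1 + M o) ^ k

/-- `f θ o` and its partial derivatives in `θ` of order at most `n` are measurable in `o` and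
bounded by powers of `1 + M o`, uniformly in `θ ∈ U` and `o ∈ S`. The partial derivatives are part
of the witness, so that their measurability in `o` needs no argument about `fderiv`. -/
def Tame (U : Set (EuclideanSpace ℝ ι)) (S : Set O) (M : O → ℝ) :
    ℕ → (EuclideanSpace ℝ ι → O → ℝ) → Prop
  | 0, f => PolyBdd U S M f
  | n + 1, f => PolyBdd U S M f ∧ ∃ f' : ι → EuclideanSpace ℝ ι → O → ℝ,
      (∀ a, Tame U S M n (f' a)) ∧
      ∀ o ∈ S, ∀ θ ∈ U, HasFDerivAt (fun τ => f τ o) (covec fun a => f' a θ o) θ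

variable {U : Set (EuclideanSpace ℝ ι)} {S : Set O} {M : O → ℝ} {n : ℕ}
  {f g : EuclideanSpace ℝ ι → O → ℝ}

lemma Tame.polyBdd (h : Tame U S M n f) : PolyBdd U S M f := by
  cases n with
  | zero => exact h
  | succ n => exact h.1

lemma Tame.pred : ∀ {n : ℕ} {f : EuclideanSpace ℝ ι → O → ℝ}, Tame U S M (n + 1) f → Tame U S M n f
  | 0, _, h => h.1
  | _ + 1, _, h => ⟨h.1, h.2.choose, fun a => (h.2.choose_spec.1 a).pred, h.2.choose_spec.2⟩

lemma PolyBdd.of_bound (hm : ∀ θ ∈ U, Measurable (f θ)) (C : ℝ) (k : ℕ)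
    (h : ∀ o ∈ S, ∀ θ ∈ U, |f θ o| ≤ C * (1 + M o) ^ k) (hM : ∀ o ∈ S, 0 ≤ M o) :
    PolyBdd U S M f :=
  ⟨hm, |C|, k, abs_nonneg C, fun o ho θ hθ => (h o ho θ hθ).trans
    (mul_le_mul_of_nonneg_right (le_abs_self C) (pow_nonneg (by linarith [hM o ho]) k))⟩

lemma PolyBdd.of_bounded (hm : ∀ θ ∈ U, Measurable (f θ)) (C : ℝ)
    (h : ∀ o ∈ S, ∀ θ ∈ U, |f θ o| ≤ C) : PolyBdd U S M f :=
  ⟨hm, |C|, 0, abs_nonneg C, fun o ho θ hθ => by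
    simpa using (h o ho θ hθ).trans (le_abs_self C)⟩

lemma PolyBdd.add (hM : ∀ o ∈ S, 0 ≤ M o) (hf : PolyBdd U S M f) (hg : PolyBdd U S M g) :
    PolyBdd U S M fun θ o => f θ o + g θ o := by
  obtain ⟨hfm, C, k, hC, hf⟩ := hf
  obtain ⟨hgm, D, l, hD, hg⟩ := hg
  refine ⟨fun θ hθ => (hfm θ hθ).add (hgm θ hθ), C + D, k + l, by positivity, fun o ho θ hθ => ?_⟩
  have h1 : 1 ≤ 1 + M o := by linarith [hM o ho]
  calc |f θ o + g θ o| ≤ |f θ o| + |g θ o| := abs_add_le _ _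
    _ ≤ C * (1 + M o) ^ k + D * (1 + M o) ^ l := add_le_add (hf o ho θ hθ) (hg o ho θ hθ)
    _ ≤ C * (1 + M o) ^ (k + l) + D * (1 + M o) ^ (k + l) := by
        gcongr <;> first | exact h1 | omega
    _ = _ := by ring

lemma PolyBdd.mul (hf : PolyBdd U S M f) (hg : PolyBdd U S M g) :
    PolyBdd U S M fun θ o => f θ o * g θ o := by
  obtain ⟨hfm, C, k, hC, hf⟩ := hf
  obtain ⟨hgm, D, l, hD, hg⟩ := hg
  refine ⟨fun θ hθ => (hfm θ hθ).mul (hgm θ hθ), C * D, k + l, by positivity, fun o ho θ hθ => ?_⟩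
  calc |f θ o * g θ o| = |f θ o| * |g θ o| := abs_mul _ _
    _ ≤ (C * (1 + M o) ^ k) * (D * (1 + M o) ^ l) :=
        mul_le_mul (hf o ho θ hθ) (hg o ho θ hθ) (abs_nonneg _)
          ((abs_nonneg _).trans (hf o ho θ hθ))
    _ = _ := by ring

lemma Tame.add (hM : ∀ o ∈ S, 0 ≤ M o) : ∀ {n : ℕ} {f g : EuclideanSpace ℝ ι → O → ℝ},
    Tame U S M n f → Tame U S M n g → Tame U S M n fun θ o => f θ o + g θ o
  | 0, _, _, hf, hg => PolyBdd.add hM hf hg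
  | n + 1, f, g, ⟨hf, f', hf', hfd⟩, ⟨hg, g', hg', hgd⟩ =>
    ⟨hf.add hM hg, fun a θ o => f' a θ o + g' a θ o, fun a => (hf' a).add hM (hg' a),
      fun o ho θ hθ => by
        refine ((hfd o ho θ hθ).add (hgd o ho θ hθ)).congr_fderiv ?_
        ext v
        simp [add_mul, Finset.sum_add_distrib]⟩

lemma Tame.mul (hM : ∀ o ∈ S, 0 ≤ M o) : ∀ {n : ℕ} {f g : EuclideanSpace ℝ ι → O → ℝ},
    Tame U S M n f → Tame U S M n g → Tame U S M n fun θ o => f θ o * g θ o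
  | 0, _, _, hf, hg => PolyBdd.mul hf hg
  | n + 1, f, g, hf0, hg0 => by
    obtain ⟨hf, f', hf', hfd⟩ := id hf0
    obtain ⟨hg, g', hg', hgd⟩ := id hg0
    refine ⟨hf.mul hg, fun a θ o => f θ o * g' a θ o + g θ o * f' a θ o,
      fun a => (hf0.pred.mul hM (hg' a)).add hM (hg0.pred.mul hM (hf' a)), fun o ho θ hθ => ?_⟩
    refine ((hfd o ho θ hθ).mul (hgd o ho θ hθ)).congr_fderiv ?_
    ext v
    simp [add_mul, Finset.sum_add_distrib, Finset.mul_sum, mul_assoc]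

lemma Tame.of_obs {c : O → ℝ} (h : PolyBdd U S M fun _ o => c o) :
    ∀ n : ℕ, Tame U S M n fun _ o => c o
  | 0 => h
  | n + 1 => ⟨h, fun _ _ _ => 0, fun _ => Tame.of_obs (c := fun _ => 0)
      (PolyBdd.of_bounded (fun _ _ => measurable_const) 0 (by simp)) n, fun o _ θ _ => by
        refine (hasFDerivAt_const (c o) θ).congr_fderiv ?_
        ext v
        simp⟩

lemma Tame.const (c : ℝ) (n : ℕ) : Tame U S M n fun _ _ => c :=
  Tame.of_obs (PolyBdd.of_bounded (fun _ _ => measurable_const) |c| (by simp)) n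

lemma Tame.obs_of_bounded {c : O → ℝ} (hc : Measurable c) (C : ℝ) (h : ∀ o ∈ S, |c o| ≤ C) (n : ℕ) :
    Tame U S M n fun _ o => c o :=
  Tame.of_obs (PolyBdd.of_bounded (fun _ _ => hc) C fun o ho _ _ => h o ho) n

lemma Tame.const_mul (hM : ∀ o ∈ S, 0 ≤ M o) (c : ℝ) (h : Tame U S M n f) :
    Tame U S M n fun θ o => c * f θ o := (Tame.const c n).mul hM h

lemma Tame.neg (hM : ∀ o ∈ S, 0 ≤ M o) (h : Tame U S M n f) : Tame U S M n fun θ o => -f θ o := by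
  simpa using h.const_mul hM (-1)

lemma Tame.sub (hM : ∀ o ∈ S, 0 ≤ M o) (hf : Tame U S M n f) (hg : Tame U S M n g) :
    Tame U S M n fun θ o => f θ o - g θ o := by
  simpa [sub_eq_add_neg] using hf.add hM (hg.neg hM)

lemma Tame.sum (hM : ∀ o ∈ S, 0 ≤ M o) {κ : Type*} (s : Finset κ)
    {F : κ → EuclideanSpace ℝ ι → O → ℝ} (h : ∀ i ∈ s, Tame U S M n (F i)) :
    Tame U S M n fun θ o => ∑ i ∈ s, F i θ o := by
  classical
  induction s using Finset.induction_on with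
  | empty => simpa using Tame.const (U := U) (S := S) (M := M) 0 n
  | insert i s hi ih =>
    simp only [Finset.sum_insert hi]
    exact (h i (by simp)).add hM (ih fun j hj => h j (by simp [hj]))

lemma Tame.coord (hU : Bornology.IsBounded U) (a : ι) :
    ∀ n : ℕ, Tame U S M n fun θ _ => θ a := by
  classical
  obtain ⟨R, hR⟩ := hU.exists_norm_le
  have hb : PolyBdd U S M fun θ _ => θ a :=
    PolyBdd.of_bounded (fun _ _ => measurable_const) R fun o _ θ hθ => by
      simpa using (PiLp.norm_apply_le θ a).trans (hR θ hθ)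
  intro n
  cases n with
  | zero => exact hb
  | succ n =>
    refine ⟨hb, fun b _ _ => if b = a then 1 else 0, fun b => Tame.const _ n, fun o _ θ _ => ?_⟩
    refine ((EuclideanSpace.proj (𝕜 := ℝ) a).hasFDerivAt (x := θ)).congr_fderiv ?_
    ext v
    simp

/-- Piecewise definition, where the pieces are determined by the observation. -/
lemma Tame.ite {p : O → Prop} [DecidablePred p] (hp : MeasurableSet {o | p o}) :
    ∀ {n : ℕ} {f g : EuclideanSpace ℝ ι → O → ℝ}, (∀ o ∈ S, 0 ≤ M o) →
    Tame U S M n f → Tame U S M n g → Tame U S M n fun θ o => if p o then f θ o else g θ o := by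
  have base : ∀ f g : EuclideanSpace ℝ ι → O → ℝ, (∀ o ∈ S, 0 ≤ M o) →
      PolyBdd U S M f → PolyBdd U S M g →
      PolyBdd U S M fun θ o => if p o then f θ o else g θ o := by
    rintro f g hM ⟨hfm, C, k, hC, hf⟩ ⟨hgm, D, l, hD, hg⟩
    refine ⟨fun θ hθ => Measurable.ite hp (hfm θ hθ) (hgm θ hθ), C + D, k + l, by positivity,
      fun o ho θ hθ => ?_⟩
    have h1 : 1 ≤ 1 + M o := by linarith [hM o ho]
    have hCk : C * (1 + M o) ^ k ≤ C * (1 + M o) ^ (k + l) := by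
      gcongr
      omega
    have hDl : D * (1 + M o) ^ l ≤ D * (1 + M o) ^ (k + l) := by
      gcongr
      omega
    have hC0 : 0 ≤ C * (1 + M o) ^ (k + l) := by positivity
    have hD0 : 0 ≤ D * (1 + M o) ^ (k + l) := by positivity
    rw [add_mul]
    beta_reduce
    split_ifs
    · linarith [hf o ho θ hθ]
    · linarith [hg o ho θ hθ]
  intro n
  induction n with
  | zero => exact fun hM hf hg => base _ _ hM hf hg
  | succ n ih =>
    rintro f g hM ⟨hf, f', hf', hfd⟩ ⟨hg, g', hg', hgd⟩
    refine ⟨base _ _ hM hf hg, fun a θ o => if p o then f' a θ o else g' a θ o,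
      fun a => ih hM (hf' a) (hg' a), fun o ho θ hθ => ?_⟩
    by_cases h : p o
    · simpa [h] using hfd o ho θ hθ
    · simpa [h] using hgd o ho θ hθ

/-- The chain rule, for an outer function `φ` that may depend on the observation. -/
lemma Tame.comp (hM : ∀ o ∈ S, 0 ≤ M o) {φ φ' : O → ℝ → ℝ}
    (hb : PolyBdd U S M fun θ o => φ o (f θ o))
    (hd : ∀ o ∈ S, ∀ θ ∈ U, HasDerivAt (φ o) (φ' o (f θ o)) (f θ o))
    (hf : Tame U S M (n + 1) f) (hφ : Tame U S M n fun θ o => φ' o (f θ o)) :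
    Tame U S M (n + 1) fun θ o => φ o (f θ o) := by
  obtain ⟨-, f', hf', hfd⟩ := hf
  refine ⟨hb, fun a θ o => φ' o (f θ o) * f' a θ o, fun a => hφ.mul hM (hf' a), fun o ho θ hθ => ?_⟩
  refine ((hd o ho θ hθ).comp_hasFDerivAt θ (hfd o ho θ hθ)).congr_fderiv ?_
  ext v
  simp [Finset.mul_sum, mul_assoc]

/-- The induction on the order behind all composition lemmas: if `φ' ∘ f` is as regular as `φ ∘ f`
and `f` are, then `φ ∘ f` is as regular as `f`. -/
lemma Tame.comp_of_ode (hM : ∀ o ∈ S, 0 ≤ M o) {φ φ' : O → ℝ → ℝ}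
    (hb : PolyBdd U S M fun θ o => φ o (f θ o))
    (hd : ∀ o ∈ S, ∀ θ ∈ U, HasDerivAt (φ o) (φ' o (f θ o)) (f θ o))
    (hφ : ∀ n, Tame U S M n f → (Tame U S M n fun θ o => φ o (f θ o)) →
      Tame U S M n fun θ o => φ' o (f θ o)) :
    ∀ n, Tame U S M n f → Tame U S M n fun θ o => φ o (f θ o)
  | 0, _ => hb
  | n + 1, hf => Tame.comp hM hb hd hf (hφ n hf.pred (Tame.comp_of_ode hM hb hd hφ n hf.pred))

lemma Tame.exp (hM : ∀ o ∈ S, 0 ≤ M o) (hf : Tame U S M n f)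
    {C : ℝ} (hC : ∀ o ∈ S, ∀ θ ∈ U, f θ o ≤ C) : Tame U S M n fun θ o => Real.exp (f θ o) :=
  Tame.comp_of_ode hM (φ := fun _ => Real.exp) (φ' := fun _ => Real.exp)
    (PolyBdd.of_bounded (fun θ hθ => Real.measurable_exp.comp (hf.polyBdd.1 θ hθ)) (Real.exp C)
      fun o ho θ hθ => by simpa using hC o ho θ hθ)
    (fun _ _ _ _ => Real.hasDerivAt_exp _) (fun _ _ h => h) n hf

lemma Tame.inv (hM : ∀ o ∈ S, 0 ≤ M o) (hf : Tame U S M n f)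
    {c : ℝ} (hc : 0 < c) (h : ∀ o ∈ S, ∀ θ ∈ U, c ≤ f θ o) : Tame U S M n fun θ o => (f θ o)⁻¹ :=
  Tame.comp_of_ode hM (φ := fun _ t => t⁻¹) (φ' := fun _ t => -(t⁻¹ * t⁻¹))
    (PolyBdd.of_bounded (fun θ hθ => (hf.polyBdd.1 θ hθ).inv) c⁻¹
      fun o ho θ hθ => by
        have := h o ho θ hθ
        rw [abs_of_nonneg (inv_nonneg.2 (hc.le.trans this))]
        exact inv_anti₀ hc this)
    (fun o ho θ hθ => by
      have h0 : f θ o ≠ 0 := (hc.trans_le (h o ho θ hθ)).ne'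
      exact (hasDerivAt_inv h0).congr_deriv (by rw [sq, mul_inv]))
    (fun _ _ h => (h.mul hM h).neg hM) n hf

lemma Tame.log (hM : ∀ o ∈ S, 0 ≤ M o) (hf : Tame U S M n f)
    {c : ℝ} (hc : 0 < c) (h : ∀ o ∈ S, ∀ θ ∈ U, c ≤ f θ o) :
    Tame U S M n fun θ o => Real.log (f θ o) := by
  refine Tame.comp_of_ode hM (φ := fun _ => Real.log) (φ' := fun _ t => t⁻¹) ?_
    (fun o ho θ hθ => Real.hasDerivAt_log (hc.trans_le (h o ho θ hθ)).ne')
    (fun _ h' _ => h'.inv hM hc h) n hf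
  have h1 : PolyBdd U S M fun θ o => f θ o + |Real.log c| :=
    hf.polyBdd.add hM (PolyBdd.of_bounded (fun _ _ => measurable_const) |Real.log c| (by simp))
  obtain ⟨-, C, k, hC, hb⟩ := h1
  refine ⟨fun θ hθ => Real.measurable_log.comp (hf.polyBdd.1 θ hθ), C, k, hC, fun o ho θ hθ => ?_⟩
  have hcf := h o ho θ hθ
  refine le_trans ?_ (hb o ho θ hθ)
  rw [abs_of_nonneg (by linarith [abs_nonneg (Real.log c)] : 0 ≤ f θ o + |Real.log c|)]
  rw [abs_le]
  constructor
  · have := Real.log_le_log hc hcf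
    linarith [neg_abs_le (Real.log c)]
  · have := Real.log_le_sub_one_of_pos (hc.trans_le hcf)
    linarith [abs_nonneg (Real.log c)]

end Tame

/-! ### The standard normal distribution function -/

/-- The standard normal density. -/
def stdNormalPDF (t : ℝ) : ℝ := gaussianPDFReal 0 1 t

lemma stdNormalPDF_eq (t : ℝ) :
    stdNormalPDF t = (√(2 * Real.pi))⁻¹ * Real.exp (-t ^ 2 / 2) := by
  simp [stdNormalPDF, gaussianPDFReal]

lemma stdNormalPDF_pos (t : ℝ) : 0 < stdNormalPDF t := gaussianPDFReal_pos 0 1 t one_ne_zero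

lemma hasDerivAt_stdNormalPDF (t : ℝ) : HasDerivAt stdNormalPDF (-t * stdNormalPDF t) t := by
  have h : HasDerivAt (fun t : ℝ => (√(2 * Real.pi))⁻¹ * Real.exp (-t ^ 2 / 2))
      ((√(2 * Real.pi))⁻¹ * (Real.exp (-t ^ 2 / 2) * (-(2 * t) / 2))) t := by
    have h1 : HasDerivAt (fun t : ℝ => -t ^ 2 / 2) (-(2 * t) / 2) t := by
      simpa using ((hasDerivAt_pow 2 t).neg.div_const 2)
    exact (h1.exp).const_mul _
  rw [show stdNormalPDF = fun t => (√(2 * Real.pi))⁻¹ * Real.exp (-t ^ 2 / 2) from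
    funext stdNormalPDF_eq]
  exact h.congr_deriv (by ring)

lemma continuous_stdNormalPDF : Continuous stdNormalPDF :=
  continuous_iff_continuousAt.2 fun t => (hasDerivAt_stdNormalPDF t).continuousAt

lemma stdNormalPDF_le_one (t : ℝ) : stdNormalPDF t ≤ 1 := by
  rw [stdNormalPDF_eq]
  have h1 : (√(2 * Real.pi))⁻¹ ≤ 1 :=
    inv_le_one_of_one_le₀ (Real.one_le_sqrt.2 (by linarith [Real.pi_gt_three]))
  have h2 : Real.exp (-t ^ 2 / 2) ≤ 1 := Real.exp_le_one_iff.2 (by nlinarith [sq_nonneg t])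
  exact mul_le_one₀ h1 (Real.exp_pos _).le h2

lemma stdNormalCDF_eq_integral (t : ℝ) : stdNormalCDF t = ∫ x in Iic t, stdNormalPDF x := by
  rw [stdNormalCDF, cdf_eq_real, measureReal_def, gaussianReal_apply_eq_integral 0 one_ne_zero]
  exact ENNReal.toReal_ofReal (integral_nonneg fun x => gaussianPDFReal_nonneg 0 1 x)

lemma hasDerivAt_stdNormalCDF (t : ℝ) : HasDerivAt stdNormalCDF (stdNormalPDF t) t := by
  have hi : Integrable stdNormalPDF := integrable_gaussianPDFReal 0 1
  have h : stdNormalCDF = fun t => stdNormalCDF 0 + ∫ x in (0 : ℝ)..t, stdNormalPDF x := by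
    funext t
    rw [stdNormalCDF_eq_integral, stdNormalCDF_eq_integral,
      ← intervalIntegral.integral_Iic_sub_Iic hi.integrableOn hi.integrableOn]
    ring
  rw [h]
  exact (intervalIntegral.integral_hasDerivAt_right (hi.intervalIntegrable)
    continuous_stdNormalPDF.stronglyMeasurable.stronglyMeasurableAtFilter
    continuous_stdNormalPDF.continuousAt).const_add _

lemma stdNormalCDF_nonneg (t : ℝ) : 0 ≤ stdNormalCDF t := cdf_nonneg _ t

lemma stdNormalCDF_le_one (t : ℝ) : stdNormalCDF t ≤ 1 := cdf_le_one _ t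

lemma measurable_stdNormalCDF : Measurable stdNormalCDF :=
  (continuous_iff_continuousAt.2 fun t => (hasDerivAt_stdNormalCDF t).continuousAt).measurable

/-- A crude form of the bound on Mills' ratio: on the interval of length `1 / (1 + |t|)` to the left
of `t` the density is comparable with its value at `t`. -/
lemma stdNormalPDF_le_mul_stdNormalCDF (t : ℝ) :
    stdNormalPDF t ≤ Real.exp (3 / 2) * (1 + |t|) * stdNormalCDF t := by
  have ha : 0 < 1 + |t| := by positivity
  set δ : ℝ := (1 + |t|)⁻¹ with hδ
  have hδ0 : 0 < δ := inv_pos.2 ha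
  obtain ⟨s, hs, hs'⟩ := exists_hasDerivAt_eq_slope stdNormalCDF stdNormalPDF
    (show t - δ < t by linarith)
    (fun x _ => (hasDerivAt_stdNormalCDF x).continuousAt.continuousWithinAt)
    (fun x _ => hasDerivAt_stdNormalCDF x)
  have h1 : stdNormalPDF s * δ ≤ stdNormalCDF t := by
    rw [hs', show t - (t - δ) = δ by ring, div_mul_cancel₀ _ hδ0.ne']
    linarith [stdNormalCDF_nonneg (t - δ)]
  have hδ1 : δ ≤ 1 := inv_le_one_of_one_le₀ (by linarith [abs_nonneg t])
  have hδt : δ * |t| ≤ 1 := by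
    rw [hδ, inv_mul_le_iff₀ ha]
    linarith
  have hs2 : s ^ 2 ≤ t ^ 2 + 3 := by
    have h4 : |s| ≤ |t| + δ := by
      have := abs_sub_abs_le_abs_sub s t
      have h5 : |s - t| ≤ δ := abs_le.2 ⟨by linarith [hs.1], by linarith [hs.2]⟩
      linarith
    have : |s| ^ 2 ≤ (|t| + δ) ^ 2 := pow_le_pow_left₀ (abs_nonneg s) h4 2
    rw [sq_abs] at this
    nlinarith [sq_abs t]
  have h2 : stdNormalPDF t ≤ Real.exp (3 / 2) * stdNormalPDF s := by
    rw [stdNormalPDF_eq, stdNormalPDF_eq, mul_left_comm, ← Real.exp_add]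
    gcongr
    linarith
  have h3 : stdNormalPDF s ≤ (1 + |t|) * stdNormalCDF t := by
    have := mul_le_mul_of_nonneg_left h1 ha.le
    rwa [mul_left_comm, hδ, mul_inv_cancel₀ ha.ne', mul_one] at this
  calc stdNormalPDF t ≤ Real.exp (3 / 2) * stdNormalPDF s := h2
    _ ≤ Real.exp (3 / 2) * ((1 + |t|) * stdNormalCDF t) := by gcongr
    _ = _ := by ring

lemma stdNormalCDF_pos (t : ℝ) : 0 < stdNormalCDF t := by
  have h := (stdNormalPDF_pos t).trans_le (stdNormalPDF_le_mul_stdNormalCDF t)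
  exact (pos_iff_pos_of_mul_pos h).1 (by positivity)

lemma abs_log_stdNormalCDF_le (t : ℝ) :
    |Real.log (stdNormalCDF t)| ≤ (3 + Real.log (√(2 * Real.pi))) * (1 + |t|) ^ 2 := by
  have ha : 0 < 1 + |t| := by positivity
  have hp := stdNormalCDF_pos t
  have h0 : Real.log (stdNormalCDF t) ≤ 0 := Real.log_nonpos hp.le (stdNormalCDF_le_one t)
  rw [abs_of_nonpos h0]
  have h1 := Real.log_le_log (stdNormalPDF_pos t) (stdNormalPDF_le_mul_stdNormalCDF t)
  rw [Real.log_mul (by positivity) hp.ne', Real.log_mul (Real.exp_pos _).ne' ha.ne', Real.log_exp,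
    stdNormalPDF_eq, Real.log_mul (by positivity) (Real.exp_pos _).ne', Real.log_exp,
    Real.log_inv] at h1
  have h2 := Real.log_le_sub_one_of_pos ha
  have h3 : 0 ≤ Real.log (√(2 * Real.pi)) :=
    Real.log_nonneg (Real.one_le_sqrt.2 (by linarith [Real.pi_gt_three]))
  have h4 : 1 ≤ (1 + |t|) ^ 2 := one_le_pow₀ (by linarith [abs_nonneg t])
  nlinarith [sq_abs t, abs_nonneg t, mul_le_mul_of_nonneg_left h4 h3]

/-! ### The Box–Cox logarithm -/

/-- The logarithm with parameter `ε`: `log (1 + ε x) / ε`, read as its limit `x` if `ε = 0`. The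
logarithm of a generalized extreme-value variable on the Fréchet scale is of this form. -/
def boxLog (ε x : ℝ) : ℝ := if ε = 0 then x else Real.log (1 + ε * x) / ε

lemma boxLog_zero_right (ε : ℝ) : boxLog ε 0 = 0 := by simp [boxLog]

lemma measurable_boxLog {α : Type*} [MeasurableSpace α] {f g : α → ℝ} (hf : Measurable f)
    (hg : Measurable g) : Measurable fun a => boxLog (f a) (g a) :=
  Measurable.ite (hf (measurableSet_singleton 0)) hg
    ((Real.measurable_log.comp ((hf.mul hg).const_add 1)).div hf)

lemma hasDerivAt_boxLog {ε x : ℝ} (h : 0 < 1 + ε * x) :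
    HasDerivAt (boxLog ε) (1 + ε * x)⁻¹ x := by
  by_cases hε : ε = 0
  · have : boxLog ε = fun x => x := by funext y; simp [boxLog, hε]
    rw [this, hε]
    simpa using hasDerivAt_id' x
  · have : boxLog ε = fun x => Real.log (1 + ε * x) / ε := by funext y; simp [boxLog, hε]
    rw [this]
    have h1 : HasDerivAt (fun x => 1 + ε * x) ε x := by
      simpa using ((hasDerivAt_id' x).const_mul ε).const_add 1
    refine ((h1.log h.ne').div_const ε).congr_deriv ?_
    field_simp

lemma boxLog_le {ε x : ℝ} (hε : 0 ≤ ε) (h : 0 < 1 + ε * x) : boxLog ε x ≤ x := by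
  rcases hε.eq_or_lt with rfl | hε
  · simp [boxLog]
  · rw [boxLog, if_neg hε.ne', div_le_iff₀ hε]
    linarith [Real.log_le_sub_one_of_pos h]

lemma le_boxLog {ε x : ℝ} (hε : 0 ≤ ε) (h : 0 < 1 + ε * x) : x / (1 + ε * x) ≤ boxLog ε x := by
  rcases hε.eq_or_lt with rfl | hε
  · simp [boxLog]
  · rw [boxLog, if_neg hε.ne', le_div_iff₀ hε]
    have := Real.one_sub_inv_le_log_of_pos h
    refine le_trans (le_of_eq ?_) this
    rw [eq_sub_iff_add_eq, div_mul_eq_mul_div, mul_comm x, inv_eq_one_div, ← add_div, add_comm,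
      div_self h.ne']

lemma abs_boxLog_le {ε x c : ℝ} (hε : 0 ≤ ε) (hc : 0 < c) (h : c ≤ 1 + ε * x) :
    |boxLog ε x| ≤ |x| * (1 + c⁻¹) := by
  have h0 : 0 < 1 + ε * x := hc.trans_le h
  have h1 := boxLog_le hε h0
  have h2 := le_boxLog hε h0
  have h3 : |x / (1 + ε * x)| ≤ |x| * c⁻¹ := by
    rw [abs_div, abs_of_pos h0, div_eq_mul_inv]
    gcongr
  have h4 : 0 ≤ |x| * c⁻¹ := by positivity
  rw [mul_add, mul_one, abs_le]
  constructor
  · linarith [neg_abs_le (x / (1 + ε * x)), abs_nonneg x]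
  · linarith [le_abs_self x]

lemma boxLog_nonneg {ε x : ℝ} (hε : 0 ≤ ε) (hx : 0 ≤ x) : 0 ≤ boxLog ε x :=
  (div_nonneg hx (by positivity)).trans (le_boxLog hε (by positivity))

lemma boxLog_mono {ε x y : ℝ} (hε : 0 ≤ ε) (hx : 0 < 1 + ε * x) (hxy : x ≤ y) :
    boxLog ε x ≤ boxLog ε y := by
  rcases hε.eq_or_lt with rfl | hε
  · simpa [boxLog] using hxy
  · rw [boxLog, boxLog, if_neg hε.ne', if_neg hε.ne']
    gcongr

/-- `boxLog ε` grows at most linearly, uniformly in `ε`. -/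
lemma boxLog_mul_le {ε x b : ℝ} (hε : 0 ≤ ε) (hx : 0 ≤ x) (hb : 1 ≤ b) :
    boxLog ε (b * x) ≤ b * boxLog ε x := by
  rcases hε.eq_or_lt with rfl | hε
  · simp [boxLog]
  · rw [boxLog, boxLog, if_neg hε.ne', if_neg hε.ne', ← mul_div_assoc]
    have h0 : 0 ≤ ε * x := by positivity
    have h1 := one_add_mul_self_le_rpow_one_add (by linarith : -1 ≤ ε * x) hb
    have h2 := Real.log_le_log (by positivity) h1
    rw [Real.log_rpow (by positivity)] at h2
    rw [show ε * (b * x) = b * (ε * x) by ring]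
    gcongr

/-! ### Regularity of compositions -/

section Tame

variable {ι : Type*} [Fintype ι] {O : Type*} [MeasurableSpace O]
  {U : Set (EuclideanSpace ℝ ι)} {S : Set O} {M : O → ℝ} {n : ℕ}
  {f g : EuclideanSpace ℝ ι → O → ℝ}

lemma Tame.stdNormalPDF (hM : ∀ o ∈ S, 0 ≤ M o) (hf : Tame U S M n f) :
    Tame U S M n fun θ o => stdNormalPDF (f θ o) :=
  Tame.comp_of_ode hM (φ := fun _ => MaxStable.stdNormalPDF)
    (φ' := fun _ t => -t * MaxStable.stdNormalPDF t)
    (PolyBdd.of_bounded (fun θ hθ => continuous_stdNormalPDF.measurable.comp (hf.polyBdd.1 θ hθ)) 1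
      fun o _ θ _ => by
        rw [abs_of_pos (stdNormalPDF_pos _)]
        exact stdNormalPDF_le_one _)
    (fun _ _ _ _ => hasDerivAt_stdNormalPDF _) (fun _ h h' => (h.neg hM).mul hM h') n hf

lemma Tame.stdNormalCDF (hM : ∀ o ∈ S, 0 ≤ M o) (hf : Tame U S M n f) :
    Tame U S M n fun θ o => stdNormalCDF (f θ o) :=
  Tame.comp_of_ode hM (φ := fun _ => MaxStable.stdNormalCDF)
    (φ' := fun _ => MaxStable.stdNormalPDF)
    (PolyBdd.of_bounded (fun θ hθ => measurable_stdNormalCDF.comp (hf.polyBdd.1 θ hθ)) 1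
      fun o _ θ _ => by
        rw [abs_of_pos (stdNormalCDF_pos _)]
        exact stdNormalCDF_le_one _)
    (fun _ _ _ _ => hasDerivAt_stdNormalCDF _) (fun _ h _ => h.stdNormalPDF hM) n hf

/-- The hazard-type function `φ / Φ` solves the equation `r' = -r (t + r)`. -/
lemma Tame.stdNormalPDF_div_stdNormalCDF (hM : ∀ o ∈ S, 0 ≤ M o) (hf : Tame U S M n f) :
    Tame U S M n fun θ o =>
      MaxStable.stdNormalPDF (f θ o) / MaxStable.stdNormalCDF (f θ o) := by
  refine Tame.comp_of_ode hM
    (φ := fun _ t => MaxStable.stdNormalPDF t / MaxStable.stdNormalCDF t)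
    (φ' := fun _ t => -(MaxStable.stdNormalPDF t / MaxStable.stdNormalCDF t *
      (t + MaxStable.stdNormalPDF t / MaxStable.stdNormalCDF t))) ?_ ?_
    (fun _ h h' => (h'.mul hM (h.add hM h')).neg hM) n hf
  · obtain ⟨hm, C, k, hC, hb⟩ := hf.polyBdd
    refine PolyBdd.of_bound (fun θ hθ => (continuous_stdNormalPDF.measurable.comp (hm θ hθ)).div
      (measurable_stdNormalCDF.comp (hm θ hθ))) (Real.exp (3 / 2) * (1 + C)) k
      (fun o ho θ hθ => ?_) hM
    have h1 : 1 ≤ (1 + M o) ^ k := one_le_pow₀ (by linarith [hM o ho])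
    rw [abs_of_pos (div_pos (stdNormalPDF_pos _) (stdNormalCDF_pos _)),
      div_le_iff₀ (stdNormalCDF_pos _)]
    refine (stdNormalPDF_le_mul_stdNormalCDF _).trans ?_
    refine mul_le_mul_of_nonneg_right ?_ (stdNormalCDF_nonneg _)
    rw [mul_assoc]
    gcongr
    linarith [hb o ho θ hθ]
  · intro o _ θ _
    have h0 := (stdNormalCDF_pos (f θ o)).ne'
    refine ((hasDerivAt_stdNormalPDF _).div (hasDerivAt_stdNormalCDF _) h0).congr_deriv ?_
    field_simp
    ring

lemma Tame.log_stdNormalCDF (hM : ∀ o ∈ S, 0 ≤ M o) (hf : Tame U S M n f) :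
    Tame U S M n fun θ o => Real.log (MaxStable.stdNormalCDF (f θ o)) := by
  refine Tame.comp_of_ode hM (φ := fun _ t => Real.log (MaxStable.stdNormalCDF t))
    (φ' := fun _ t => MaxStable.stdNormalPDF t / MaxStable.stdNormalCDF t) ?_
    (fun o _ θ _ => (hasDerivAt_stdNormalCDF _).log (stdNormalCDF_pos _).ne')
    (fun _ h _ => h.stdNormalPDF_div_stdNormalCDF hM) n hf
  obtain ⟨hm, C, k, hC, hb⟩ := hf.polyBdd
  have h3 : 0 ≤ Real.log (√(2 * Real.pi)) :=
    Real.log_nonneg (Real.one_le_sqrt.2 (by linarith [Real.pi_gt_three]))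
  refine PolyBdd.of_bound (fun θ hθ => Real.measurable_log.comp
    (measurable_stdNormalCDF.comp (hm θ hθ)))
    ((3 + Real.log (√(2 * Real.pi))) * (1 + C) ^ 2) (k * 2) (fun o ho θ hθ => ?_) hM
  have h1 : 1 ≤ (1 + M o) ^ k := one_le_pow₀ (by linarith [hM o ho])
  refine (abs_log_stdNormalCDF_le _).trans ?_
  rw [mul_assoc, pow_mul, ← mul_pow]
  gcongr
  linarith [hb o ho θ hθ]

/-- The logistic function `e ^ t / (1 + e ^ t)` solves the equation `s' = s (1 - s)`. -/
lemma Tame.logistic (hM : ∀ o ∈ S, 0 ≤ M o) (hf : Tame U S M n f) :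
    Tame U S M n fun θ o => Real.exp (f θ o) / (1 + Real.exp (f θ o)) := by
  refine Tame.comp_of_ode hM (φ := fun _ t => Real.exp t / (1 + Real.exp t))
    (φ' := fun _ t => Real.exp t / (1 + Real.exp t) * (1 - Real.exp t / (1 + Real.exp t))) ?_ ?_
    (fun _ h h' => h'.mul hM ((Tame.const 1 _).sub hM h')) n hf
  · refine PolyBdd.of_bounded (fun θ hθ => ?_) 1 fun o _ θ _ => ?_
    · have := Real.measurable_exp.comp (hf.polyBdd.1 θ hθ)
      exact this.div (this.const_add 1)
    · rw [abs_of_pos (by positivity), div_le_one (by positivity)]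
      linarith
  · intro o _ θ _
    have h := Real.hasDerivAt_exp (f θ o)
    have h0 : 1 + Real.exp (f θ o) ≠ 0 := by positivity
    refine (h.div (h.const_add 1) h0).congr_deriv ?_
    field_simp

lemma Tame.log_one_add_exp (hM : ∀ o ∈ S, 0 ≤ M o) (hf : Tame U S M n f) :
    Tame U S M n fun θ o => Real.log (1 + Real.exp (f θ o)) := by
  refine Tame.comp_of_ode hM (φ := fun _ t => Real.log (1 + Real.exp t))
    (φ' := fun _ t => Real.exp t / (1 + Real.exp t)) ?_
    (fun o _ θ _ => ((Real.hasDerivAt_exp _).const_add 1).log (by positivity))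
    (fun _ h _ => h.logistic hM) n hf
  obtain ⟨hm, C, k, hC, hb⟩ := hf.polyBdd
  refine PolyBdd.of_bound (fun θ hθ => Real.measurable_log.comp
    ((Real.measurable_exp.comp (hm θ hθ)).const_add 1)) (1 + C) k (fun o ho θ hθ => ?_) hM
  have h1 : 1 ≤ (1 + M o) ^ k := one_le_pow₀ (by linarith [hM o ho])
  have h2 : Real.log (1 + Real.exp (f θ o)) ≤ 1 + |f θ o| := by
    rw [Real.log_le_iff_le_exp (by positivity), Real.exp_add]
    have h3 : Real.exp (f θ o) ≤ Real.exp |f θ o| := Real.exp_le_exp.2 (le_abs_self _)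
    have h4 : 1 ≤ Real.exp |f θ o| := Real.one_le_exp (abs_nonneg _)
    have h5 : 2 ≤ Real.exp 1 := by linarith [Real.add_one_le_exp (1 : ℝ)]
    nlinarith
  rw [abs_of_nonneg (Real.log_nonneg (by linarith [Real.exp_pos (f θ o)]))]
  linarith [hb o ho θ hθ]

lemma Tame.log_exp_add_exp (hM : ∀ o ∈ S, 0 ≤ M o) (hf : Tame U S M n f) (hg : Tame U S M n g) :
    Tame U S M n fun θ o => Real.log (Real.exp (f θ o) + Real.exp (g θ o)) := by
  have h := hg.add hM ((hf.sub hM hg).log_one_add_exp hM)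
  convert h using 3 with θ o
  have h1 : Real.exp (f θ o) + Real.exp (g θ o) =
      Real.exp (g θ o) * (1 + Real.exp (f θ o - g θ o)) := by
    rw [mul_add, ← Real.exp_add]
    simp [add_comm]
  rw [h1, Real.log_mul (Real.exp_pos _).ne' (by positivity), Real.log_exp]

lemma Tame.boxLog (hM : ∀ o ∈ S, 0 ≤ M o) (hf : Tame U S M n f) {ε : O → ℝ} (hεm : Measurable ε)
    {R : ℝ} (hε : ∀ o ∈ S, 0 ≤ ε o) (hR : ∀ o ∈ S, ε o ≤ R) {c : ℝ} (hc : 0 < c)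
    (h : ∀ o ∈ S, ∀ θ ∈ U, c ≤ 1 + ε o * f θ o) :
    Tame U S M n fun θ o => MaxStable.boxLog (ε o) (f θ o) := by
  refine Tame.comp_of_ode hM (φ := fun o => MaxStable.boxLog (ε o))
    (φ' := fun o t => (1 + ε o * t)⁻¹) ?_
    (fun o ho θ hθ => hasDerivAt_boxLog (hc.trans_le (h o ho θ hθ)))
    (fun n hf _ => ((Tame.const 1 n).add hM ((Tame.obs_of_bounded hεm R (fun o ho => by
      rw [abs_of_nonneg (hε o ho)]; exact hR o ho) n).mul hM hf)).inv hM hc h) n hf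
  obtain ⟨hm, C, k, hC, hb⟩ := hf.polyBdd
  refine ⟨fun θ hθ => measurable_boxLog hεm (hm θ hθ), C * (1 + c⁻¹), k, by positivity,
    fun o ho θ hθ => (abs_boxLog_le (hε o ho) hc (h o ho θ hθ)).trans ?_⟩
  rw [mul_right_comm]
  gcongr
  exact hb o ho θ hθ

/-- `boxLog ε (r e ^ f)` where `ε`, `r` depend on the observation only and `M` dominates
`boxLog ε r`. The bounds are uniform as `ε → 0` and `r → ∞`: with `D = (1 + ε r e ^ t)⁻¹` and
`Q = r e ^ t D`, the derivatives in `t` are `boxLog' = Q`, `Q' = Q D`, `D' = -(1 - D) D`. -/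
lemma Tame.boxLog_mul_exp (hM : ∀ o ∈ S, 0 ≤ M o) (hf : Tame U S M n f) {ε r : O → ℝ}
    (hεm : Measurable ε) (hrm : Measurable r) (hε : ∀ o ∈ S, 0 ≤ ε o) (hr : ∀ o ∈ S, 0 ≤ r o)
    (hrM : ∀ o ∈ S, MaxStable.boxLog (ε o) (r o) ≤ M o) {C : ℝ} (hC : ∀ o ∈ S, ∀ θ ∈ U, f θ o ≤ C) :
    Tame U S M n fun θ o => MaxStable.boxLog (ε o) (r o * Real.exp (f θ o)) := by
  have hpos : ∀ o ∈ S, ∀ t, 0 < 1 + ε o * (r o * Real.exp t) := fun o ho t => by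
    have := hε o ho
    have := hr o ho
    positivity
  have hbd : ∀ o ∈ S, ∀ θ ∈ U,
      MaxStable.boxLog (ε o) (r o * Real.exp (f θ o)) ≤ Real.exp |C| * (1 + M o) ^ 1 := by
    intro o ho θ hθ
    have h0 := hr o ho
    have h1 : r o * Real.exp (f θ o) ≤ Real.exp |C| * r o := by
      rw [mul_comm]
      gcongr
      exact (hC o ho θ hθ).trans (le_abs_self C)
    refine (boxLog_mono (hε o ho) (hpos o ho _) h1).trans ?_
    refine (boxLog_mul_le (hε o ho) h0 (Real.one_le_exp (abs_nonneg C))).trans ?_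
    gcongr
    linarith [hrM o ho]
  have hem : ∀ θ ∈ U, Measurable fun o => r o * Real.exp (f θ o) := fun θ hθ =>
    hrm.mul (Real.measurable_exp.comp (hf.polyBdd.1 θ hθ))
  have hdm : ∀ θ ∈ U, Measurable fun o => (1 + ε o * (r o * Real.exp (f θ o)))⁻¹ := fun θ hθ =>
    ((hεm.mul (hem θ hθ)).const_add 1).inv
  have hder : ∀ o, ∀ t, HasDerivAt (fun t => 1 + ε o * (r o * Real.exp t))
      (ε o * (r o * Real.exp t)) t := fun o t =>
    (((Real.hasDerivAt_exp t).const_mul _).const_mul _).const_add 1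
  have hD : ∀ n, Tame U S M n f →
      Tame U S M n fun θ o => (1 + ε o * (r o * Real.exp (f θ o)))⁻¹ := by
    refine Tame.comp_of_ode hM (φ := fun o t => (1 + ε o * (r o * Real.exp t))⁻¹)
      (φ' := fun o t => -((1 - (1 + ε o * (r o * Real.exp t))⁻¹) *
        (1 + ε o * (r o * Real.exp t))⁻¹)) ?_ ?_
      (fun n _ h => ((((Tame.const 1 n).sub hM h).mul hM h)).neg hM)
    · refine PolyBdd.of_bounded hdm 1 fun o ho θ hθ => ?_
      have := hε o ho
      have := hr o ho
      rw [abs_of_pos (by positivity)]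
      exact inv_le_one_of_one_le₀
          (by linarith [show 0 ≤ ε o * (r o * Real.exp (f θ o)) by positivity])
    · intro o ho θ _
      have h0 := (hpos o ho (f θ o)).ne'
      refine ((hder o _).inv h0).congr_deriv ?_
      generalize ε o * (r o * Real.exp (f θ o)) = a at h0 ⊢
      field_simp
      ring
  have hQ : ∀ n, Tame U S M n f → Tame U S M n fun θ o =>
      r o * Real.exp (f θ o) * (1 + ε o * (r o * Real.exp (f θ o)))⁻¹ := by
    refine Tame.comp_of_ode hM
      (φ := fun o t => r o * Real.exp t * (1 + ε o * (r o * Real.exp t))⁻¹)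
      (φ' := fun o t => r o * Real.exp t * (1 + ε o * (r o * Real.exp t))⁻¹ *
        (1 + ε o * (r o * Real.exp t))⁻¹) ?_ ?_ (fun n hf h => h.mul hM (hD n hf))
    · refine PolyBdd.of_bound (fun θ hθ => (hem θ hθ).mul (hdm θ hθ)) (Real.exp |C|) 1
        (fun o ho θ hθ => ?_) hM
      have h1 := hε o ho
      have h2 := hr o ho
      rw [abs_of_nonneg (by positivity), ← div_eq_mul_inv]
      exact (le_boxLog (hε o ho) (hpos o ho _)).trans (hbd o ho θ hθ)
    · intro o ho θ _
      have h0 := (hpos o ho (f θ o)).ne'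
      refine (((Real.hasDerivAt_exp (f θ o)).const_mul (r o)).mul
        ((hder o _).inv h0)).congr_deriv ?_
      simp only [Pi.inv_apply]
      field_simp
      ring
  refine Tame.comp_of_ode hM (φ := fun o t => MaxStable.boxLog (ε o) (r o * Real.exp t))
    (φ' := fun o t => r o * Real.exp t * (1 + ε o * (r o * Real.exp t))⁻¹) ?_ ?_
    (fun n hf _ => hQ n hf) n hf
  · refine PolyBdd.of_bound (fun θ hθ => measurable_boxLog hεm (hem θ hθ)) (Real.exp |C|) 1
      (fun o ho θ hθ => ?_) hM
    rw [abs_of_nonneg (boxLog_nonneg (hε o ho) (mul_nonneg (hr o ho) (Real.exp_pos _).le))]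
    exact hbd o ho θ hθ
  · intro o ho θ _
    refine ((hasDerivAt_boxLog (hpos o ho (f θ o))).comp (f θ o)
      ((Real.hasDerivAt_exp (f θ o)).const_mul (r o))).congr_deriv ?_
    ring

end Tame

/-! ### Laws of large numbers and the central limit theorem -/

section Limit

variable {Ω : Type*} [MeasurableSpace Ω] {P : Measure Ω}

/-- The events `A n` have probability tending to one (in terms of the outer measure of the
complements, so that no measurability is required). -/
def Whp (P : Measure Ω) (A : ℕ → Ω → Prop) : Prop :=
  Tendsto (fun n => P {ω | ¬ A n ω}) atTop (𝓝 0)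

lemma Whp.mono {A B : ℕ → Ω → Prop} (hA : Whp P A) (h : ∀ᶠ n in atTop, ∀ ω, A n ω → B n ω) :
    Whp P B :=
  tendsto_of_tendsto_of_tendsto_of_le_of_le' tendsto_const_nhds hA (Eventually.of_forall fun _ =>
    zero_le) (h.mono fun _ hn => measure_mono fun _ hω hA' => hω (hn _ hA'))

lemma Whp.and {A B : ℕ → Ω → Prop} (hA : Whp P A) (hB : Whp P B) :
    Whp P fun n ω => A n ω ∧ B n ω := by
  have h := Tendsto.add hA hB
  rw [add_zero] at h
  refine tendsto_of_tendsto_of_tendsto_of_le_of_le tendsto_const_nhds h (fun _ => zero_le)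
    fun n => ?_
  refine (measure_mono ?_).trans (measure_union_le _ _)
  intro ω hω
  by_cases h : A n ω
  · exact Or.inr fun h' => hω ⟨h, h'⟩
  · exact Or.inl h

lemma Whp.of_ae {A : ℕ → Ω → Prop} (h : ∀ n, ∀ᵐ ω ∂P, A n ω) : Whp P A := by
  have : (fun n => P {ω | ¬ A n ω}) = fun _ => 0 := funext fun n => ae_iff.1 (h n)
  rw [Whp, this]
  exact tendsto_const_nhds

lemma whp_norm_sub_lt {V : Type*} [NormedAddCommGroup V] {X : ℕ → Ω → V} {c : V}
    (h : TendstoInMeasure P X atTop fun _ => c) {ε : ℝ} (hε : 0 < ε) :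
    Whp P fun n ω => ‖X n ω - c‖ < ε := by
  simpa [Whp, not_lt] using tendstoInMeasure_iff_norm.1 h ε hε

lemma tendstoInMeasure_of_whp {V : Type*} [NormedAddCommGroup V] {X : ℕ → Ω → V} {c : V}
    (h : ∀ ε > 0, Whp P fun n ω => ‖X n ω - c‖ < ε) :
    TendstoInMeasure P X atTop fun _ => c :=
  tendstoInMeasure_iff_norm.2 fun ε hε => by simpa [Whp, not_lt] using h ε hε

/-- If, for every `ε`, there are events `A n` of probability at least `1 - ε` that imply `B n`, up
to events of vanishing probability, then the `B n` have probability tending to one. -/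
lemma Whp.of_forall_pos {B : ℕ → Ω → Prop}
    (h : ∀ ε : ENNReal, 0 < ε → ∃ A : ℕ → Ω → Prop, (∀ᶠ n in atTop, P {ω | ¬ A n ω} ≤ ε) ∧
      Whp P fun n ω => A n ω → B n ω) : Whp P B := by
  rw [Whp, ENNReal.tendsto_nhds_zero]
  intro ε hε
  obtain ⟨A, hA, hAB⟩ := h (ε / 2) (ENNReal.half_pos hε.ne')
  filter_upwards [hA, ENNReal.tendsto_nhds_zero.1 hAB (ε / 2) (ENNReal.half_pos hε.ne')]
    with n h1 h2
  calc P {ω | ¬ B n ω} ≤ P ({ω | ¬ A n ω} ∪ {ω | ¬ (A n ω → B n ω)}) := by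
        refine measure_mono fun ω hω => ?_
        by_cases h : A n ω
        · exact Or.inr fun h' => hω (h' h)
        · exact Or.inl h
    _ ≤ _ := measure_union_le _ _
    _ ≤ ε / 2 + ε / 2 := add_le_add h1 h2
    _ = ε := ENNReal.add_halves ε

/-- `Z 0, Z 1, …` are independent with law `μ`. -/
structure IsSample {O : Type*} [MeasurableSpace O] (P : Measure Ω) (Z : ℕ → Ω → O)
    (μ : Measure O) : Prop where
  measurable : ∀ i, Measurable (Z i)
  indep : iIndepFun Z P
  law : ∀ i, P.map (Z i) = μ

/-- The sample mean of `g`. -/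
def sampleMean {O V : Type*} [AddCommGroup V] [Module ℝ V] (Z : ℕ → Ω → O) (g : O → V)
    (n : ℕ) (ω : Ω) : V := (n : ℝ)⁻¹ • ∑ i ∈ Finset.range n, g (Z i ω)

variable {O : Type*} [MeasurableSpace O] {Z : ℕ → Ω → O} {μ : Measure O}

lemma IsSample.ae_forall (hZ : IsSample P Z μ) {p : O → Prop} (h : ∀ᵐ o ∂μ, p o) :
    ∀ᵐ ω ∂P, ∀ i, p (Z i ω) := by
  refine ae_all_iff.2 fun i => ?_
  rw [← hZ.law i] at h
  exact ae_of_ae_map (hZ.measurable i).aemeasurable h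

lemma IsSample.identDistrib (hZ : IsSample P Z μ) {V : Type*} [MeasurableSpace V] {g : O → V}
    (hg : AEMeasurable g μ) (i : ℕ) :
    IdentDistrib (fun ω => g (Z i ω)) (fun ω => g (Z 0 ω)) P P := by
  have h : IdentDistrib (Z i) (Z 0) P P := ⟨(hZ.measurable i).aemeasurable,
    (hZ.measurable 0).aemeasurable, by rw [hZ.law i, hZ.law 0]⟩
  exact h.comp_of_aemeasurable (by rwa [hZ.law i])

lemma IsSample.indep_comp (hZ : IsSample P Z μ) {V : Type*} [MeasurableSpace V] {g : O → V}
    (hg : AEMeasurable g μ) : iIndepFun (fun i ω => g (Z i ω)) P :=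
  hZ.indep.comp₀ (fun _ => g) (fun i => (hZ.measurable i).aemeasurable)
    (fun i => by rwa [hZ.law i])

lemma IsSample.integral_comp (hZ : IsSample P Z μ) {V : Type*} [NormedAddCommGroup V]
    [NormedSpace ℝ V] {g : O → V} (hg : AEStronglyMeasurable g μ) (i : ℕ) :
    ∫ ω, g (Z i ω) ∂P = ∫ o, g o ∂μ := by
  rw [← hZ.law i, integral_map (hZ.measurable i).aemeasurable (by rwa [hZ.law i])]

variable [IsProbabilityMeasure P]

/-- The weak law of large numbers. -/
lemma IsSample.tendstoInMeasure_sampleMean (hZ : IsSample P Z μ) {V : Type*}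
    [NormedAddCommGroup V] [NormedSpace ℝ V] [CompleteSpace V] [MeasurableSpace V] [BorelSpace V]
    {g : O → V} (hg : Integrable g μ) :
    TendstoInMeasure P (sampleMean Z g) atTop fun _ => ∫ o, g o ∂μ := by
  have hi : ∀ i, Integrable (fun ω => g (Z i ω)) P := fun i => by
    have := hg
    rw [← hZ.law i] at this
    exact this.comp_measurable (hZ.measurable i)
  have hm : AEMeasurable g μ := hg.1.aemeasurable
  have h := strong_law_ae (fun i ω => g (Z i ω)) (hi 0)
    (fun i j hij => (hZ.indep_comp hm).indepFun hij) (fun i => hZ.identDistrib hm i)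
  rw [hZ.integral_comp hg.1 0] at h
  refine tendstoInMeasure_of_tendsto_ae (fun n => ?_) h
  have : AEStronglyMeasurable (fun ω => ∑ i ∈ Finset.range n, g (Z i ω)) P :=
    (integrable_finsetSum _ fun i _ => hi i).1
  exact this.const_smul _

/-- The multivariate central limit theorem, for centred summands with covariance matrix `C`. -/
lemma IsSample.tendstoInDistribution_sampleMean (hZ : IsSample P Z μ) {ι : Type*} [Fintype ι]
    [DecidableEq ι] {g : O → EuclideanSpace ℝ ι} (hg : MemLp g 2 μ) (h0 : ∫ o, g o ∂μ = 0)
    [IsProbabilityMeasure μ] {C : Matrix ι ι ℝ} (hC : C.PosSemidef)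
    (hCov : ∀ a b, C a b = cov[fun o => g o a, fun o => g o b; μ]) :
    TendstoInDistribution (fun (n : ℕ) ω => √(n : ℝ) • sampleMean Z g n ω) atTop id (fun _ => P)
      (multivariateGaussian 0 C) := by
  have hgi : Integrable g μ := hg.integrable (by norm_num)
  have hm : AEMeasurable g μ := hgi.1.aemeasurable
  have hmZ : ∀ i, AEMeasurable (fun ω => g (Z i ω)) P := fun i =>
    (hZ.identDistrib hm i).aemeasurable_fst
  have hmean : ∀ n : ℕ, AEMeasurable (fun ω => √(n : ℝ) • sampleMean Z g n ω) P := fun n => by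
    have h : AEMeasurable (fun ω => ∑ i ∈ Finset.range n, g (Z i ω)) P :=
      Finset.aemeasurable_fun_sum _ fun i _ => hmZ i
    exact (h.const_smul (n : ℝ)⁻¹).const_smul (√(n : ℝ))
  refine ⟨hmean, aemeasurable_id, ?_⟩
  refine ProbabilityMeasure.tendsto_of_tendsto_charFun fun t => ?_
  -- the projection in direction `t` is a scalar sample
  set X : ℕ → Ω → ℝ := fun i ω => inner ℝ t (g (Z i ω)) with hX
  have hgt : AEMeasurable (fun o => inner ℝ t (g o)) μ :=
    (by fun_prop : Measurable fun v : EuclideanSpace ℝ ι => inner ℝ t v).comp_aemeasurable hm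
  have hLp : MemLp (fun o => inner ℝ t (g o)) 2 μ := hg.const_inner t
  have hLp0 : MemLp (X 0) 2 P := by
    have := hLp
    rw [← hZ.law 0] at this
    exact this.comp_of_map (hZ.measurable 0).aemeasurable
  have hX0 : P[X 0] = 0 := by
    rw [hX]
    simp only
    rw [hZ.integral_comp (g := fun o => inner ℝ t (g o)) hLp.1 0, integral_inner hgi, h0,
      inner_zero_right]
  have hVar : Var[X 0; P] = t.ofLp ⬝ᵥ C.mulVec t.ofLp := by
    have h1 : Var[X 0; P] = Var[fun o => inner ℝ t (g o); μ] := by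
      rw [← hZ.law 0, variance_map (by rw [hZ.law 0]; exact hgt) (hZ.measurable 0).aemeasurable]
      rfl
    have hga : ∀ a, MemLp (fun o => t a * g o a) 2 μ := fun a =>
      ((EuclideanSpace.proj (𝕜 := ℝ) a).comp_memLp' hg).const_mul _
    have h2 : (fun o => inner ℝ t (g o)) = fun o => ∑ a, t a * g o a := by
      funext o
      simp [PiLp.inner_apply, mul_comm]
    rw [h1, h2, ← covariance_self (by
      exact Finset.aemeasurable_fun_sum _ fun a _ => (hga a).1.aemeasurable),
      covariance_fun_sum_fun_sum hga hga]
    simp only [dotProduct, Matrix.mulVec, Finset.mul_sum, covariance_const_mul_left,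
      covariance_const_mul_right, hCov]
    refine Finset.sum_congr rfl fun a _ => Finset.sum_congr rfl fun b _ => by ring
  have hclt := tendstoInDistribution_inv_sqrt_mul_sum_sub
    (P' := gaussianReal 0 Var[X 0; P].toNNReal)
    (Y := id) HasLaw.id hLp0 (hZ.indep_comp hgt) (fun i => hZ.identDistrib hgt i)
  have h := ProbabilityMeasure.tendsto_iff_tendsto_charFun.1 hclt.tendsto 1
  have e1 : charFun (multivariateGaussian 0 C) t =
      charFun (gaussianReal 0 Var[X 0; P].toNNReal) 1 := by
    rw [charFun_multivariateGaussian hC, charFun_gaussianReal, hVar]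
    have : 0 ≤ t.ofLp ⬝ᵥ C.mulVec t.ofLp := by rw [← hVar]; exact variance_nonneg _ _
    simp [this]
  simp only [ProbabilityMeasure.coe_mk, Measure.map_id] at h ⊢
  rw [e1]
  refine h.congr fun n => ?_
  simp only [charFun_apply]
  rw [integral_map (by
      have := hclt.forall_aemeasurable n
      exact this) (by fun_prop), integral_map (hmean n) (by fun_prop)]
  congr 1
  funext ω
  congr 2
  have h3 : ∑ i ∈ Finset.range n, X i ω = inner ℝ t (∑ i ∈ Finset.range n, g (Z i ω)) := by
    rw [inner_sum]
  have h4 : √(n : ℝ) * (n : ℝ)⁻¹ = (√(n : ℝ))⁻¹ := by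
    rcases Nat.eq_zero_or_pos n with rfl | hn
    · simp
    · have : (0 : ℝ) < n := by exact_mod_cast hn
      have h5 := Real.mul_self_sqrt this.le
      have h6 : √(n : ℝ) ≠ 0 := (Real.sqrt_pos.2 this).ne'
      field_simp
      nlinarith
  rw [hX0, mul_zero, sub_zero, h3, sampleMean, smul_smul, h4, real_inner_smul_left,
    real_inner_comm t]
  simp

end Limit

/-! ### Zeros of nearly linear maps -/

section Deterministic

variable {ι : Type*} [Fintype ι]

/-- On the ball of radius `δ` about `θ₀`, increments of `f` are those of the linear map `L` up to
the factor `η`. -/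
def NearlyLinear (L : EuclideanSpace ℝ ι →L[ℝ] EuclideanSpace ℝ ι) (θ₀ : EuclideanSpace ℝ ι)
    (δ η : ℝ) (f : EuclideanSpace ℝ ι → EuclideanSpace ℝ ι) : Prop :=
  ∀ x ∈ Metric.ball θ₀ δ, ∀ y ∈ Metric.ball θ₀ δ, ‖f x - f y - L (x - y)‖ ≤ η * ‖x - y‖

variable {L : EuclideanSpace ℝ ι →L[ℝ] EuclideanSpace ℝ ι} {θ₀ : EuclideanSpace ℝ ι} {δ c : ℝ}
  {f : EuclideanSpace ℝ ι → EuclideanSpace ℝ ι}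

lemma norm_ge_of_inner_le (hL : ∀ v, inner ℝ (L v) v ≤ -c * ‖v‖ ^ 2) (v : EuclideanSpace ℝ ι) :
    c * ‖v‖ ≤ ‖L v‖ := by
  rcases eq_or_ne v 0 with rfl | hv
  · simp
  · have h0 : 0 < ‖v‖ := norm_pos_iff.2 hv
    have h1 := abs_real_inner_le_norm (L v) v
    have h2 := neg_abs_le (inner ℝ (L v) v)
    have h3 := hL v
    have : c * ‖v‖ * ‖v‖ ≤ ‖L v‖ * ‖v‖ := by nlinarith
    exact le_of_mul_le_mul_right this h0

lemma exists_inverse (hc : 0 < c) (hL : ∀ v, inner ℝ (L v) v ≤ -c * ‖v‖ ^ 2) :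
    ∃ e : EuclideanSpace ℝ ι ≃L[ℝ] EuclideanSpace ℝ ι, (e : EuclideanSpace ℝ ι →L[ℝ] _) = L := by
  have hinj : Function.Injective (L : EuclideanSpace ℝ ι →ₗ[ℝ] EuclideanSpace ℝ ι) := by
    rw [← LinearMap.ker_eq_bot, LinearMap.ker_eq_bot']
    intro v hv
    have h1 := norm_ge_of_inner_le hL v
    have hv' : L v = 0 := hv
    rw [hv', norm_zero] at h1
    by_contra h
    have := norm_pos_iff.2 h
    nlinarith
  refine ⟨(LinearEquiv.ofInjectiveEndo _ hinj).toContinuousLinearEquiv, ?_⟩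
  ext v
  rfl

/-- A version of the inverse function theorem: `f` has a zero near `θ₀` if `f θ₀` is small. -/
lemma NearlyLinear.exists_zero (hc : 0 < c) (hL : ∀ v, inner ℝ (L v) v ≤ -c * ‖v‖ ^ 2)
    (hf : NearlyLinear L θ₀ δ (c / 4) f) {ε : ℝ} (hε : 0 ≤ ε) (hεδ : ε < δ)
    (h0 : ‖f θ₀‖ ≤ c / 2 * ε) : ∃ θ ∈ Metric.closedBall θ₀ ε, f θ = 0 := by
  obtain ⟨e, he⟩ := exists_inverse hc hL
  have happ : ApproximatesLinearOn f (e : EuclideanSpace ℝ ι →L[ℝ] EuclideanSpace ℝ ι)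
      (Metric.ball θ₀ δ) ⟨c / 4, by positivity⟩ := by
    intro x hx y hy
    rw [he]
    exact hf x hx y hy
  have hs := happ.surjOn_closedBall_of_nonlinearRightInverse e.toNonlinearRightInverse hε
    (Metric.closedBall_subset_ball hεδ)
  have hn : ‖(e.symm : EuclideanSpace ℝ ι →L[ℝ] EuclideanSpace ℝ ι)‖ ≤ c⁻¹ := by
    refine ContinuousLinearMap.opNorm_le_bound _ (by positivity) fun v => ?_
    have h1 := norm_ge_of_inner_le hL (e.symm v)
    rw [← he] at h1
    simp only [ContinuousLinearEquiv.coe_coe, ContinuousLinearEquiv.apply_symm_apply] at h1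
    rw [inv_mul_eq_div, le_div_iff₀ hc, mul_comm]
    exact h1
  rcases isEmpty_or_nonempty ι with hι | hι
  · exact ⟨θ₀, Metric.mem_closedBall_self hε, Subsingleton.elim _ _⟩
  have hn0 : 0 < ‖(e.symm : EuclideanSpace ℝ ι →L[ℝ] EuclideanSpace ℝ ι)‖ :=
    e.norm_symm_pos
  have hinv : c ≤ ‖(e.symm : EuclideanSpace ℝ ι →L[ℝ] EuclideanSpace ℝ ι)‖⁻¹ := by
    rw [le_inv_comm₀ hc hn0]
    exact hn
  obtain ⟨θ, hθ, hθ0⟩ := hs (show (0 : EuclideanSpace ℝ ι) ∈ _ by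
    rw [Metric.mem_closedBall, dist_zero_left]
    refine h0.trans (mul_le_mul_of_nonneg_right ?_ hε)
    change c / 2 ≤ ‖(e.symm : EuclideanSpace ℝ ι →L[ℝ] EuclideanSpace ℝ ι)‖⁻¹ - c / 4
    linarith)
  exact ⟨θ, hθ, hθ0⟩

lemma NearlyLinear.inner_sub_nonpos (hL : ∀ v, inner ℝ (L v) v ≤ -c * ‖v‖ ^ 2) (hc : 0 < c)
    (hf : NearlyLinear L θ₀ δ (c / 4) f) {x y : EuclideanSpace ℝ ι} (hx : x ∈ Metric.ball θ₀ δ)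
    (hy : y ∈ Metric.ball θ₀ δ) : inner ℝ (f x - f y) (x - y) ≤ 0 := by
  have h1 := hf x hx y hy
  have h2 := real_inner_le_norm (f x - f y - L (x - y)) (x - y)
  have h3 := hL (x - y)
  rw [inner_sub_left] at h2
  nlinarith [mul_le_mul_of_nonneg_right h1 (norm_nonneg (x - y)), sq_nonneg ‖x - y‖]

lemma NearlyLinear.norm_sub_ge (hL : ∀ v, inner ℝ (L v) v ≤ -c * ‖v‖ ^ 2)
    (hf : NearlyLinear L θ₀ δ (c / 4) f) {x y : EuclideanSpace ℝ ι} (hx : x ∈ Metric.ball θ₀ δ)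
    (hy : y ∈ Metric.ball θ₀ δ) : 3 * c / 4 * ‖x - y‖ ≤ ‖f x - f y‖ := by
  have h1 := hf x hx y hy
  have h2 := norm_ge_of_inner_le hL (x - y)
  have h3 := norm_sub_norm_le (L (x - y)) (f x - f y)
  rw [norm_sub_rev (L (x - y))] at h3
  linarith

lemma NearlyLinear.norm_sub_le (hf : NearlyLinear L θ₀ δ c f) {x y : EuclideanSpace ℝ ι}
    (hx : x ∈ Metric.ball θ₀ δ) (hy : y ∈ Metric.ball θ₀ δ) :
    ‖f x - f y‖ ≤ (c + ‖L‖) * ‖x - y‖ := by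
  have h1 := hf x hx y hy
  have h2 := L.le_opNorm (x - y)
  have h3 := norm_add_le (f x - f y - L (x - y)) (L (x - y))
  rw [sub_add_cancel] at h3
  linarith

/-- A zero of the gradient is a local maximum if the gradient is monotonically decreasing. -/
lemma isLocalMax_of_gradient {F : EuclideanSpace ℝ ι → ℝ} {T : EuclideanSpace ℝ ι}
    (hT : T ∈ Metric.ball θ₀ δ) (hF : ∀ θ ∈ Metric.ball θ₀ δ, HasGradientAt F (f θ) θ)
    (hmono : ∀ θ ∈ Metric.ball θ₀ δ, inner ℝ (f θ - f T) (θ - T) ≤ 0) (h0 : f T = 0) :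
    IsLocalMax F T := by
  filter_upwards [Metric.isOpen_ball.mem_nhds hT] with θ hθ
  have hseg : ∀ s ∈ Icc (0 : ℝ) 1, T + s • (θ - T) ∈ Metric.ball θ₀ δ := fun s hs =>
    (convex_ball θ₀ δ).add_smul_sub_mem hT hθ hs
  have hd : ∀ s ∈ Icc (0 : ℝ) 1, HasDerivAt (fun s : ℝ => F (T + s • (θ - T)))
      (inner ℝ (f (T + s • (θ - T))) (θ - T)) s := by
    intro s hs
    have h1 : HasDerivAt (fun s : ℝ => T + s • (θ - T)) (θ - T) s := by
      simpa using ((hasDerivAt_id' s).smul_const (θ - T)).const_add T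
    have h2 := (hF _ (hseg s hs)).hasFDerivAt.comp_hasDerivAt s h1
    exact h2.congr_deriv (by simp)
  obtain ⟨s, hs, hs'⟩ := exists_hasDerivAt_eq_slope (fun s : ℝ => F (T + s • (θ - T)))
    (fun s => inner ℝ (f (T + s • (θ - T))) (θ - T)) zero_lt_one
    (fun s hs => (hd s hs).continuousAt.continuousWithinAt)
    (fun s hs => hd s (Ioo_subset_Icc_self hs))
  have h3 := hmono _ (hseg s (Ioo_subset_Icc_self hs))
  rw [h0, sub_zero, add_sub_cancel_left, real_inner_smul_right] at h3
  have h4 : inner ℝ (f (T + s • (θ - T))) (θ - T) ≤ 0 := by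
    by_contra h
    push Not at h
    nlinarith [mul_pos hs.1 h]
  simp only [one_smul, zero_smul, add_zero, sub_zero, div_one, add_sub_cancel] at hs'
  linarith

/-- A measurable way to solve an equation that is known to have a unique nondegenerate solution in
a ball: the limit of the first points of a dense sequence at which `‖f‖` is less than `1 / m`. -/
lemma exists_measurable_solution {X : Type*} [MeasurableSpace X]
    (G : EuclideanSpace ℝ ι → X → EuclideanSpace ℝ ι) (hδ : 0 < δ)
    (hG : ∀ θ ∈ Metric.ball θ₀ δ, Measurable (G θ)) :
    ∃ T : X → EuclideanSpace ℝ ι, Measurable T ∧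
      ∀ (c : ℝ) (L : EuclideanSpace ℝ ι →L[ℝ] EuclideanSpace ℝ ι), 0 < c →
        (∀ v, inner ℝ (L v) v ≤ -c * ‖v‖ ^ 2) → ∀ x, NearlyLinear L θ₀ δ (c / 4) (fun θ => G θ x) →
          ∀ θ ∈ Metric.ball θ₀ δ, G θ x = 0 → T x = θ := by
  classical
  have : Nonempty (Metric.ball θ₀ δ) := ⟨⟨θ₀, Metric.mem_ball_self hδ⟩⟩
  let q : ℕ → Metric.ball θ₀ δ := TopologicalSpace.denseSeq _
  have hq : DenseRange q := TopologicalSpace.denseRange_denseSeq _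
  -- the index of the first admissible point, or zero if there is none
  let p : ℕ → X → ℕ → Prop := fun m x k =>
    ‖G (q k) x‖ < 1 / ((m : ℝ) + 1) ∨ ∀ l, ¬ ‖G (q l) x‖ < 1 / ((m : ℝ) + 1)
  have hp : ∀ m x, ∃ k, p m x k := by
    intro m x
    by_cases h : ∃ l, ‖G (q l) x‖ < 1 / ((m : ℝ) + 1)
    · exact ⟨h.choose, Or.inl h.choose_spec⟩
    · exact ⟨0, Or.inr (not_exists.1 h)⟩
  have hms : ∀ m l, MeasurableSet {x | ‖G (q l) x‖ < 1 / ((m : ℝ) + 1)} := fun m l =>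
    measurableSet_lt (hG _ (q l).2).norm measurable_const
  have hpm : ∀ m k, MeasurableSet {x | p m x k} := fun m k => by
    have h : {x | ∀ l, ¬ ‖G (q l) x‖ < 1 / ((m : ℝ) + 1)} =
        ⋂ l, {x | ‖G (q l) x‖ < 1 / ((m : ℝ) + 1)}ᶜ := by
      ext x
      simp
    refine (hms m k).union ?_
    change MeasurableSet {x | ∀ l, ¬ ‖G (q l) x‖ < 1 / ((m : ℝ) + 1)}
    rw [h]
    exact MeasurableSet.iInter fun l => (hms m l).compl
  let t : ℕ → X → EuclideanSpace ℝ ι := fun m x => q (Nat.find (hp m x))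
  have ht : ∀ m, Measurable (t m) := fun m =>
    (measurable_from_nat (f := fun k => (q k : EuclideanSpace ℝ ι))).comp
      (measurable_find (hp m) (hpm m))
  refine ⟨fun x => limUnder atTop fun m => t m x,
    (StronglyMeasurable.limUnder fun m => (ht m).stronglyMeasurable).measurable, ?_⟩
  intro c L hc hL x hx θ hθ h0
  refine Tendsto.limUnder_eq ?_
  have hsmall : ∀ m, ‖G (t m x) x‖ < 1 / ((m : ℝ) + 1) := by
    intro m
    rcases Nat.find_spec (hp m x) with h | h
    · exact h
    · exfalso
      have hpos : 0 < 1 / ((m : ℝ) + 1) / (c / 4 + ‖L‖) := by positivity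
      obtain ⟨l, hl⟩ := hq.exists_dist_lt ⟨θ, hθ⟩ hpos
      refine h l ?_
      have h1 := hx.norm_sub_le (q l).2 hθ
      simp only [h0, sub_zero] at h1
      refine h1.trans_lt ?_
      have h2 : ‖(q l : EuclideanSpace ℝ ι) - θ‖ < 1 / ((m : ℝ) + 1) / (c / 4 + ‖L‖) := by
        rw [← dist_eq_norm, dist_comm]
        exact hl
      rw [lt_div_iff₀ (by positivity)] at h2
      linarith
  rw [tendsto_iff_norm_sub_tendsto_zero]
  have hlim : Tendsto (fun m : ℕ => (3 * c / 4)⁻¹ * (1 / ((m : ℝ) + 1))) atTop (𝓝 0) := by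
    simpa using tendsto_one_div_add_atTop_nhds_zero_nat.const_mul (3 * c / 4)⁻¹
  refine squeeze_zero (fun _ => norm_nonneg _) (fun m => ?_) hlim
  have h1 := hx.norm_sub_ge hL (q (Nat.find (hp m x))).2 hθ
  simp only [h0, sub_zero] at h1
  rw [inv_mul_eq_div, le_div_iff₀ (by positivity), mul_comm]
  exact h1.trans (hsmall m).le

end Deterministic

/-! ### Asymptotics of zeros of a random score -/

section Score

variable {Ω : Type*} [MeasurableSpace Ω] {P : Measure Ω} [IsProbabilityMeasure P]
  {O : Type*} [MeasurableSpace O] {Z : ℕ → Ω → O} {μ : Measure O}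
  {ι : Type*} [Fintype ι] {ψ : EuclideanSpace ℝ ι → O → EuclideanSpace ℝ ι}
  {θ₀ : EuclideanSpace ℝ ι}

lemma norm_sampleMean_le {V : Type*} [NormedAddCommGroup V] [NormedSpace ℝ V] {g : O → V}
    {F : O → ℝ} {n : ℕ} {ω : Ω} (h : ∀ i, ‖g (Z i ω)‖ ≤ F (Z i ω)) :
    ‖sampleMean Z g n ω‖ ≤ sampleMean Z F n ω := by
  rw [sampleMean, sampleMean, norm_smul, norm_inv, Real.norm_natCast, smul_eq_mul]
  gcongr
  exact norm_sum_le_of_le _ fun i _ => h i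

lemma sampleMean_sub {V : Type*} [AddCommGroup V] [Module ℝ V] (f g : O → V) (n : ℕ) (ω : Ω) :
    sampleMean Z (fun o => f o - g o) n ω = sampleMean Z f n ω - sampleMean Z g n ω := by
  simp [sampleMean, smul_sub]

lemma sampleMean_apply (A : O → EuclideanSpace ℝ ι →L[ℝ] EuclideanSpace ℝ ι)
    (v : EuclideanSpace ℝ ι) (n : ℕ) (ω : Ω) :
    sampleMean Z (fun o => A o v) n ω = sampleMean Z A n ω v := by
  simp [sampleMean]

lemma sampleMean_mul_const (F : O → ℝ) (c : ℝ) (n : ℕ) (ω : Ω) :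
    sampleMean Z (fun o => F o * c) n ω = sampleMean Z F n ω * c := by
  simp [sampleMean, Finset.sum_mul, mul_assoc]

/-- A first-order expansion of the score with an integrable remainder makes the sample score nearly
linear, with high probability. -/
lemma IsSample.exists_whp_nearlyLinear (hZ : IsSample P Z μ) {δ₀ : ℝ} (hδ₀ : 0 < δ₀)
    {A : O → EuclideanSpace ℝ ι →L[ℝ] EuclideanSpace ℝ ι} (hA : Integrable A μ) {F : O → ℝ}
    (hF : Integrable F μ) (hexp : ∀ᵐ o ∂μ, ∀ x ∈ Metric.ball θ₀ δ₀, ∀ y ∈ Metric.ball θ₀ δ₀,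
      ‖ψ x o - ψ y o - A o (x - y)‖ ≤ F o * (‖x - θ₀‖ + ‖y - θ₀‖) * ‖x - y‖)
    {η : ℝ} (hη : 0 < η) :
    ∃ δ, 0 < δ ∧ δ ≤ δ₀ ∧ Whp P fun n ω =>
      NearlyLinear (∫ o, A o ∂μ) θ₀ δ η fun θ => sampleMean Z (ψ θ) n ω := by
  set K : ℝ := |∫ o, F o ∂μ| + 1 with hK
  have hK0 : 0 < K := by positivity
  refine ⟨min δ₀ (η / (4 * K)), by positivity, min_le_left _ _, ?_⟩
  have h1 := whp_norm_sub_lt (hZ.tendstoInMeasure_sampleMean hA) (half_pos hη)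
  have h2 := whp_norm_sub_lt (hZ.tendstoInMeasure_sampleMean hF) one_pos
  have h3 : Whp P fun _ ω => ∀ i, ∀ x ∈ Metric.ball θ₀ δ₀, ∀ y ∈ Metric.ball θ₀ δ₀,
      ‖ψ x (Z i ω) - ψ y (Z i ω) - A (Z i ω) (x - y)‖ ≤
        F (Z i ω) * (‖x - θ₀‖ + ‖y - θ₀‖) * ‖x - y‖ := Whp.of_ae fun _ => hZ.ae_forall hexp
  refine ((h1.and h2).and h3).mono (Eventually.of_forall fun n ω => ?_)
  rintro ⟨⟨h1, h2⟩, h3⟩ x hx y hy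
  have hx' := Metric.ball_subset_ball (min_le_left _ _) hx
  have hy' := Metric.ball_subset_ball (min_le_left _ _) hy
  have hxn : ‖x - θ₀‖ ≤ η / (4 * K) := by
    rw [← dist_eq_norm]
    exact (Metric.mem_ball.1 (Metric.ball_subset_ball (min_le_right _ _) hx)).le
  have hyn : ‖y - θ₀‖ ≤ η / (4 * K) := by
    rw [← dist_eq_norm]
    exact (Metric.mem_ball.1 (Metric.ball_subset_ball (min_le_right _ _) hy)).le
  have hF1 : sampleMean Z F n ω ≤ K := by
    rw [Real.norm_eq_abs] at h2
    have := (abs_lt.1 h2).2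
    have := le_abs_self (∫ o, F o ∂μ)
    rw [hK]
    linarith
  have hrem := norm_sampleMean_le (n := n) (fun i => h3 i x hx' y hy')
    (g := fun o => ψ x o - ψ y o - A o (x - y))
    (F := fun o => F o * (‖x - θ₀‖ + ‖y - θ₀‖) * ‖x - y‖)
  rw [sampleMean_mul_const, sampleMean_mul_const, sampleMean_sub, sampleMean_sub,
    sampleMean_apply] at hrem
  have hsplit : sampleMean Z (ψ x) n ω - sampleMean Z (ψ y) n ω - (∫ o, A o ∂μ) (x - y) =
      (sampleMean Z (ψ x) n ω - sampleMean Z (ψ y) n ω - sampleMean Z A n ω (x - y)) +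
        (sampleMean Z A n ω - ∫ o, A o ∂μ) (x - y) := by
    rw [sub_apply]
    abel
  rw [hsplit]
  refine (norm_add_le _ _).trans ?_
  have h4 := ((sampleMean Z A n ω - ∫ o, A o ∂μ)).le_opNorm (x - y)
  have h5 : sampleMean Z F n ω * (‖x - θ₀‖ + ‖y - θ₀‖) ≤ η / 2 := by
    calc sampleMean Z F n ω * (‖x - θ₀‖ + ‖y - θ₀‖)
        ≤ K * (η / (4 * K) + η / (4 * K)) := by gcongr
      _ = η / 2 := by field_simp; ring
  have h6 := mul_le_mul_of_nonneg_right h5 (norm_nonneg (x - y))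
  have h7 := mul_le_mul_of_nonneg_right h1.le (norm_nonneg (x - y))
  linarith

/-- Wald's argument. If the expected score does not vanish on a compact set `K`, and the score is
locally Lipschitz with integrable constants, then the sample score has no zeros on `K`, with high
probability. -/
lemma IsSample.whp_ne_zero_on (hZ : IsSample P Z μ) {K : Set (EuclideanSpace ℝ ι)}
    (hK : IsCompact K)
    (hint : ∀ θ ∈ K, Integrable (ψ θ) μ) (hne : ∀ θ ∈ K, ∫ o, ψ θ o ∂μ ≠ 0)
    (hlip : ∀ θ ∈ K, ∃ δ, 0 < δ ∧ ∃ F : O → ℝ, Integrable F μ ∧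
      ∀ᵐ o ∂μ, ∀ x ∈ Metric.ball θ δ, ‖ψ x o - ψ θ o‖ ≤ F o * ‖x - θ‖) :
    Whp P fun n ω => ∀ θ ∈ K, sampleMean Z (ψ θ) n ω ≠ 0 := by
  refine hK.induction_on (p := fun s => Whp P fun n ω => ∀ θ ∈ s, sampleMean Z (ψ θ) n ω ≠ 0)
    (Whp.of_ae fun _ => by simp)
    (fun s t hst h => h.mono (Eventually.of_forall fun n ω hω θ hθ => hω θ (hst hθ)))
    (fun s t hs ht => (hs.and ht).mono (Eventually.of_forall fun n ω hω θ hθ =>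
      hθ.elim (hω.1 θ) (hω.2 θ))) ?_
  intro θ hθ
  obtain ⟨δ, hδ, F, hF, hl⟩ := hlip θ hθ
  have hm : 0 < ‖∫ o, ψ θ o ∂μ‖ := norm_pos_iff.2 (hne θ hθ)
  set m := ‖∫ o, ψ θ o ∂μ‖ with hmdef
  set C : ℝ := |∫ o, F o ∂μ| + 1 with hC
  have hC0 : 0 < C := by positivity
  refine ⟨Metric.ball θ (min δ (m / (2 * C))),
    mem_nhdsWithin_of_mem_nhds (Metric.ball_mem_nhds θ (by positivity)), ?_⟩
  have h1 := whp_norm_sub_lt (hZ.tendstoInMeasure_sampleMean (hint θ hθ)) (half_pos hm)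
  have h2 := whp_norm_sub_lt (hZ.tendstoInMeasure_sampleMean hF) one_pos
  have h3 : Whp P fun _ ω => ∀ i, ∀ x ∈ Metric.ball θ δ,
      ‖ψ x (Z i ω) - ψ θ (Z i ω)‖ ≤ F (Z i ω) * ‖x - θ‖ := Whp.of_ae fun _ => hZ.ae_forall hl
  refine ((h1.and h2).and h3).mono (Eventually.of_forall fun n ω => ?_)
  rintro ⟨⟨h1, h2⟩, h3⟩ x hx h0
  have hx' := Metric.ball_subset_ball (min_le_left _ _) hx
  have hxn : ‖x - θ‖ < m / (2 * C) := by
    rw [← dist_eq_norm]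
    exact Metric.mem_ball.1 (Metric.ball_subset_ball (min_le_right _ _) hx)
  have hF1 : sampleMean Z F n ω ≤ C := by
    rw [Real.norm_eq_abs] at h2
    have := (abs_lt.1 h2).2
    have := le_abs_self (∫ o, F o ∂μ)
    rw [hC]
    linarith
  have hrem := norm_sampleMean_le (n := n) (fun i => h3 i x hx')
    (g := fun o => ψ x o - ψ θ o) (F := fun o => F o * ‖x - θ‖)
  rw [sampleMean_mul_const, sampleMean_sub, h0, zero_sub, norm_neg] at hrem
  have h4 : sampleMean Z F n ω * ‖x - θ‖ ≤ C * ‖x - θ‖ := by gcongr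
  have h5 : C * ‖x - θ‖ < m / 2 := by
    rw [lt_div_iff₀ (by positivity)] at hxn
    linarith
  have h6 := norm_sub_norm_le (∫ o, ψ θ o ∂μ) (∫ o, ψ θ o ∂μ - sampleMean Z (ψ θ) n ω)
  rw [sub_sub_cancel, ← norm_sub_rev (sampleMean Z (ψ θ) n ω)] at h6
  linarith

/-- Sequences that converge in distribution are bounded in probability. -/
lemma exists_norm_bound_of_tendstoInDistribution {X : ℕ → Ω → EuclideanSpace ℝ ι}
    {G : Measure (EuclideanSpace ℝ ι)} [IsProbabilityMeasure G]
    (h : TendstoInDistribution X atTop id (fun _ => P) G) {ε : ENNReal} (hε : 0 < ε) :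
    ∃ R : ℝ, 0 < R ∧ ∀ᶠ n in atTop, P {ω | R ≤ ‖X n ω‖} ≤ ε := by
  have hG : Tendsto (fun R : ℕ => G {x | (R : ℝ) + 1 ≤ ‖x‖}) atTop (𝓝 0) := by
    have hanti : Antitone fun R : ℕ => {x : EuclideanSpace ℝ ι | (R : ℝ) + 1 ≤ ‖x‖} := by
      intro R R' hRR' x hx
      have : (R : ℝ) ≤ R' := by exact_mod_cast hRR'
      exact le_trans (by linarith) (show (R' : ℝ) + 1 ≤ ‖x‖ from hx)
    have := tendsto_measure_iInter_atTop (μ := G) (fun R => (measurableSet_le measurable_const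
      measurable_norm).nullMeasurableSet) hanti ⟨0, measure_ne_top _ _⟩
    have he : (⋂ R : ℕ, {x : EuclideanSpace ℝ ι | (R : ℝ) + 1 ≤ ‖x‖}) = ∅ := by
      ext x
      obtain ⟨R, hR⟩ := exists_nat_gt ‖x‖
      simp only [mem_iInter, mem_ofPred_eq, mem_empty_iff_false, iff_false, not_forall, not_le]
      exact ⟨R, by linarith⟩
    rwa [he, measure_empty] at this
  obtain ⟨R, hR⟩ := ((tendsto_order.1 hG).2 ε hε).exists
  refine ⟨(R : ℝ) + 1, by positivity, ?_⟩
  have hclosed : IsClosed {x : EuclideanSpace ℝ ι | (R : ℝ) + 1 ≤ ‖x‖} :=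
    isClosed_le continuous_const continuous_norm
  have hlim := ProbabilityMeasure.limsup_measure_closed_le_of_tendsto h.tendsto hclosed
  simp only [ProbabilityMeasure.coe_mk, Measure.map_id] at hlim
  filter_upwards [eventually_lt_of_limsup_lt (hlim.trans_lt hR)] with n hn
  rw [Measure.map_apply_of_aemeasurable (h.forall_aemeasurable n) hclosed.measurableSet] at hn
  exact hn.le

/-- Asymptotic normality of consistent zeros of the score, in terms of the limit in distribution
`G` of the normalized score at the true value. -/
lemma tendstoInDistribution_of_consistent
    {L : EuclideanSpace ℝ ι ≃L[ℝ] EuclideanSpace ℝ ι} {c : ℝ} (hc : 0 < c)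
    (hL : ∀ v, inner ℝ (L v) v ≤ -c * ‖v‖ ^ 2)
    (hlin : ∀ η > 0, ∃ δ > 0, Whp P fun n ω =>
      NearlyLinear (L : EuclideanSpace ℝ ι →L[ℝ] _) θ₀ δ η fun θ => sampleMean Z (ψ θ) n ω)
    {G : Measure (EuclideanSpace ℝ ι)} [IsProbabilityMeasure G]
    (hclt : TendstoInDistribution (fun (n : ℕ) ω => √(n : ℝ) • sampleMean Z (ψ θ₀) n ω) atTop id
      (fun _ => P) G)
    {θhat : ℕ → Ω → EuclideanSpace ℝ ι} (hmeas : ∀ n, AEMeasurable (θhat n) P)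
    (hzero : Whp P fun n ω => sampleMean Z (ψ (θhat n ω)) n ω = 0)
    (hcons : TendstoInMeasure P θhat atTop fun _ => θ₀) :
    (∀ ε : ENNReal, 0 < ε → ∃ R : ℝ, ∀ᶠ n : ℕ in atTop,
      P {ω | R < √(n : ℝ) * ‖θhat n ω - θ₀‖} ≤ ε) ∧
    TendstoInDistribution (fun (n : ℕ) ω => √(n : ℝ) • (θhat n ω - θ₀)) atTop
      (fun x => -L.symm x) (fun _ => P) G := by
  set N : ℕ → Ω → EuclideanSpace ℝ ι := fun n ω => √(n : ℝ) • sampleMean Z (ψ θ₀) n ω with hN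
  set Δ : ℕ → Ω → EuclideanSpace ℝ ι := fun n ω => √(n : ℝ) • (θhat n ω - θ₀) with hΔ
  -- the linearized score equation, up to a small multiple of the normalized error
  have hkey : ∀ η > 0, Whp P fun n ω => ‖N n ω + L (Δ n ω)‖ ≤ η * ‖Δ n ω‖ := by
    intro η hη
    obtain ⟨δ, hδ, h⟩ := hlin η hη
    refine ((h.and hzero).and (whp_norm_sub_lt hcons hδ)).mono (Eventually.of_forall fun n ω => ?_)
    rintro ⟨⟨h1, h2⟩, h3⟩
    have h4 := h1 θ₀ (Metric.mem_ball_self hδ) (θhat n ω) (by rwa [Metric.mem_ball, dist_eq_norm])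
    beta_reduce at h4
    rw [h2, sub_zero] at h4
    have h5 : N n ω + L (Δ n ω) = √(n : ℝ) • (sampleMean Z (ψ θ₀) n ω - L (θ₀ - θhat n ω)) := by
      simp only [hN, hΔ, map_smul, ← smul_add]
      rw [← neg_sub θ₀, map_neg, ← sub_eq_add_neg]
    rw [h5, norm_smul, hΔ, norm_smul, mul_left_comm, norm_sub_rev (θhat n ω)]
    gcongr
    exact h4
  have hΔN : ∀ n ω, ‖N n ω + L (Δ n ω)‖ ≤ c / 2 * ‖Δ n ω‖ → ‖Δ n ω‖ ≤ 2 / c * ‖N n ω‖ := by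
    intro n ω h
    have h1 := norm_ge_of_inner_le (L := (L : EuclideanSpace ℝ ι →L[ℝ] _)) hL (Δ n ω)
    simp only [ContinuousLinearEquiv.coe_coe] at h1
    have h2 := norm_sub_le (N n ω + L (Δ n ω)) (N n ω)
    rw [add_sub_cancel_left] at h2
    rw [div_mul_eq_mul_div, le_div_iff₀ hc]
    linarith
  have hkey2 := hkey (c / 2) (by positivity)
  have hsmall : ∀ r > 0, Whp P fun n ω => ‖N n ω + L (Δ n ω)‖ < r := by
    intro r hr
    refine Whp.of_forall_pos fun ε hε => ?_
    obtain ⟨R, hR0, hR⟩ := exists_norm_bound_of_tendstoInDistribution hclt hε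
    refine ⟨fun n ω => ‖N n ω‖ < R, by simpa using hR, ?_⟩
    refine (hkey2.and (hkey (r / (2 / c * R)) (by positivity))).mono
      (Eventually.of_forall fun n ω h hNR => ?_)
    have h1 := hΔN n ω h.1
    have h2 : ‖Δ n ω‖ < 2 / c * R := h1.trans_lt (by gcongr)
    calc ‖N n ω + L (Δ n ω)‖ ≤ r / (2 / c * R) * ‖Δ n ω‖ := h.2
      _ < r / (2 / c * R) * (2 / c * R) := by gcongr
      _ = r := by field_simp
  have hΔm : ∀ n, AEMeasurable (Δ n) P := fun n => ((hmeas n).sub_const θ₀).const_smul (√(n : ℝ))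
  refine ⟨fun ε hε => ?_, ?_⟩
  · obtain ⟨R, hR0, hR⟩ := exists_norm_bound_of_tendstoInDistribution hclt
      (ENNReal.half_pos hε.ne')
    refine ⟨2 / c * R, ?_⟩
    filter_upwards [hR, ENNReal.tendsto_nhds_zero.1 hkey2 (ε / 2) (ENNReal.half_pos hε.ne')]
      with n h1 h2
    calc P {ω | 2 / c * R < √(n : ℝ) * ‖θhat n ω - θ₀‖}
        ≤ P ({ω | R ≤ ‖N n ω‖} ∪ {ω | ¬ ‖N n ω + L (Δ n ω)‖ ≤ c / 2 * ‖Δ n ω‖}) := by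
          refine measure_mono fun ω hω => ?_
          by_cases h : ‖N n ω + L (Δ n ω)‖ ≤ c / 2 * ‖Δ n ω‖
          · refine Or.inl ?_
            have h3 : 2 / c * R < ‖Δ n ω‖ := by
              rw [hΔ]
              simp only [norm_smul, Real.norm_eq_abs, abs_of_nonneg (Real.sqrt_nonneg _)]
              exact hω
            have h4 := h3.trans_le (hΔN n ω h)
            exact (lt_of_mul_lt_mul_left h4 (by positivity)).le
          · exact Or.inr h
      _ ≤ ε / 2 + ε / 2 := (measure_union_le _ _).trans (add_le_add h1 h2)
      _ = ε := ENNReal.add_halves ε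
  · have h1 : TendstoInDistribution (fun n ω => -L.symm (N n ω)) atTop (fun x => -L.symm x)
        (fun _ => P) G :=
      hclt.continuous_comp (g := fun x => -L.symm x) (by fun_prop)
    refine tendstoInDistribution_of_tendstoInMeasure_sub (X := fun n ω => -L.symm (N n ω))
      _ _ h1 ?_ hΔm
    refine tendstoInMeasure_of_whp fun r hr => ?_
    refine (hsmall (c * r) (by positivity)).mono (Eventually.of_forall fun n ω h => ?_)
    change ‖Δ n ω - -L.symm (N n ω) - 0‖ < r
    rw [sub_zero, sub_neg_eq_add]
    have h2 := norm_ge_of_inner_le (L := (L : EuclideanSpace ℝ ι →L[ℝ] _)) hL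
      (Δ n ω + L.symm (N n ω))
    simp only [ContinuousLinearEquiv.coe_coe, map_add, ContinuousLinearEquiv.apply_symm_apply] at h2
    rw [add_comm (L _)] at h2
    exact lt_of_mul_lt_mul_left (h2.trans_lt h) hc.le

end Score

/-! ### Exponential tilting of Gaussian vectors -/

lemma gaussianReal_real_Iic {m σ t : ℝ} (hσ : 0 < σ) :
    (gaussianReal m (σ ^ 2).toNNReal).real (Iic t) = stdNormalCDF ((t - m) / σ) := by
  have h : gaussianReal m (σ ^ 2).toNNReal = (gaussianReal 0 1).map (fun x => σ * x + m) := by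
    have h1 : (gaussianReal 0 1).map (fun x => σ * x) = gaussianReal 0 (σ ^ 2).toNNReal := by
      rw [gaussianReal_map_const_mul]
      congr 1
      · simp
      · rw [mul_one]
        exact NNReal.eq (by simp [sq_nonneg])
    have h2 := gaussianReal_map_add_const (μ := 0) (v := (σ ^ 2).toNNReal) m
    rw [← h1, Measure.map_map (by fun_prop) (by fun_prop), zero_add] at h2
    exact h2.symm
  rw [h, map_measureReal_apply (by fun_prop) measurableSet_Iic, stdNormalCDF, cdf_eq_real]
  congr 1
  ext x
  simp only [mem_preimage, mem_Iic]
  rw [le_div_iff₀ hσ]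
  constructor <;> intro h <;> linarith

section Gaussian

variable {V : Type*} [NormedAddCommGroup V] [NormedSpace ℝ V] [MeasurableSpace V] [BorelSpace V]
  [SecondCountableTopology V] [CompleteSpace V] {G : Measure V} [IsGaussian G]

lemma integrable_exp_dual (L : StrongDual ℝ V) : Integrable (fun w => Real.exp (L w)) G := by
  have h := integrable_exp_mul_gaussianReal (μ := G[L]) (v := Var[L; G].toNNReal) 1
  rw [← IsGaussian.map_eq_gaussianReal] at h
  simpa [Function.comp_def] using h.comp_measurable (by fun_prop : Measurable L)

lemma integral_exp_dual (L : StrongDual ℝ V) (h0 : G[L] = 0) :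
    ∫ w, Real.exp (L w) ∂G = Real.exp (Var[L; G] / 2) := by
  have h := mgf_gaussianReal (IsGaussian.map_eq_gaussianReal (μ := G) L) 1
  rw [h0] at h
  simpa [mgf, variance_nonneg] using h

/-- Under the exponential tilt of a centred Gaussian measure by a linear functional `L`, another
functional `D` has the same variance and its mean is its covariance with `L`. -/
lemma map_tilted_eq_gaussianReal (L D : StrongDual ℝ V) (hL : G[L] = 0) (hD : G[D] = 0) :
    (G.tilted L).map D = gaussianReal cov[L, D; G] Var[D; G].toNNReal := by
  have hiL := integrable_exp_dual (G := G) L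
  have : IsProbabilityMeasure (G.tilted L) := isProbabilityMeasure_tilted hiL
  have hmgf : mgf D (G.tilted L) = mgf id (gaussianReal cov[L, D; G] Var[D; G].toNNReal) := by
    funext t
    rw [mgf_id_gaussianReal, mgf, integral_exp_tilted]
    have h1 : G[L + t • D] = 0 := by
      have : ∀ w, (L + t • D) w = L w + t * D w := fun w => by simp
      simp only [this]
      rw [integral_add (IsGaussian.integrable_dual G L)
          ((IsGaussian.integrable_dual G D).const_mul t),
        integral_const_mul, hL, hD]
      simp
    have h2 := integral_exp_dual (L + t • D) h1
    have h3 : Var[L + t • D; G] = Var[L; G] + 2 * (t * cov[L, D; G]) + t ^ 2 * Var[D; G] := by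
      have h4 : ((L + t • D : StrongDual ℝ V) : V → ℝ) = (L : V → ℝ) + fun w => t * D w := by
        funext w
        simp
      have hL2 := IsGaussian.memLp_dual G L 2 (by simp)
      have hD2 := IsGaussian.memLp_dual G D 2 (by simp)
      rw [h4, variance_add hL2 (hD2.const_mul t), covariance_const_mul_right, variance_const_mul]
    have h5 : ∀ w, (L + fun w => t * D w) w = (L + t • D) w := fun w => by simp
    simp only [h5]
    rw [h2, h3, integral_exp_dual L hL, ← Real.exp_sub]
    congr 1
    rw [Real.coe_toNNReal _ (variance_nonneg _ _)]
    ring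
  have hc : complexMGF D (G.tilted L) =
      complexMGF id (gaussianReal cov[L, D; G] Var[D; G].toNNReal) := by
    funext z
    refine eqOn_complexMGF_of_mgf hmgf ?_
    rw [integrableExpSet_eq_of_mgf hmgf, integrableExpSet_id_gaussianReal]
    simp
  simpa using Measure.ext_of_complexMGF_eq (by fun_prop) aemeasurable_id hc

/-- Half of the computation of the bivariate exponent measure: tilting turns the expectation over
the event that the first coordinate is the larger one into a normal probability. -/
lemma setIntegral_exp_dual (L D : StrongDual ℝ V) (hL : G[L] = 0) (hD : G[D] = 0) {σ : ℝ}
    (hσ : 0 < σ) (hV : Var[D; G] = σ ^ 2) (t : ℝ) :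
    ∫ w in {w | D w ≤ t}, Real.exp (L w - Var[L; G] / 2) ∂G =
      stdNormalCDF ((t - cov[L, D; G]) / σ) := by
  have h := map_tilted_eq_gaussianReal L D hL hD
  have hs : MeasurableSet {w | D w ≤ t} := measurableSet_le (by fun_prop) measurable_const
  have : IsProbabilityMeasure (G.tilted L) := isProbabilityMeasure_tilted (integrable_exp_dual L)
  have h1 : (G.tilted L).real {w | D w ≤ t} = stdNormalCDF ((t - cov[L, D; G]) / σ) := by
    rw [← gaussianReal_real_Iic hσ, ← hV, ← h,
      map_measureReal_apply (by fun_prop) measurableSet_Iic]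
    rfl
  rw [← h1, measureReal_def, tilted_apply_eq_ofReal_integral' _ hs, ENNReal.toReal_ofReal
    (integral_nonneg fun w => by positivity), integral_exp_dual L hL]
  simp only [Real.exp_sub]

lemma integral_max_exp_dual (L₁ L₂ : StrongDual ℝ V) (h₁ : G[L₁] = 0) (h₂ : G[L₂] = 0) {σ : ℝ}
    (hσ : 0 < σ) (hV : Var[L₂ - L₁; G] = σ ^ 2) {x₁ x₂ : ℝ} (hx₁ : 0 < x₁) (hx₂ : 0 < x₂) :
    ∫ w, max (Real.exp (L₁ w - Var[L₁; G] / 2) / x₁) (Real.exp (L₂ w - Var[L₂; G] / 2) / x₂) ∂G =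
      pairExponent σ x₁ x₂ := by
  set v₁ := Var[L₁; G]
  set v₂ := Var[L₂; G]
  set D : StrongDual ℝ V := L₂ - L₁ with hDdef
  have hL₁ := IsGaussian.memLp_dual G L₁ 2 (by simp)
  have hL₂ := IsGaussian.memLp_dual G L₂ 2 (by simp)
  have hD0 : G[D] = 0 := by
    have : ∀ w, D w = L₂ w - L₁ w := fun w => by simp [hDdef]
    simp only [this]
    rw [integral_sub (IsGaussian.integrable_dual G L₂) (IsGaussian.integrable_dual G L₁), h₁, h₂,
      sub_zero]
  have hDfun : ((D : StrongDual ℝ V) : V → ℝ) = (L₂ : V → ℝ) - (L₁ : V → ℝ) := by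
    funext w
    simp [hDdef]
  have hvar : v₂ - 2 * cov[L₁, L₂; G] + v₁ = σ ^ 2 := by
    rw [← hV, hDfun, variance_sub hL₂ hL₁, covariance_comm]
  have hc₁ : cov[L₁, D; G] = (v₂ - v₁ - σ ^ 2) / 2 := by
    rw [hDfun, covariance_sub_right hL₁ hL₂ hL₁, covariance_self hL₁.1.aemeasurable, ← hvar]
    ring
  set D' : StrongDual ℝ V := L₁ - L₂ with hDdef'
  have hDneg : ∀ w, D' w = -(D w) := fun w => by simp [hDdef, hDdef']
  have hDfun' : ((D' : StrongDual ℝ V) : V → ℝ) = (L₁ : V → ℝ) - (L₂ : V → ℝ) := by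
    funext w
    simp [hDdef']
  have hc₂ : cov[L₂, D'; G] = (v₁ - v₂ - σ ^ 2) / 2 := by
    rw [hDfun', covariance_sub_right hL₂ hL₁ hL₂, covariance_self hL₂.1.aemeasurable,
      covariance_comm, ← hvar]
    ring
  have hD0' : G[D'] = 0 := by
    simp only [hDneg, integral_neg, hD0, neg_zero]
  have hV' : Var[D'; G] = σ ^ 2 := by
    rw [show (D' : V → ℝ) = fun w => -(D w) from funext hDneg, variance_fun_neg, hV]
  set T : ℝ := Real.log (x₂ / x₁) + (v₂ - v₁) / 2 with hT
  have e₁ := setIntegral_exp_dual L₁ D h₁ hD0 hσ hV T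
  have e₂ := setIntegral_exp_dual L₂ D' h₂ hD0' hσ hV' (-T)
  have hs : MeasurableSet {w | D w ≤ T} := measurableSet_le (by fun_prop) measurable_const
  have hi₁ : Integrable (fun w => Real.exp (L₁ w - v₁ / 2)) G := by
    simpa only [Real.exp_sub] using (integrable_exp_dual L₁).div_const _
  have hi₂ : Integrable (fun w => Real.exp (L₂ w - v₂ / 2)) G := by
    simpa only [Real.exp_sub] using (integrable_exp_dual L₂).div_const _
  -- the first entry of the maximum dominates exactly on `{D ≤ T}`
  have hcmp : ∀ w, D w ≤ T ↔
      Real.exp (L₂ w - v₂ / 2) / x₂ ≤ Real.exp (L₁ w - v₁ / 2) / x₁ := by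
    intro w
    rw [div_le_div_iff₀ hx₂ hx₁,
      ← Real.log_le_log_iff (x := Real.exp _ * x₁) (by positivity) (by positivity),
      Real.log_mul (Real.exp_pos _).ne' hx₁.ne', Real.log_mul (Real.exp_pos _).ne' hx₂.ne',
      Real.log_exp, Real.log_exp, hT, Real.log_div hx₂.ne' hx₁.ne', hDdef]
    simp only [FunLike.coe_sub, Pi.sub_apply]
    constructor <;> intro h <;> linarith
  have hnull : G {w | D w = T} = 0 := by
    have h1 : G {w | D w = T} = (G.map D) {T} := by
      rw [Measure.map_apply (by fun_prop) (measurableSet_singleton T)]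
      rfl
    have h2 : Var[D; G].toNNReal ≠ 0 := by
      rw [hV]
      simp [hσ.ne']
    rw [h1, IsGaussian.map_eq_gaussianReal]
    exact (nullSingletonClass_gaussianReal h2).measure_singleton T
  have hae : ({w | D w ≤ T}ᶜ : Set V) =ᵐ[G] {w | D' w ≤ -T} := by
    filter_upwards [measure_eq_zero_iff_ae_notMem.1 hnull] with w hw
    have hw' : D w ≠ T := hw
    apply propext
    change ¬ (D w ≤ T) ↔ D' w ≤ -T
    rw [hDneg, not_le, neg_le_neg_iff]
    exact ⟨le_of_lt, fun h => lt_of_le_of_ne h hw'.symm⟩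
  have hmax : Integrable (fun w => max (Real.exp (L₁ w - v₁ / 2) / x₁)
      (Real.exp (L₂ w - v₂ / 2) / x₂)) G := (hi₁.div_const x₁).sup (hi₂.div_const x₂)
  rw [← integral_add_compl hs hmax]
  have i₁ : ∫ w in {w | D w ≤ T}, max (Real.exp (L₁ w - v₁ / 2) / x₁)
      (Real.exp (L₂ w - v₂ / 2) / x₂) ∂G = 1 / x₁ * stdNormalCDF ((T - cov[L₁, D; G]) / σ) := by
    rw [← e₁, ← integral_const_mul]
    refine setIntegral_congr_fun hs fun w hw => ?_
    rw [max_eq_left ((hcmp w).1 hw)]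
    ring
  have i₂ : ∫ w in {w | D w ≤ T}ᶜ, max (Real.exp (L₁ w - v₁ / 2) / x₁)
      (Real.exp (L₂ w - v₂ / 2) / x₂) ∂G = 1 / x₂ * stdNormalCDF ((-T - cov[L₂, D'; G]) / σ) := by
    rw [← e₂, ← integral_const_mul, ← setIntegral_congr_set hae]
    refine setIntegral_congr_fun hs.compl fun w hw => ?_
    have : ¬ D w ≤ T := hw
    rw [max_eq_right (le_of_lt (not_le.1 fun h => this ((hcmp w).2 h)))]
    ring
  have hlog : Real.log (x₁ / x₂) = -Real.log (x₂ / x₁) := by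
    rw [← Real.log_inv, inv_div]
  rw [i₁, i₂, pairExponent, hc₁, hc₂, hT, hlog]
  congr 3 <;> field_simp <;> ring

end Gaussian

/-! ### One- and two-dimensional margins of the Brown–Resnick law -/

section BrownResnick

variable {d : ℕ} {s : Fin d → EuclideanSpace ℝ (Fin 2)} {ω ζ : ℝ} {ρ : Measure (Fin d → ℝ)}

lemma integrable_exp_eval (G : Measure (Fin d → ℝ)) [IsGaussian G] (v : ℝ) (j : Fin d) :
    Integrable (fun w : Fin d → ℝ => Real.exp (w j - v)) G := by
  have h := integrable_exp_dual (G := G) (ContinuousLinearMap.proj (R := ℝ) (φ := fun _ => ℝ) j)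
  simpa only [Real.exp_sub, ContinuousLinearMap.proj_apply] using h.div_const (Real.exp v)

lemma integral_exp_eval (G : Measure (Fin d → ℝ)) [IsGaussian G] (j : Fin d)
    (h0 : ∫ w, w j ∂G = 0) :
    ∫ w : Fin d → ℝ, Real.exp (w j - Var[fun w' => w' j; G] / 2) ∂G = 1 := by
  have h := integral_exp_dual (G := G) (ContinuousLinearMap.proj (R := ℝ) (φ := fun _ => ℝ) j) h0
  have he : Var[(ContinuousLinearMap.proj (R := ℝ) (φ := fun _ : Fin d => ℝ) j); G] =
      Var[fun w' => w' j; G] := rfl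
  simp only [ContinuousLinearMap.proj_apply, he] at h
  simp only [Real.exp_sub, integral_div, h]
  exact div_self (Real.exp_pos _).ne'

/-- A margin is obtained by letting the other arguments tend to infinity. -/
lemma measureReal_pair_eq_exp {G : Measure (Fin d → ℝ)} [IsGaussian G] [IsProbabilityMeasure ρ]
    {v : Fin d → ℝ}
    (h : ∀ x : Fin d → ℝ, (∀ j, 0 < x j) → ρ.real {y | ∀ j, y j ≤ x j} =
      Real.exp (-∫ w, ⨆ j, Real.exp (w j - v j) / x j ∂G)) (j l : Fin d) {x : Fin d → ℝ}
    (hx : ∀ j, 0 < x j) :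
    ρ.real {y | y j ≤ x j ∧ y l ≤ x l} =
      Real.exp (-∫ w, max (Real.exp (w j - v j) / x j) (Real.exp (w l - v l) / x l) ∂G) := by
  classical
  have : Nonempty (Fin d) := ⟨j⟩
  set X : ℕ → Fin d → ℝ := fun n i => if i = j ∨ i = l then x i else n + 1 with hX
  have hXpos : ∀ n i, 0 < X n i := fun n i => by
    rw [hX]
    beta_reduce
    split_ifs
    · exact hx i
    · positivity
  set m : (Fin d → ℝ) → ℝ := fun w =>
    max (Real.exp (w j - v j) / x j) (Real.exp (w l - v l) / x l) with hm
  set R : (Fin d → ℝ) → ℝ := fun w => ∑ i, Real.exp (w i - v i) with hR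
  have hi : ∀ i, Integrable (fun w : Fin d → ℝ => Real.exp (w i - v i)) G := fun i =>
    integrable_exp_eval G (v i) i
  have hmi : Integrable m G := ((hi j).div_const _).sup ((hi l).div_const _)
  have hRi : Integrable R G := integrable_finsetSum _ fun i _ => hi i
  have hbdd : ∀ (n : ℕ) (w : Fin d → ℝ),
      BddAbove (range fun i => Real.exp (w i - v i) / X n i) := fun n w =>
    (finite_range _).bddAbove
  have hlow : ∀ (n : ℕ) (w : Fin d → ℝ), m w ≤ ⨆ i, Real.exp (w i - v i) / X n i := by
    intro n w
    refine max_le ?_ ?_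
    · simpa [hX] using le_ciSup (hbdd n w) j
    · simpa [hX] using le_ciSup (hbdd n w) l
  have hm0 : ∀ w, 0 ≤ m w := fun w =>
    le_max_of_le_left (div_nonneg (Real.exp_pos _).le (hx j).le)
  have hup : ∀ (n : ℕ) (w : Fin d → ℝ),
      ⨆ i, Real.exp (w i - v i) / X n i ≤ m w + R w / (n + 1) := by
    intro n w
    have hR0 : 0 ≤ R w / ((n : ℝ) + 1) := by positivity
    refine ciSup_le fun i => ?_
    by_cases hij : i = j ∨ i = l
    · rcases hij with rfl | rfl
      · have : Real.exp (w i - v i) / x i ≤ m w := le_max_left _ _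
        simpa [hX] using this.trans (le_add_of_nonneg_right hR0)
      · have : Real.exp (w i - v i) / x i ≤ m w := le_max_right _ _
        simpa [hX] using this.trans (le_add_of_nonneg_right hR0)
    · simp only [hX, if_neg hij]
      have h1 : Real.exp (w i - v i) ≤ R w :=
        Finset.single_le_sum (f := fun i => Real.exp (w i - v i)) (fun i _ => (Real.exp_pos _).le)
          (Finset.mem_univ i)
      have : Real.exp (w i - v i) / ((n : ℝ) + 1) ≤ R w / (n + 1) := by gcongr
      linarith [hm0 w]
  have hsi : ∀ n, Integrable (fun w => ⨆ i, Real.exp (w i - v i) / X n i) G := by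
    intro n
    refine (hmi.add (hRi.div_const ((n : ℝ) + 1))).mono' ?_ (Eventually.of_forall fun w => ?_)
    · exact (Measurable.iSup fun i => (by fun_prop : Measurable fun w : Fin d → ℝ =>
        Real.exp (w i - v i) / X n i)).aestronglyMeasurable
    · rw [Real.norm_of_nonneg ((hm0 w).trans (hlow n w))]
      exact hup n w
  have hlim : Tendsto (fun n => ∫ w, ⨆ i, Real.exp (w i - v i) / X n i ∂G) atTop
      (𝓝 (∫ w, m w ∂G)) := by
    have h2 : Tendsto (fun n : ℕ => ∫ w, m w ∂G + (∫ w, R w ∂G) * (1 / ((n : ℝ) + 1))) atTop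
        (𝓝 (∫ w, m w ∂G)) := by
      simpa using (tendsto_one_div_add_atTop_nhds_zero_nat.const_mul (∫ w, R w ∂G)).const_add
        (∫ w, m w ∂G)
    refine tendsto_of_tendsto_of_tendsto_of_le_of_le tendsto_const_nhds h2
      (fun n => integral_mono hmi (hsi n) (hlow n)) fun n => ?_
    have := integral_mono (hsi n) (hmi.add (hRi.div_const ((n : ℝ) + 1))) (hup n)
    simp only [Pi.add_apply] at this
    rw [integral_add hmi (hRi.div_const _), integral_div] at this
    rw [mul_one_div]
    exact this
  have hset : (⋃ n, {y : Fin d → ℝ | ∀ i, y i ≤ X n i}) = {y | y j ≤ x j ∧ y l ≤ x l} := by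
    ext y
    simp only [mem_iUnion, mem_ofPred_eq]
    constructor
    · rintro ⟨n, hn⟩
      exact ⟨by simpa [hX] using hn j, by simpa [hX] using hn l⟩
    · rintro ⟨h1, h2⟩
      obtain ⟨n, hn⟩ := exists_nat_gt (∑ i, |y i|)
      refine ⟨n, fun i => ?_⟩
      by_cases hij : i = j ∨ i = l
      · rcases hij with rfl | rfl <;> simpa [hX]
      · simp only [hX, if_neg hij]
        have := Finset.single_le_sum (f := fun i => |y i|) (fun i _ => abs_nonneg _)
          (Finset.mem_univ i)
        have := le_abs_self (y i)
        linarith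
  have hmono : Monotone fun n => {y : Fin d → ℝ | ∀ i, y i ≤ X n i} := by
    intro n n' hnn y hy i
    refine le_trans (hy i) ?_
    simp only [hX]
    split_ifs
    · exact le_rfl
    · have : (n : ℝ) ≤ n' := by exact_mod_cast hnn
      linarith
  have h3 := tendsto_measure_iUnion_atTop (μ := ρ) hmono
  rw [hset] at h3
  have h4 := (ENNReal.tendsto_toReal (measure_ne_top ρ _)).comp h3
  refine tendsto_nhds_unique h4 ?_
  have h5 := (Real.continuous_exp.tendsto _).comp hlim.neg
  refine h5.congr fun n => ?_
  simp only [Function.comp_apply]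
  exact (h (X n) (hXpos n)).symm

/-- The margins are unit Fréchet. -/
lemma IsBrownResnick.measureReal_le (h : IsBrownResnick s ω ζ ρ) (j : Fin d) {x : ℝ} (hx : 0 < x) :
    ρ.real {y | y j ≤ x} = Real.exp (-(1 / x)) := by
  obtain ⟨hp, G, hG, h0, -, hF⟩ := h
  have h1 := measureReal_pair_eq_exp hF j j (x := fun _ => x) fun _ => hx
  simp only [and_self, max_self] at h1
  rw [h1, integral_div, integral_exp_eval G j (h0 j)]

lemma sqrt_semivariogram_pos {h : EuclideanSpace ℝ (Fin 2)} (hh : h ≠ 0) (ω ζ : ℝ) :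
    0 < √(2 * semivariogram ω ζ h) := by
  have : 0 < ‖h‖ := norm_pos_iff.2 hh
  unfold semivariogram
  positivity

/-- The bivariate margins have the Hüsler–Reiss exponent measure. -/
lemma IsBrownResnick.measureReal_pair (h : IsBrownResnick s ω ζ ρ) {j l : Fin d} (hjl : s j ≠ s l)
    {x₁ x₂ : ℝ} (hx₁ : 0 < x₁) (hx₂ : 0 < x₂) :
    ρ.real {y | y j ≤ x₁ ∧ y l ≤ x₂} = pairCDF (√(2 * semivariogram ω ζ (s j - s l))) x₁ x₂ := by
  obtain ⟨hp, G, hG, h0, hv, hF⟩ := h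
  have hne : l ≠ j := fun h => hjl (by rw [h])
  have h1 := measureReal_pair_eq_exp hF j l (x := fun i => if i = j then x₁ else x₂)
    fun i => by split_ifs <;> assumption
  simp only [if_true, if_neg hne] at h1
  rw [h1, pairCDF]
  congr 2
  have hσ := sqrt_semivariogram_pos (sub_ne_zero.2 hjl) ω ζ
  set L : Fin d → StrongDual ℝ (Fin d → ℝ) := fun i =>
    ContinuousLinearMap.proj (R := ℝ) (φ := fun _ => ℝ) i with hL
  have hi : ∀ i, Integrable (fun w : Fin d → ℝ => w i) G := fun i =>
    IsGaussian.integrable_dual G (L i)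
  have hV : Var[L l - L j; G] = √(2 * semivariogram ω ζ (s j - s l)) ^ 2 := by
    have hfun : ((L l - L j : StrongDual ℝ (Fin d → ℝ)) : (Fin d → ℝ) → ℝ) =
        fun w => w l - w j := by
      funext w
      simp [hL]
    have hm0 : ∫ w : Fin d → ℝ, (w l - w j) ∂G = 0 := by
      rw [integral_sub (hi l) (hi j), h0, h0, sub_zero]
    rw [hfun, variance_eq_integral (by fun_prop), hm0, Real.sq_sqrt (by
      unfold semivariogram
      positivity), ← hv j l]
    congr 1
    funext w
    ring
  exact integral_max_exp_dual (L j) (L l) (h0 j) (h0 l) hσ hV hx₁ hx₂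

lemma IsBrownResnick.ae_pos (h : IsBrownResnick s ω ζ ρ) : ∀ᵐ y ∂ρ, ∀ j, 0 < y j := by
  have hp := h.1
  refine ae_all_iff.2 fun j => ?_
  rw [ae_iff]
  have h1 : ∀ x : ℝ, 0 < x → ρ.real {y | ¬ 0 < y j} ≤ Real.exp (-(1 / x)) := by
    intro x hx
    rw [← h.measureReal_le j hx]
    refine measureReal_mono fun y hy => ?_
    have : ¬ 0 < y j := hy
    exact le_trans (not_lt.1 this) hx.le
  have h2 : Tendsto (fun x : ℝ => Real.exp (-(1 / x))) (𝓝[>] 0) (𝓝 0) := by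
    refine Real.tendsto_exp_atBot.comp (tendsto_neg_atTop_atBot.comp ?_)
    exact tendsto_inv_nhdsGT_zero.congr fun x => (one_div x).symm
  have h3 : ρ.real {y | ¬ 0 < y j} ≤ 0 :=
    ge_of_tendsto h2 (eventually_mem_nhdsWithin.mono fun x hx => h1 x hx)
  exact (measureReal_eq_zero_iff).1 (le_antisymm h3 measureReal_nonneg)

end BrownResnick

/-! ### The generalized extreme-value margins -/

section Margins

variable {μ σ ξ : ℝ}

/-- The logarithm of the Fréchet transform. -/
lemma toFrechet_eq_exp {y : ℝ} (h : 0 < 1 + ξ * (y - μ) / σ) :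
    toFrechet μ σ ξ y = Real.exp (boxLog ξ ((y - μ) / σ)) := by
  unfold toFrechet boxLog
  split_ifs with hξ
  · rfl
  · rw [Real.rpow_def_of_pos h, mul_div_assoc]
    ring_nf

lemma toFrechet_pos {y : ℝ} (h : 0 < 1 + ξ * (y - μ) / σ) :
    0 < toFrechet μ σ ξ y := by
  rw [toFrechet_eq_exp h]
  exact Real.exp_pos _

lemma fromFrechet_arg (σ_pos : 0 < σ) (hξ : ξ ≠ 0) (x : ℝ) :
    1 + ξ * (fromFrechet μ σ ξ x - μ) / σ = x ^ ξ := by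
  rw [fromFrechet, if_neg hξ]
  field_simp
  ring

lemma fromFrechet_arg_pos (σ_pos : 0 < σ) {x : ℝ} (hx : 0 < x) :
    0 < 1 + ξ * (fromFrechet μ σ ξ x - μ) / σ := by
  by_cases hξ : ξ = 0
  · simp [hξ]
  · rw [fromFrechet_arg σ_pos hξ]
    positivity

lemma toFrechet_fromFrechet (σ_pos : 0 < σ) {x : ℝ} (hx : 0 < x) :
    toFrechet μ σ ξ (fromFrechet μ σ ξ x) = x := by
  by_cases hξ : ξ = 0
  · simp only [toFrechet, fromFrechet, if_pos hξ]
    rw [add_sub_cancel_left, mul_div_cancel_left₀ _ σ_pos.ne', Real.exp_log hx]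
  · rw [toFrechet, if_neg hξ, fromFrechet_arg σ_pos hξ, ← Real.rpow_mul hx.le,
      mul_one_div_cancel hξ, Real.rpow_one]

lemma hasDerivAt_toFrechet {y : ℝ} (h : 0 < 1 + ξ * (y - μ) / σ) :
    HasDerivAt (toFrechet μ σ ξ)
      (toFrechet μ σ ξ y * ((1 + ξ * (y - μ) / σ)⁻¹ * σ⁻¹)) y := by
  have h1 : HasDerivAt (fun y => (y - μ) / σ) σ⁻¹ y := by
    simpa [div_eq_mul_inv] using ((hasDerivAt_id' y).sub_const μ).mul_const σ⁻¹
  have h' : 0 < 1 + ξ * ((y - μ) / σ) := by rwa [← mul_div_assoc]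
  have h2 := ((hasDerivAt_boxLog h').comp y h1).exp
  have hev : toFrechet μ σ ξ =ᶠ[𝓝 y] fun y => Real.exp (boxLog ξ ((y - μ) / σ)) := by
    have hc : Continuous fun y => 1 + ξ * (y - μ) / σ := by fun_prop
    filter_upwards [hc.continuousAt.eventually (lt_mem_nhds h)] with t ht
    exact toFrechet_eq_exp ht
  rw [toFrechet_eq_exp h]
  refine (h2.congr_of_eventuallyEq hev).congr_deriv ?_
  rw [mul_div_assoc]
  rfl

lemma jacobian_eq {y : ℝ} (h : 0 < 1 + ξ * (y - μ) / σ) :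
    jacobian μ σ ξ y = toFrechet μ σ ξ y * ((1 + ξ * (y - μ) / σ)⁻¹ * σ⁻¹) :=
  (hasDerivAt_toFrechet h).deriv

lemma strictMonoOn_toFrechet (σ_pos : 0 < σ) :
    StrictMonoOn (toFrechet μ σ ξ) {y | 0 < 1 + ξ * (y - μ) / σ} := by
  have hconv : Convex ℝ {y : ℝ | 0 < 1 + ξ * (y - μ) / σ} := by
    intro a ha b hb s t hs ht hst
    have ha' : 0 < 1 + ξ * (a - μ) / σ := ha
    have hb' : 0 < 1 + ξ * (b - μ) / σ := hb
    have h1 : 1 + ξ * (s • a + t • b - μ) / σ =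
        s * (1 + ξ * (a - μ) / σ) + t * (1 + ξ * (b - μ) / σ) := by
      have : t = 1 - s := by linarith
      simp only [smul_eq_mul, this]
      ring
    change 0 < 1 + ξ * (s • a + t • b - μ) / σ
    rw [h1]
    rcases hs.eq_or_lt with rfl | hs
    · have : t = 1 := by linarith
      simpa [this] using hb'
    · have := mul_pos hs ha'
      have := mul_nonneg ht hb'.le
      linarith
  refine strictMonoOn_of_deriv_pos hconv
    (fun y hy => (hasDerivAt_toFrechet hy).continuousAt.continuousWithinAt) fun y hy => ?_
  have hy' := interior_subset hy
  have hy'' : 0 < 1 + ξ * (y - μ) / σ := hy'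
  rw [(hasDerivAt_toFrechet hy').deriv]
  exact mul_pos (toFrechet_pos hy') (mul_pos (inv_pos.2 hy'') (inv_pos.2 σ_pos))

lemma fromFrechet_le_iff (σ_pos : 0 < σ) {x y : ℝ} (hx : 0 < x) (h : 0 < 1 + ξ * (y - μ) / σ) :
    fromFrechet μ σ ξ x ≤ y ↔ x ≤ toFrechet μ σ ξ y := by
  rw [← (strictMonoOn_toFrechet σ_pos).le_iff_le (fromFrechet_arg_pos σ_pos hx) h,
    toFrechet_fromFrechet σ_pos hx]

end Margins

/-! ### Consequences of the common support -/

section Support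

variable {d q₁ q₂ q₃ : ℕ}

lemma gevScale_pos (θ : Param q₁ q₂ q₃) (z : Design d q₁ q₂ q₃) (j : Fin d) :
    0 < gevScale θ z j := Real.exp_pos _

lemma continuous_gevLoc (j : Fin d) :
    Continuous fun p : Param q₁ q₂ q₃ × Design d q₁ q₂ q₃ => gevLoc p.1 p.2 j := by
  unfold gevLoc
  fun_prop

lemma continuous_gevScale (j : Fin d) :
    Continuous fun p : Param q₁ q₂ q₃ × Design d q₁ q₂ q₃ => gevScale p.1 p.2 j := by
  unfold gevScale
  fun_prop

lemma continuous_gevShape (j : Fin d) :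
    Continuous fun p : Param q₁ q₂ q₃ × Design d q₁ q₂ q₃ => gevShape p.1 p.2 j := by
  unfold gevShape
  fun_prop

/-- The quantity `1 + ξ (y - μ) / σ`, positive exactly on the support of the generalized
extreme-value distribution. -/
def gevArg (θ : Param q₁ q₂ q₃) (z : Design d q₁ q₂ q₃) (j : Fin d) (y : ℝ) : ℝ :=
  1 + gevShape θ z j * (y - gevLoc θ z j) / gevScale θ z j

lemma continuous_gevArg (j : Fin d) (y : ℝ) :
    Continuous fun p : Param q₁ q₂ q₃ × Design d q₁ q₂ q₃ => gevArg p.1 p.2 j y := by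
  have h1 := continuous_gevLoc (q₁ := q₁) (q₂ := q₂) (q₃ := q₃) j
  have h2 := continuous_gevScale (q₁ := q₁) (q₂ := q₂) (q₃ := q₃) j
  have h3 := continuous_gevShape (q₁ := q₁) (q₂ := q₂) (q₃ := q₃) j
  unfold gevArg
  exact continuous_const.add ((h3.mul (continuous_const.sub h1)).div h2
    fun p => (gevScale_pos p.1 p.2 j).ne')

variable (B : Block d q₁ q₂ q₃) (ρ : ℝ → ℝ → Measure (Fin d → ℝ))

/-- The censored observation obtained from covariates and a unit Fréchet vector. -/
def simulate (θ : Param q₁ q₂ q₃) (zx : Design d q₁ q₂ q₃ × (Fin d → ℝ)) : Obs d q₁ q₂ q₃ :=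
  censor B (zx.1, fun j =>
    fromFrechet (gevLoc θ zx.1 j) (gevScale θ zx.1 j) (gevShape θ zx.1 j) (zx.2 j))

lemma measurable_simulate (θ : Param q₁ q₂ q₃) : Measurable (simulate B θ) := by
  have h1 : ∀ j, Measurable fun z : Design d q₁ q₂ q₃ => gevLoc θ z j := fun j =>
    ((continuous_gevLoc j).comp (Continuous.prodMk_right θ)).measurable
  have h2 : ∀ j, Measurable fun z : Design d q₁ q₂ q₃ => gevScale θ z j := fun j =>
    ((continuous_gevScale j).comp (Continuous.prodMk_right θ)).measurable
  have h3 : ∀ j, Measurable fun z : Design d q₁ q₂ q₃ => gevShape θ z j := fun j =>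
    ((continuous_gevShape j).comp (Continuous.prodMk_right θ)).measurable
  refine measurable_fst.prodMk (measurable_pi_lambda _ fun j => ?_)
  have hx : Measurable fun zx : Design d q₁ q₂ q₃ × (Fin d → ℝ) => zx.2 j := by fun_prop
  have h1' : Measurable fun zx : Design d q₁ q₂ q₃ × (Fin d → ℝ) => gevLoc θ zx.1 j :=
    (h1 j).comp measurable_fst
  have h2' : Measurable fun zx : Design d q₁ q₂ q₃ × (Fin d → ℝ) => gevScale θ zx.1 j :=
    (h2 j).comp measurable_fst
  have h3' : Measurable fun zx : Design d q₁ q₂ q₃ × (Fin d → ℝ) => gevShape θ zx.1 j :=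
    (h3 j).comp measurable_fst
  refine Measurable.max ?_ measurable_const
  refine Measurable.ite (h3' (measurableSet_singleton 0)) ?_ ?_
  · exact h1'.add (h2'.mul (Real.measurable_log.comp hx))
  · exact h1'.add ((h2'.div h3').mul ((hx.pow h3').sub_const 1))

lemma obsLaw_eq (θ : Param q₁ q₂ q₃) :
    obsLaw B ρ θ = (B.covLaw.prod (ρ (omega θ) (zeta θ))).map (simulate B θ) := rfl

variable {B ρ} {Θ : Set (Param q₁ q₂ q₃)} {θ₀ : Param q₁ q₂ q₃}

lemma isProbabilityMeasure_obsLaw [IsProbabilityMeasure B.covLaw]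
    (h_BR : ∀ ω ζ : ℝ, IsBrownResnick B.site ω ζ (ρ ω ζ)) (θ : Param q₁ q₂ q₃) :
    IsProbabilityMeasure (obsLaw B ρ θ) := by
  have := (h_BR (omega θ) (zeta θ)).1
  rw [obsLaw_eq]
  exact Measure.isProbabilityMeasure_map (measurable_simulate B θ).aemeasurable

/-- An event has positive probability if its conditional probability given the covariates is
positive for almost all covariates in a neighbourhood of a point of their support. -/
lemma obsLaw_pos [IsProbabilityMeasure B.covLaw]
    (h_BR : ∀ ω ζ : ℝ, IsBrownResnick B.site ω ζ (ρ ω ζ)) (θ : Param q₁ q₂ q₃)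
    {z : Design d q₁ q₂ q₃} (hz : z ∈ B.covLaw.support) {N : Set (Design d q₁ q₂ q₃)}
    (hN : N ∈ 𝓝 z) {W : Set (Obs d q₁ q₂ q₃)} (hW : MeasurableSet W)
    (h : ∀ᵐ z' ∂B.covLaw, z' ∈ N →
      ρ (omega θ) (zeta θ) {x | simulate B θ (z', x) ∈ W} ≠ 0) : 0 < obsLaw B ρ θ W := by
  have := (h_BR (omega θ) (zeta θ)).1
  rw [pos_iff_ne_zero]
  intro h0
  rw [obsLaw_eq, Measure.map_apply (measurable_simulate B θ) hW,
    Measure.measure_prod_null (measurable_simulate B θ hW)] at h0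
  have h1 : B.covLaw N = 0 := by
    rw [measure_eq_zero_iff_ae_notMem]
    filter_upwards [h, h0] with z' h1 h2 hz'
    exact h1 hz' h2
  exact ((Measure.mem_support_iff_forall z).1 hz N hN).ne' h1

lemma ae_gevArg_pos [IsProbabilityMeasure B.covLaw]
    (h_BR : ∀ ω ζ : ℝ, IsBrownResnick B.site ω ζ (ρ ω ζ))
    (h_reg : Regular B ρ Θ θ₀) {θ : Param q₁ q₂ q₃} (hθ : θ ∈ Θ) :
    ∀ᵐ z ∂B.covLaw, ∀ j, 0 < gevArg θ z j (B.thr j) := by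
  have := (h_BR (omega θ₀) (zeta θ₀)).1
  have h1 : ∀ᵐ o ∂obsLaw B ρ θ₀, o ∈ (obsLaw B ρ θ₀).support := Measure.support_mem_ae
  rw [obsLaw_eq] at h1
  have h2 := ae_of_ae_map (measurable_simulate B θ₀).aemeasurable h1
  have h3 := Measure.ae_ae_of_ae_prod h2
  filter_upwards [h3] with z hz j
  obtain ⟨x, hx⟩ := hz.exists
  exact h_reg.thr_valid θ hθ _ hx j

lemma thr_mem_support [IsProbabilityMeasure B.covLaw]
    (h_BR : ∀ ω ζ : ℝ, IsBrownResnick B.site ω ζ (ρ ω ζ))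
    (h_reg : Regular B ρ Θ θ₀) {z : Design d q₁ q₂ q₃} (hz : z ∈ B.covLaw.support) :
    (z, B.thr) ∈ (obsLaw B ρ θ₀).support := by
  rw [Measure.mem_support_iff_forall]
  intro U hU
  obtain ⟨N, hN, V, hV, hNV⟩ := mem_nhds_prod_iff.1 hU
  obtain ⟨N', hN', hN'o, hzN'⟩ := mem_nhds_iff.1 hN
  obtain ⟨V', hV', hV'o, hzV'⟩ := mem_nhds_iff.1 hV
  have hBR := h_BR (omega θ₀) (zeta θ₀)
  refine lt_of_lt_of_le (obsLaw_pos h_BR θ₀ hz (hN'o.mem_nhds hzN')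
    (hN'o.prod hV'o).measurableSet ?_) (measure_mono ((prod_mono hN' hV').trans hNV))
  filter_upwards [ae_gevArg_pos h_BR h_reg (interior_subset h_reg.interior)] with z' hz' hzN h0
  have hpos : 0 < (ρ (omega θ₀) (zeta θ₀)).real {x | ∀ j, x j ≤ frechetThr B θ₀ z' j} := by
    obtain ⟨-, G, -, -, -, hF⟩ := hBR
    rw [hF (fun j => frechetThr B θ₀ z' j) fun j => toFrechet_pos (hz' j)]
    exact Real.exp_pos _
  have h1 : (ρ (omega θ₀) (zeta θ₀)) {x | ∀ j, x j ≤ frechetThr B θ₀ z' j} = 0 := by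
    rw [measure_eq_zero_iff_ae_notMem] at h0 ⊢
    filter_upwards [h0, hBR.ae_pos] with x hx hxpos hle
    refine hx ⟨hzN, ?_⟩
    have : (simulate B θ₀ (z', x)).2 = B.thr := by
      funext j
      exact max_eq_right ((fromFrechet_le_iff (gevScale_pos θ₀ z' j) (hxpos j) (hz' j)).2 (hle j))
    rw [this]
    exact hzV'
  rw [measureReal_def, h1] at hpos
  simp at hpos

lemma gevArg_thr_pos [IsProbabilityMeasure B.covLaw]
    (h_BR : ∀ ω ζ : ℝ, IsBrownResnick B.site ω ζ (ρ ω ζ))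
    (h_reg : Regular B ρ Θ θ₀) {θ : Param q₁ q₂ q₃} (hθ : θ ∈ Θ) {z : Design d q₁ q₂ q₃}
    (hz : z ∈ B.covLaw.support) (j : Fin d) : 0 < gevArg θ z j (B.thr j) :=
  h_reg.thr_valid θ hθ _ (thr_mem_support h_BR h_reg hz) j

/-- A value `e` above the upper endpoint of a margin under one parameter cannot lie in the interior
of the support under another: outcomes above `e`, with covariates near `z`, would have probability
zero under the former and positive probability under the latter. -/
lemma gevArg_endpoint [IsProbabilityMeasure B.covLaw]
    (h_BR : ∀ ω ζ : ℝ, IsBrownResnick B.site ω ζ (ρ ω ζ))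
    (h_reg : Regular B ρ Θ θ₀) {θa θb : Param q₁ q₂ q₃} (ha : θa ∈ Θ) (hb : θb ∈ Θ)
    {z : Design d q₁ q₂ q₃} (hz : z ∈ B.covLaw.support) {j : Fin d}
    (hξ : gevShape θa z j < 0) {e : ℝ} (hea : gevArg θa z j e < 0) : gevArg θb z j e ≤ 0 := by
  by_contra hcon
  push Not at hcon
  have ca : Continuous fun z' : Design d q₁ q₂ q₃ => gevArg θa z' j e :=
    (continuous_gevArg j e).comp (Continuous.prodMk_right θa)
  have cb : Continuous fun z' : Design d q₁ q₂ q₃ => gevArg θb z' j e :=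
    (continuous_gevArg j e).comp (Continuous.prodMk_right θb)
  have cx : Continuous fun z' : Design d q₁ q₂ q₃ => gevShape θa z' j :=
    (continuous_gevShape j).comp (Continuous.prodMk_right θa)
  have hue : B.thr j < e := by
    by_contra h
    push Not at h
    have h1 := gevArg_thr_pos h_BR h_reg ha hz j
    have h2 : gevShape θa z j * (B.thr j - gevLoc θa z j) ≤
        gevShape θa z j * (e - gevLoc θa z j) := by nlinarith
    have h3 := div_le_div_of_nonneg_right h2 (gevScale_pos θa z j).le
    unfold gevArg at h1 hea
    linarith
  set N : Set (Design d q₁ q₂ q₃) :=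
    {z' | gevArg θa z' j e < 0} ∩ {z' | 0 < gevArg θb z' j e} ∩ {z' | gevShape θa z' j < 0} with hN
  have hNo : IsOpen N := ((isOpen_lt ca continuous_const).inter
    (isOpen_lt continuous_const cb)).inter (isOpen_lt cx continuous_const)
  have hzN : z ∈ N := ⟨⟨hea, hcon⟩, hξ⟩
  set W : Set (Obs d q₁ q₂ q₃) := N ×ˢ {y | e < y j} with hWdef
  have hWo : IsOpen W := hNo.prod (isOpen_lt continuous_const (continuous_apply j))
  have hBRa := h_BR (omega θa) (zeta θa)
  have hBRb := h_BR (omega θb) (zeta θb)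
  have hpa := hBRa.1
  have hpb := hBRb.1
  have hWa : obsLaw B ρ θa W = 0 := by
    rw [obsLaw_eq, Measure.map_apply (measurable_simulate B θa) hWo.measurableSet,
      Measure.measure_prod_null (measurable_simulate B θa hWo.measurableSet)]
    refine Eventually.of_forall fun z' => ?_
    simp only [Pi.zero_apply]
    rw [measure_eq_zero_iff_ae_notMem]
    filter_upwards [hBRa.ae_pos] with x hx hmem
    obtain ⟨⟨⟨h1, -⟩, h2⟩, h3⟩ := hmem
    have h1' : gevArg θa z' j e < 0 := h1
    have h2' : gevShape θa z' j < 0 := h2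
    have h3' : e < max (fromFrechet (gevLoc θa z' j) (gevScale θa z' j) (gevShape θa z' j) (x j))
      (B.thr j) := h3
    have h4 := fromFrechet_arg_pos (μ := gevLoc θa z' j) (ξ := gevShape θa z' j)
      (gevScale_pos θa z' j) (hx j)
    rcases lt_max_iff.1 h3' with h5 | h5
    · have h6 := mul_le_mul_of_nonpos_left (sub_le_sub_right h5.le (gevLoc θa z' j)) h2'.le
      have h7 := div_le_div_of_nonneg_right h6 (gevScale_pos θa z' j).le
      unfold gevArg at h1'
      linarith
    · linarith
  have hWb : 0 < obsLaw B ρ θb W := by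
    refine obsLaw_pos h_BR θb hz (hNo.mem_nhds hzN) hWo.measurableSet
      (Eventually.of_forall fun z' hz' h0 => ?_)
    have harg : 0 < gevArg θb z' j e := hz'.1.2
    set t := toFrechet (gevLoc θb z' j) (gevScale θb z' j) (gevShape θb z' j) e with ht
    have htpos : 0 < t := toFrechet_pos harg
    have h1 : ∀ᵐ x ∂ρ (omega θb) (zeta θb), x j ≤ t := by
      rw [measure_eq_zero_iff_ae_notMem] at h0
      filter_upwards [h0, hBRb.ae_pos] with x hx hxpos
      by_contra hlt
      refine hx ⟨hz', ?_⟩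
      have : e < fromFrechet (gevLoc θb z' j) (gevScale θb z' j) (gevShape θb z' j) (x j) := by
        by_contra h
        exact hlt ((fromFrechet_le_iff (gevScale_pos θb z' j) (hxpos j) harg).1 (not_lt.1 h))
      exact lt_max_of_lt_left this
    have h2 := hBRb.measureReal_le j htpos
    have h4 : ρ (omega θb) (zeta θb) {x | x j ≤ t} = 1 := by
      rw [← prob_compl_eq_zero_iff (measurableSet_le (measurable_pi_apply j) measurable_const)]
      exact ae_iff.1 h1
    rw [measureReal_def, h4] at h2
    have h3 : Real.exp (-(1 / t)) < 1 := Real.exp_lt_one_iff.2 (by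
      have := one_div_pos.2 htpos
      linarith)
    simp only [ENNReal.toReal_one] at h2
    linarith
  have hsupp : (obsLaw B ρ θa).support = (obsLaw B ρ θb).support :=
    (h_reg.support_eq θa ha).trans (h_reg.support_eq θb hb).symm
  obtain ⟨o, ho, hos⟩ := Measure.nonempty_inter_support_of_pos hWb
  exact Measure.subset_compl_support_of_isOpen hWo hWa ho (hsupp ▸ hos)

end Support

section Shape

variable {d q₁ q₂ q₃ : ℕ}

/-- The direction in the parameter space that moves the shape coefficients by `v`. -/
def shapeDir (q₁ q₂ : ℕ) {q₃ : ℕ} (v : Fin q₃ → ℝ) : Param q₁ q₂ q₃ :=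
  WithLp.toLp 2 (Sum.elim 0 (Sum.elim 0 (Sum.elim 0 v)))

lemma gevLoc_add_shapeDir (θ : Param q₁ q₂ q₃) (v : Fin q₃ → ℝ) (z : Design d q₁ q₂ q₃)
    (j : Fin d) : gevLoc (θ + shapeDir q₁ q₂ v) z j = gevLoc θ z j := by
  simp [gevLoc, shapeDir]

lemma gevScale_add_shapeDir (θ : Param q₁ q₂ q₃) (v : Fin q₃ → ℝ) (z : Design d q₁ q₂ q₃)
    (j : Fin d) : gevScale (θ + shapeDir q₁ q₂ v) z j = gevScale θ z j := by
  simp [gevScale, shapeDir]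

lemma gevShape_add_shapeDir (θ : Param q₁ q₂ q₃) (v : Fin q₃ → ℝ) (z : Design d q₁ q₂ q₃)
    (j : Fin d) :
    gevShape (θ + shapeDir q₁ q₂ v) z j = gevShape θ z j + ∑ i, (z j).2.2 i * v i := by
  simp [gevShape, shapeDir, mul_add, Finset.sum_add_distrib]

lemma norm_shapeDir_single (i : Fin q₃) (t : ℝ) :
    ‖shapeDir q₁ q₂ (Pi.single i t)‖ = |t| := by
  have : shapeDir q₁ q₂ (Pi.single i t) =
      EuclideanSpace.single (Sum.inr (Sum.inr (Sum.inr i)) : ParamIdx q₁ q₂ q₃) t := by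
    ext a
    rcases a with a | a | a | a <;> simp [shapeDir]
  rw [this, PiLp.norm_single, Real.norm_eq_abs]

variable {B : Block d q₁ q₂ q₃} {ρ : ℝ → ℝ → Measure (Fin d → ℝ)} {Θ : Set (Param q₁ q₂ q₃)}
  {θ₀ : Param q₁ q₂ q₃}

/-- A negative shape would make the upper endpoint of a margin move with the shape coefficients. -/
lemma gevShape_true_nonneg [IsProbabilityMeasure B.covLaw]
    (h_BR : ∀ ω ζ : ℝ, IsBrownResnick B.site ω ζ (ρ ω ζ))
    (h_reg : Regular B ρ Θ θ₀) {z : Design d q₁ q₂ q₃} (hz : z ∈ B.covLaw.support) (j : Fin d) :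
    0 ≤ gevShape θ₀ z j := by
  by_contra hneg
  push Not at hneg
  -- Shrinking the shape coefficients by the factor `1 - t` moves the endpoint to the right; `e`
  -- lies between the two endpoints.
  set β : Fin q₃ → ℝ := fun i => θ₀ (Sum.inr (Sum.inr (Sum.inr i))) with hβ
  have hc : Continuous fun t : ℝ => θ₀ + shapeDir q₁ q₂ (-t • β) := by
    refine continuous_const.add ((PiLp.continuous_toLp 2 _).comp (continuous_pi fun a => ?_))
    rcases a with a | a | a | a <;>
      simp only [Sum.elim_inl, Sum.elim_inr, Pi.zero_apply, Pi.smul_apply] <;> fun_prop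
  have h0 : (fun t : ℝ => θ₀ + shapeDir q₁ q₂ (-t • β)) 0 = θ₀ := by
    ext a
    rcases a with a | a | a | a <;> simp [shapeDir]
  have hev : ∀ᶠ t in 𝓝[>] (0 : ℝ), θ₀ + shapeDir q₁ q₂ (-t • β) ∈ Θ := by
    refine (hc.continuousAt.eventually ?_).filter_mono nhdsWithin_le_nhds
    rw [h0]
    exact mem_interior_iff_mem_nhds.1 h_reg.interior
  obtain ⟨t, ⟨hΘ, ht1⟩, ht0⟩ := ((hev.and ((eventually_lt_nhds (zero_lt_one' ℝ)).filter_mono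
    nhdsWithin_le_nhds)).and self_mem_nhdsWithin).exists
  have ht0' : 0 < t := ht0
  have hσ := gevScale_pos θ₀ z j
  set e : ℝ := gevLoc θ₀ z j - gevScale θ₀ z j * (1 + t / 2) / gevShape θ₀ z j with he
  have hsum : ∑ i, (z j).2.2 i * (-t • β) i = -t * gevShape θ₀ z j := by
    simp only [gevShape, Finset.mul_sum, hβ, Pi.smul_apply, smul_eq_mul]
    exact Finset.sum_congr rfl fun i _ => by ring
  have ha : gevArg θ₀ z j e = -(t / 2) := by
    rw [gevArg, he]
    field_simp [hneg.ne]
    ring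
  have hb : gevArg (θ₀ + shapeDir q₁ q₂ (-t • β)) z j e = t / 2 * (1 + t) := by
    rw [gevArg, gevLoc_add_shapeDir, gevScale_add_shapeDir, gevShape_add_shapeDir, hsum, he]
    field_simp [hneg.ne]
    ring
  have h := gevArg_endpoint h_BR h_reg (interior_subset h_reg.interior) hΘ hz hneg
    (by rw [ha]; linarith : gevArg θ₀ z j e < 0)
  rw [hb] at h
  have : 0 < t / 2 * (1 + t) := by positivity
  linarith

lemma gevShape_nonneg [IsProbabilityMeasure B.covLaw]
    (h_BR : ∀ ω ζ : ℝ, IsBrownResnick B.site ω ζ (ρ ω ζ))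
    (h_reg : Regular B ρ Θ θ₀) {θ : Param q₁ q₂ q₃} (hθ : θ ∈ Θ) {z : Design d q₁ q₂ q₃}
    (hz : z ∈ B.covLaw.support) (j : Fin d) : 0 ≤ gevShape θ z j := by
  by_contra hneg
  push Not at hneg
  have hσ := gevScale_pos θ z j
  have h0 := gevShape_true_nonneg h_BR h_reg hz j
  -- At `θ₀` the shape is nonnegative, so that large values such as `e` remain in the support.
  set e : ℝ := max (gevLoc θ₀ z j) (gevLoc θ z j - 2 * gevScale θ z j / gevShape θ z j) with he
  have ha : gevArg θ z j e < 0 := by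
    have h1 : gevShape θ z j * (e - gevLoc θ z j) ≤
        gevShape θ z j * (-(2 * gevScale θ z j / gevShape θ z j)) := by
      refine mul_le_mul_of_nonpos_left ?_ hneg.le
      linarith [le_max_right (gevLoc θ₀ z j) (gevLoc θ z j - 2 * gevScale θ z j / gevShape θ z j)]
    have h2 := div_le_div_of_nonneg_right h1 hσ.le
    have h3 : gevShape θ z j * (-(2 * gevScale θ z j / gevShape θ z j)) / gevScale θ z j = -2 := by
      field_simp [hneg.ne]
    unfold gevArg
    linarith
  have h := gevArg_endpoint h_BR h_reg hθ (interior_subset h_reg.interior) hz hneg ha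
  have h1 : 0 ≤ gevShape θ₀ z j * (e - gevLoc θ₀ z j) / gevScale θ₀ z j :=
    div_nonneg (mul_nonneg h0 (sub_nonneg.2 (le_max_left _ _))) (gevScale_pos θ₀ z j).le
  unfold gevArg at h
  linarith

/-- Well inside the parameter space the shape is bounded below by a multiple of the norm of its
covariates, as it stays nonnegative when the coefficients are perturbed. -/
lemma mul_norm_le_gevShape [IsProbabilityMeasure B.covLaw]
    (h_BR : ∀ ω ζ : ℝ, IsBrownResnick B.site ω ζ (ρ ω ζ))
    (h_reg : Regular B ρ Θ θ₀) {θ : Param q₁ q₂ q₃} {δ : ℝ} (hδ : 0 < δ)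
    (hΘ : Metric.closedBall θ δ ⊆ Θ) {z : Design d q₁ q₂ q₃}
    (hz : z ∈ B.covLaw.support) (j : Fin d) : δ * ‖(z j).2.2‖ ≤ gevShape θ z j := by
  have h0 : 0 ≤ gevShape θ z j :=
    gevShape_nonneg h_BR h_reg (hΘ (Metric.mem_closedBall_self hδ.le)) hz j
  rw [← le_div_iff₀' hδ, pi_norm_le_iff_of_nonneg (by positivity)]
  intro i
  rw [le_div_iff₀' hδ, Real.norm_eq_abs]
  have key : ∀ t : ℝ, |t| ≤ δ → 0 ≤ gevShape θ z j + (z j).2.2 i * t := by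
    intro t ht
    have hmem : θ + shapeDir q₁ q₂ (Pi.single i t) ∈ Θ := by
      refine hΘ ?_
      rw [Metric.mem_closedBall, dist_eq_norm, add_sub_cancel_left, norm_shapeDir_single]
      exact ht
    have h1 := gevShape_nonneg h_BR h_reg hmem hz j
    rw [gevShape_add_shapeDir] at h1
    simpa [Pi.single_apply] using h1
  have h1 := key δ (abs_of_pos hδ).le
  have h2 := key (-δ) (by rw [abs_neg, abs_of_pos hδ])
  rcases abs_cases ((z j).2.2 i) with h | h <;> rw [h.1] <;> linarith

lemma isCompact_support_covLaw (h_bdd : ∃ R : ℝ, ∀ᵐ z ∂B.covLaw, ‖z‖ ≤ R) :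
    IsCompact B.covLaw.support := by
  obtain ⟨R, hR⟩ := h_bdd
  refine (isCompact_closedBall (0 : Design d q₁ q₂ q₃) R).of_isClosed_subset
    Measure.isClosed_support (Measure.support_subset_of_isClosed Metric.isClosed_closedBall ?_)
  filter_upwards [hR] with z hz
  simpa using hz

lemma exists_le_gevArg [IsProbabilityMeasure B.covLaw]
    (h_bdd : ∃ R : ℝ, ∀ᵐ z ∂B.covLaw, ‖z‖ ≤ R)
    (h_BR : ∀ ω ζ : ℝ, IsBrownResnick B.site ω ζ (ρ ω ζ))
    (h_reg : Regular B ρ Θ θ₀) {θ : Param q₁ q₂ q₃} {δ : ℝ}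
    (hΘ : Metric.closedBall θ δ ⊆ Θ) :
    ∃ c : ℝ, 0 < c ∧ ∀ τ ∈ Metric.closedBall θ δ, ∀ z ∈ B.covLaw.support, ∀ j,
      c ≤ gevArg τ z j (B.thr j) := by
  have hj : ∀ j, ∃ c : ℝ, 0 < c ∧ ∀ τ ∈ Metric.closedBall θ δ, ∀ z ∈ B.covLaw.support,
      c ≤ gevArg τ z j (B.thr j) := by
    intro j
    have hK := (isCompact_closedBall θ δ).prod (isCompact_support_covLaw h_bdd)
    rcases (Metric.closedBall θ δ ×ˢ B.covLaw.support).eq_empty_or_nonempty with he | hne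
    · refine ⟨1, one_pos, fun τ hτ z hz => ?_⟩
      have : (τ, z) ∈ Metric.closedBall θ δ ×ˢ B.covLaw.support := ⟨hτ, hz⟩
      rw [he] at this
      exact this.elim
    · obtain ⟨p, hp, hmin⟩ := hK.exists_isMinOn hne (continuous_gevArg j (B.thr j)).continuousOn
      exact ⟨_, gevArg_thr_pos h_BR h_reg (hΘ hp.1) hp.2 j, fun τ hτ z hz =>
        hmin (a := (τ, z)) ⟨hτ, hz⟩⟩
  choose c hc h using hj
  obtain ⟨t, ht, ht0⟩ := ((eventually_all.2 fun j => (eventually_le_nhds (hc j)).filter_mono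
    (nhdsWithin_le_nhds (s := Ioi (0 : ℝ)))).and self_mem_nhdsWithin).exists
  exact ⟨t, ht0, fun τ hτ z hz j => (ht j).trans (h j τ hτ z hz)⟩

end Shape

/-! ### Derivatives of the bivariate distribution function -/

section PairCDF

/-- The partial derivative of `pairCDF` in its first argument. -/
def pairPartial (a s t : ℝ) : ℝ :=
  pairCDF a s t * (stdNormalCDF (a / 2 - 1 / a * Real.log (s / t)) / s ^ 2)

/-- The mixed second partial derivative of `pairCDF`. -/
def pairDensity (a s t : ℝ) : ℝ :=
  pairCDF a s t * ((stdNormalCDF (a / 2 - 1 / a * Real.log (s / t)) *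
    stdNormalCDF (a / 2 - 1 / a * Real.log (t / s)) +
    s * stdNormalPDF (a / 2 - 1 / a * Real.log (t / s)) / a) / (s ^ 2 * t ^ 2))

variable {a s t : ℝ}

lemma pairCDF_comm (a s t : ℝ) : pairCDF a s t = pairCDF a t s := by
  simp only [pairCDF, pairExponent, add_comm]

lemma pairCDF_pos : 0 < pairCDF a s t := Real.exp_pos _

lemma pairPartial_pos (hs : 0 < s) : 0 < pairPartial a s t :=
  mul_pos pairCDF_pos (div_pos (stdNormalCDF_pos _) (by positivity))

lemma pairDensity_pos (ha : 0 < a) (hs : 0 < s) (ht : 0 < t) : 0 < pairDensity a s t := by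
  have h1 := stdNormalCDF_pos (a / 2 - 1 / a * Real.log (s / t))
  have h2 := stdNormalCDF_pos (a / 2 - 1 / a * Real.log (t / s))
  have h3 := stdNormalPDF_pos (a / 2 - 1 / a * Real.log (t / s))
  have h4 : 0 < pairCDF a s t := pairCDF_pos
  unfold pairDensity
  positivity

lemma log_div_swap (s t : ℝ) : Real.log (t / s) = -Real.log (s / t) := by
  rw [← Real.log_inv, inv_div]

/-- The symmetry that makes the density terms cancel in the first derivatives. -/
lemma mul_stdNormalPDF_swap (ha : 0 < a) (hs : 0 < s) (ht : 0 < t) :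
    t * stdNormalPDF (a / 2 - 1 / a * Real.log (s / t)) =
      s * stdNormalPDF (a / 2 - 1 / a * Real.log (t / s)) := by
  have h1 : t = s * Real.exp (-Real.log (s / t)) := by
    rw [Real.exp_neg, Real.exp_log (by positivity)]
    field_simp
  conv_lhs => rw [h1]
  rw [mul_assoc, stdNormalPDF_eq, stdNormalPDF_eq, mul_left_comm (Real.exp _), ← Real.exp_add,
    ← h1, log_div_swap s t]
  congr 3
  field_simp
  ring

lemma hasDerivAt_dep_left (hs : 0 < s) (ht : 0 < t) :
    HasDerivAt (fun s => a / 2 - 1 / a * Real.log (s / t)) (-(1 / (a * s))) s := by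
  have h1 : HasDerivAt (fun s : ℝ => s / t) (1 / t) s := (hasDerivAt_id' s).div_const t
  have h2 := (h1.log (by positivity)).const_mul (1 / a)
  refine (h2.const_sub (a / 2)).congr_deriv ?_
  by_cases ha : a = 0
  · simp [ha]
  · field_simp

lemma hasDerivAt_dep_right (hs : 0 < s) (ht : 0 < t) :
    HasDerivAt (fun s => a / 2 - 1 / a * Real.log (t / s)) (1 / (a * s)) s := by
  have h := hasDerivAt_dep_left (a := a) hs ht
  have h2 : (fun s => a / 2 - 1 / a * Real.log (t / s)) =
      fun s => a - (a / 2 - 1 / a * Real.log (s / t)) := by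
    funext s
    rw [log_div_swap s t]
    ring
  rw [h2]
  simpa using h.const_sub a

lemma hasDerivAt_pairCDF (ha : 0 < a) (hs : 0 < s) (ht : 0 < t) :
    HasDerivAt (fun s => pairCDF a s t) (pairPartial a s t) s := by
  have hp := (hasDerivAt_stdNormalCDF _).comp s (hasDerivAt_dep_left (a := a) hs ht)
  have hq := (hasDerivAt_stdNormalCDF _).comp s (hasDerivAt_dep_right (a := a) hs ht)
  have hi : HasDerivAt (fun s : ℝ => 1 / s) (-(1 / s ^ 2)) s := by
    simpa using hasDerivAt_inv hs.ne'
  have h := ((hi.mul hp).add (hq.const_mul (1 / t))).neg.exp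
  refine h.congr_deriv ?_
  have hsym := mul_stdNormalPDF_swap ha hs ht
  simp only [pairPartial, pairCDF, pairExponent, Function.comp]
  congr 1
  generalize a / 2 - 1 / a * Real.log (s / t) = p at *
  generalize a / 2 - 1 / a * Real.log (t / s) = q at *
  field_simp
  linear_combination hsym

lemma hasDerivAt_pairPartial (ha : 0 < a) (hs : 0 < s) (ht : 0 < t) :
    HasDerivAt (fun s => pairPartial a t s) (pairDensity a s t) s := by
  have h1 := hasDerivAt_pairCDF ha hs ht
  have hq := (hasDerivAt_stdNormalCDF _).comp s (hasDerivAt_dep_right (a := a) hs ht)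
  have h := h1.mul (hq.div_const (t ^ 2))
  have he : (fun s => pairPartial a t s) = fun s => pairCDF a s t *
      ((stdNormalCDF ∘ fun s => a / 2 - 1 / a * Real.log (t / s)) s / t ^ 2) := by
    funext s
    simp only [pairPartial, pairCDF_comm a t s, Function.comp]
  rw [he]
  refine h.congr_deriv ?_
  simp only [pairPartial, pairDensity, Function.comp]
  field_simp

lemma hasDerivAt_pairCDF_right (ha : 0 < a) (hs : 0 < s) (ht : 0 < t) :
    HasDerivAt (fun t => pairCDF a s t) (pairPartial a t s) t := by
  have h := hasDerivAt_pairCDF ha ht hs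
  simpa only [pairCDF_comm a s] using h

lemma deriv_deriv_pairCDF (ha : 0 < a) (hs : 0 < s) (ht : 0 < t) :
    deriv (fun s => deriv (fun t => pairCDF a s t) t) s = pairDensity a s t := by
  have hev : (fun s => deriv (fun t => pairCDF a s t) t) =ᶠ[𝓝 s] fun s => pairPartial a t s := by
    filter_upwards [lt_mem_nhds hs] with s' hs'
    exact (hasDerivAt_pairCDF_right ha hs' ht).deriv
  rw [hev.deriv_eq, (hasDerivAt_pairPartial ha hs ht).deriv]

end PairCDF

/-! ### The log-likelihood on the logarithmic Fréchet scale -/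

lemma boxLog_mul_left {ε η : ℝ} (hη : η ≠ 0) (w : ℝ) :
    boxLog (ε * η) w = boxLog ε (η * w) / η := by
  unfold boxLog
  by_cases hε : ε = 0
  · simp [hε, hη]
  · rw [if_neg (mul_ne_zero hε hη), if_neg hε, div_div, mul_assoc]

lemma boxLog_add {ε v w : ℝ} (hv : 0 < 1 + ε * v) (hw : 0 < 1 + ε * (w / (1 + ε * v))) :
    boxLog ε (v + w) = boxLog ε v + boxLog ε (w / (1 + ε * v)) := by
  unfold boxLog
  by_cases hε : ε = 0
  · simp [hε]
  · simp only [if_neg hε]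
    rw [← add_div, ← Real.log_mul hv.ne' hw.ne']
    congr 2
    field_simp
    ring

section LogScale

variable {d q₁ q₂ q₃ : ℕ} (B : Block d q₁ q₂ q₃)

/-- The logarithm of `gevScale`. -/
def logScale (θ : Param q₁ q₂ q₃) (z : Design d q₁ q₂ q₃) (j : Fin d) : ℝ :=
  ∑ i, (z j).2.1 i * θ (Sum.inr (Sum.inr (Sum.inl i)))

/-- The shape relative to the norm of its covariates, and `1` if these covariates vanish: in the
latter case the shape is zero for every parameter. -/
def shapeRatio (θ : Param q₁ q₂ q₃) (z : Design d q₁ q₂ q₃) (j : Fin d) : ℝ :=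
  if ‖(z j).2.2‖ = 0 then 1 else gevShape θ z j / ‖(z j).2.2‖

/-- The excess of an outcome over its threshold. -/
def excess (o : Obs d q₁ q₂ q₃) (j : Fin d) : ℝ := max (o.2 j - B.thr j) 0

/-- The logarithm of the rate `η / (σ A)`, with `η` the relative shape and `A` the value of `gevArg`
at the threshold. -/
def logRate (θ : Param q₁ q₂ q₃) (z : Design d q₁ q₂ q₃) (j : Fin d) : ℝ :=
  Real.log (shapeRatio θ z j) - logScale θ z j - Real.log (gevArg θ z j (B.thr j))

/-- The logarithm of the outcome on the Fréchet scale, split into the part of the threshold and the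
part of the excess. -/
def logFrechet (θ : Param q₁ q₂ q₃) (o : Obs d q₁ q₂ q₃) (j : Fin d) : ℝ :=
  (boxLog ‖(o.1 j).2.2‖ (shapeRatio θ o.1 j *
      ((B.thr j - gevLoc θ o.1 j) * Real.exp (-logScale θ o.1 j))) +
    boxLog ‖(o.1 j).2.2‖ (excess B o j * Real.exp (logRate B θ o.1 j))) * (shapeRatio θ o.1 j)⁻¹

/-- The logarithm of `pairDep`. -/
def logDep (θ : Param q₁ q₂ q₃) (j l : Fin d) : ℝ :=
  1 / 2 * (Real.log 2 + 2 * (Real.exp (omega θ) / (1 + Real.exp (omega θ))) *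
    (Real.log ‖B.site j - B.site l‖ - zeta θ))

/-- The argument of `Φ` in the pair exponent. -/
def pairArg (θ : Param q₁ q₂ q₃) (o : Obs d q₁ q₂ q₃) (j l : Fin d) : ℝ :=
  1 / 2 * Real.exp (logDep B θ j l) +
    (logFrechet B θ o l - logFrechet B θ o j) * Real.exp (-logDep B θ j l)

/-- The contribution of an exceedance at site `j` to the logarithm of the likelihood. -/
def logMargin (θ : Param q₁ q₂ q₃) (o : Obs d q₁ q₂ q₃) (j : Fin d) : ℝ :=
  -((1 + gevShape θ o.1 j) * logFrechet B θ o j) - logScale θ o.1 j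

open Classical in
/-- The logarithm of the likelihood contribution of a pair, as an explicit smooth function. -/
def pairLogLik (θ : Param q₁ q₂ q₃) (o : Obs d q₁ q₂ q₃) (j l : Fin d) : ℝ :=
  -(Real.exp (-logFrechet B θ o j) * stdNormalCDF (pairArg B θ o j l) +
      Real.exp (-logFrechet B θ o l) * stdNormalCDF (pairArg B θ o l j)) +
    if B.thr j < o.2 j then
      if B.thr l < o.2 l then
        Real.log (Real.exp (Real.log (stdNormalCDF (pairArg B θ o j l)) +
            Real.log (stdNormalCDF (pairArg B θ o l j))) +
          Real.exp (logFrechet B θ o j + -(1 / 2 * (pairArg B θ o l j * pairArg B θ o l j)) +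
            Real.log ((√(2 * Real.pi))⁻¹) - logDep B θ j l)) +
          logMargin B θ o j + logMargin B θ o l
      else Real.log (stdNormalCDF (pairArg B θ o j l)) + logMargin B θ o j
    else
      if B.thr l < o.2 l then Real.log (stdNormalCDF (pairArg B θ o l j)) + logMargin B θ o l
      else 0

/-- The set of censored observations: covariates in the support of their law and outcomes at or
above the thresholds. -/
def obsSet : Set (Obs d q₁ q₂ q₃) :=
  {o | o.1 ∈ B.covLaw.support ∧ ∀ j, B.thr j ≤ o.2 j}

/-- At the covariates `z`, every margin has positive shape, or zero shape because its shape
covariates vanish, and its threshold lies in its support. -/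
def MarginsValid (θ : Param q₁ q₂ q₃) (z : Design d q₁ q₂ q₃) : Prop :=
  ∀ j, 0 < shapeRatio θ z j ∧ 0 < gevArg θ z j (B.thr j)

variable {B} {θ : Param q₁ q₂ q₃} {o : Obs d q₁ q₂ q₃} {z : Design d q₁ q₂ q₃} {j l : Fin d}

lemma gevShape_eq_mul_shapeRatio (θ : Param q₁ q₂ q₃) (z : Design d q₁ q₂ q₃) (j : Fin d) :
    gevShape θ z j = ‖(z j).2.2‖ * shapeRatio θ z j := by
  unfold shapeRatio
  split_ifs with h
  · have h0 : (z j).2.2 = 0 := norm_eq_zero.1 h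
    simp [gevShape, h0]
  · field_simp

lemma gevShape_nonneg_of_valid (h : MarginsValid B θ z) (j : Fin d) : 0 ≤ gevShape θ z j := by
  rw [gevShape_eq_mul_shapeRatio]
  exact mul_nonneg (norm_nonneg _) (h j).1.le

lemma exp_logScale : Real.exp (logScale θ z j) = gevScale θ z j := rfl

lemma gevArg_eq (θ : Param q₁ q₂ q₃) (z : Design d q₁ q₂ q₃) (j : Fin d) (y : ℝ) :
    gevArg θ z j y = 1 + ‖(z j).2.2‖ * (shapeRatio θ z j *
      ((y - gevLoc θ z j) * Real.exp (-logScale θ z j))) := by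
  rw [gevArg, gevShape_eq_mul_shapeRatio, Real.exp_neg, exp_logScale, div_eq_mul_inv]
  ring

lemma gevArg_pos_of_le (h : MarginsValid B θ z) {y : ℝ} (hy : B.thr j ≤ y) :
    0 < gevArg θ z j y := by
  refine (h j).2.trans_le ?_
  unfold gevArg
  have := gevScale_pos θ z j
  have := gevShape_nonneg_of_valid h j
  gcongr

lemma exp_logRate (h : MarginsValid B θ z) (j : Fin d) : Real.exp (logRate B θ z j) =
    shapeRatio θ z j * Real.exp (-logScale θ z j) / gevArg θ z j (B.thr j) := by
  rw [logRate, Real.exp_sub, sub_eq_add_neg, Real.exp_add, Real.exp_log (h j).1,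
    Real.exp_log (h j).2]

lemma frechetObs_eq_exp (h : MarginsValid B θ o.1) (ho : B.thr j ≤ o.2 j) :
    frechetObs θ o j = Real.exp (logFrechet B θ o j) := by
  have hpos := gevArg_pos_of_le h ho
  rw [frechetObs, toFrechet_eq_exp hpos]
  have hη := (h j).1
  have hA := (h j).2
  congr 1
  rw [gevShape_eq_mul_shapeRatio, boxLog_mul_left hη.ne', logFrechet, div_eq_mul_inv]
  congr 1
  have hr : excess B o j = o.2 j - B.thr j := max_eq_left (sub_nonneg.2 ho)
  have hr0 : 0 ≤ excess B o j := le_max_right _ _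
  have hdiv : excess B o j * Real.exp (logRate B θ o.1 j) =
      shapeRatio θ o.1 j * (excess B o j * Real.exp (-logScale θ o.1 j)) /
        (1 + ‖(o.1 j).2.2‖ * (shapeRatio θ o.1 j *
      ((B.thr j - gevLoc θ o.1 j) * Real.exp (-logScale θ o.1 j)))) := by
    rw [exp_logRate h, gevArg_eq]
    ring
  rw [hdiv, ← boxLog_add]
  · congr 1
    rw [hr, Real.exp_neg, exp_logScale]
    ring
  · rw [← gevArg_eq]
    exact hA
  · rw [← hdiv]
    positivity

lemma frechetThr_eq_frechetObs (h : o.2 j = B.thr j) :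
    frechetThr B θ o.1 j = frechetObs θ o j := by
  rw [frechetThr, frechetObs, h]

lemma jacobianObs_eq_exp (h : MarginsValid B θ o.1) (ho : B.thr j ≤ o.2 j) :
    jacobianObs θ o j =
      Real.exp ((1 - gevShape θ o.1 j) * logFrechet B θ o j - logScale θ o.1 j) := by
  have hpos : 0 < 1 + gevShape θ o.1 j * (o.2 j - gevLoc θ o.1 j) / gevScale θ o.1 j :=
    gevArg_pos_of_le h ho
  have hx := frechetObs_eq_exp h ho
  have hlog : Real.log (1 + gevShape θ o.1 j * (o.2 j - gevLoc θ o.1 j) / gevScale θ o.1 j) =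
      gevShape θ o.1 j * logFrechet B θ o j := by
    have h1 := hx
    rw [frechetObs, toFrechet_eq_exp hpos, Real.exp_eq_exp] at h1
    rw [← h1, boxLog]
    split_ifs with h0
    · simp [h0]
    · rw [mul_div_cancel₀ _ h0, mul_div_assoc]
  have hinv : (1 + gevShape θ o.1 j * (o.2 j - gevLoc θ o.1 j) / gevScale θ o.1 j)⁻¹ =
      Real.exp (-(gevShape θ o.1 j * logFrechet B θ o j)) := by
    rw [← hlog, Real.exp_neg, Real.exp_log hpos]
  rw [jacobianObs, jacobian_eq hpos, hinv]
  change frechetObs θ o j * _ = _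
  rw [hx, ← exp_logScale, ← Real.exp_neg, ← Real.exp_add, ← Real.exp_add]
  ring_nf

lemma pairDep_eq_exp (h : B.site j ≠ B.site l) :
    pairDep B θ j l = Real.exp (logDep B θ j l) := by
  have hn : 0 < ‖B.site j - B.site l‖ := norm_pos_iff.2 (sub_ne_zero.2 h)
  rw [pairDep, logDep, semivariogram, Real.rpow_def_of_pos (by positivity),
    Real.log_div hn.ne' (Real.exp_pos _).ne', Real.log_exp]
  conv_lhs => rw [← Real.exp_log two_pos]
  rw [← Real.exp_add, one_div, inv_mul_eq_div, Real.exp_half, smoothness]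
  congr 3
  ring

lemma logDep_comm (θ : Param q₁ q₂ q₃) (j l : Fin d) : logDep B θ j l = logDep B θ l j := by
  rw [logDep, logDep, norm_sub_rev]

lemma pairArg_eq (θ : Param q₁ q₂ q₃) (o : Obs d q₁ q₂ q₃) (j l : Fin d) :
    Real.exp (logDep B θ j l) / 2 - 1 / Real.exp (logDep B θ j l) *
      Real.log (Real.exp (logFrechet B θ o j) / Real.exp (logFrechet B θ o l)) =
      pairArg B θ o j l := by
  rw [pairArg, ← Real.exp_sub, Real.log_exp, Real.exp_neg]
  ring

lemma pairExponent_eq (h : B.site j ≠ B.site l) :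
    pairExponent (pairDep B θ j l) (Real.exp (logFrechet B θ o j)) (Real.exp (logFrechet B θ o l)) =
      Real.exp (-logFrechet B θ o j) * stdNormalCDF (pairArg B θ o j l) +
      Real.exp (-logFrechet B θ o l) * stdNormalCDF (pairArg B θ o l j) := by
  rw [pairExponent, pairDep_eq_exp h, pairArg_eq]
  conv_lhs => rw [logDep_comm θ j l]
  rw [pairArg_eq, Real.exp_neg, Real.exp_neg, one_div, one_div]

lemma pairLik_eq (hs : B.site j ≠ B.site l) (h : MarginsValid B θ o.1)
    (ho : ∀ j, B.thr j ≤ o.2 j) [Decidable (B.thr j < o.2 j)] [Decidable (B.thr l < o.2 l)] :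
    pairLik B θ o j l =
      if B.thr j < o.2 j then
        if B.thr l < o.2 l then
          pairDensity (pairDep B θ j l) (frechetObs θ o j) (frechetObs θ o l) *
            jacobianObs θ o j * jacobianObs θ o l
        else pairPartial (pairDep B θ j l) (frechetObs θ o j) (frechetThr B θ o.1 l) *
          jacobianObs θ o j
      else
        if B.thr l < o.2 l then
          pairPartial (pairDep B θ j l) (frechetObs θ o l) (frechetThr B θ o.1 j) *
            jacobianObs θ o l
        else pairCDF (pairDep B θ j l) (frechetThr B θ o.1 j) (frechetThr B θ o.1 l) := by
  have ha : 0 < pairDep B θ j l := by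
    rw [pairDep_eq_exp hs]
    exact Real.exp_pos _
  have hj : 0 < frechetObs θ o j := by
    rw [frechetObs_eq_exp h (ho j)]
    exact Real.exp_pos _
  have hl : 0 < frechetObs θ o l := by
    rw [frechetObs_eq_exp h (ho l)]
    exact Real.exp_pos _
  have htj : 0 < frechetThr B θ o.1 j := toFrechet_pos (h j).2
  have htl : 0 < frechetThr B θ o.1 l := toFrechet_pos (h l).2
  unfold pairLik
  split_ifs
  · dsimp only
    rw [deriv_deriv_pairCDF ha hj hl]
  · dsimp only
    rw [(hasDerivAt_pairCDF ha hj htl).deriv]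
  · dsimp only
    rw [(hasDerivAt_pairCDF_right ha htj hl).deriv]
  · rfl

lemma log_stdNormalPDF_exp (p a : ℝ) (x : ℝ) :
    Real.exp x * stdNormalPDF p / Real.exp a =
      Real.exp (x + -(1 / 2 * (p * p)) + Real.log ((√(2 * Real.pi))⁻¹) - a) := by
  have h0 : 0 < (√(2 * Real.pi))⁻¹ := inv_pos.2 (Real.sqrt_pos.2 (by positivity))
  rw [Real.exp_sub, Real.exp_add, Real.exp_add, Real.exp_log h0, stdNormalPDF_eq]
  rw [show -(1 / 2 * (p * p)) = -p ^ 2 / 2 by ring]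
  ring

/-- The likelihood contributions are positive, with logarithm `pairLogLik`. -/
lemma pairLik_eq_exp (hs : B.site j ≠ B.site l) (h : MarginsValid B θ o.1)
    (ho : ∀ j, B.thr j ≤ o.2 j) : pairLik B θ o j l = Real.exp (pairLogLik B θ o j l) := by
  classical
  rw [pairLik_eq hs h ho, pairLogLik]
  have hj := frechetObs_eq_exp h (ho j)
  have hl := frechetObs_eq_exp h (ho l)
  have hpd := pairDep_eq_exp (θ := θ) hs
  have hcdf : pairCDF (pairDep B θ j l) (Real.exp (logFrechet B θ o j))
      (Real.exp (logFrechet B θ o l)) =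
      Real.exp (-(Real.exp (-logFrechet B θ o j) * stdNormalCDF (pairArg B θ o j l) +
      Real.exp (-logFrechet B θ o l) * stdNormalCDF (pairArg B θ o l j))) := by
    rw [pairCDF, pairExponent_eq hs]
  have hΦ : ∀ t, Real.exp (Real.log (stdNormalCDF t)) = stdNormalCDF t := fun t =>
    Real.exp_log (stdNormalCDF_pos t)
  have hpart : ∀ j l, B.site j ≠ B.site l → pairPartial (pairDep B θ j l)
      (Real.exp (logFrechet B θ o j)) (Real.exp (logFrechet B θ o l)) =
      pairCDF (pairDep B θ j l) (Real.exp (logFrechet B θ o j)) (Real.exp (logFrechet B θ o l)) *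
      (stdNormalCDF (pairArg B θ o j l) / Real.exp (logFrechet B θ o j) ^ 2) := by
    intro j l hs
    rw [pairPartial]
    congr 3
    rw [pairDep_eq_exp hs, pairArg_eq]
  have hmarg : ∀ j, B.thr j ≤ o.2 j → Real.exp (logMargin B θ o j) =
      jacobianObs θ o j / Real.exp (logFrechet B θ o j) ^ 2 := by
    intro j hoj
    rw [jacobianObs_eq_exp h hoj, logMargin, eq_div_iff (by positivity), ← Real.exp_nat_mul,
      ← Real.exp_add]
    congr 1
    push_cast
    ring
  have hcomm : pairDep B θ j l = pairDep B θ l j := by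
    rw [hpd, pairDep_eq_exp hs.symm, logDep_comm]
  split_ifs with h1 h2 h2
  · rw [hj, hl, Real.exp_add, ← hcdf, pairDensity, Real.exp_add, Real.exp_add, hmarg j (ho j),
      hmarg l (ho l), ← log_stdNormalPDF_exp, Real.exp_add, hΦ, hΦ, Real.exp_log
      (by have := stdNormalCDF_pos (pairArg B θ o j l)
          have := stdNormalCDF_pos (pairArg B θ o l j)
          have := stdNormalPDF_pos (pairArg B θ o l j)
          positivity)]
    have e1 := pairArg_eq (B := B) θ o j l
    have e2 := pairArg_eq (B := B) θ o l j
    rw [← logDep_comm] at e2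
    rw [← hpd] at e1 e2
    rw [e1, e2, hpd]
    ring
  · rw [frechetThr_eq_frechetObs ((ho l).eq_of_not_lt h2).symm, hj, hl, Real.exp_add, ← hcdf,
      Real.exp_add, hmarg j (ho j), hΦ, hpart j l hs]
    ring
  · rw [frechetThr_eq_frechetObs ((ho j).eq_of_not_lt h1).symm, hj, hl, Real.exp_add, ← hcdf,
      Real.exp_add, hmarg l (ho l), hΦ, hcomm, hpart l j hs.symm, pairCDF_comm]
    ring
  · rw [frechetThr_eq_frechetObs ((ho l).eq_of_not_lt h2).symm,
      frechetThr_eq_frechetObs ((ho j).eq_of_not_lt h1).symm, hj, hl, add_zero, hcdf]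

lemma logLik_eq (hs : Function.Injective B.site) (h : MarginsValid B θ o.1)
    (ho : ∀ j, B.thr j ≤ o.2 j) :
    logLik B θ o = ∑ j : Fin d, ∑ l ∈ Finset.Ioi j, pairLogLik B θ o j l := by
  refine Finset.sum_congr rfl fun j _ => Finset.sum_congr rfl fun l hl => ?_
  rw [pairLik_eq_exp (fun he => (Finset.mem_Ioi.1 hl).ne (hs he)) h ho, Real.log_exp]

end LogScale

/-! ### Envelopes for the derivatives of the log-likelihood -/

section TameBounds

variable {ι : Type*} [Fintype ι] {O : Type*} [MeasurableSpace O]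
  {U : Set (EuclideanSpace ℝ ι)} {S : Set O} {M M' : O → ℝ}

lemma Tame.mono_bound (h0 : ∀ o ∈ S, 0 ≤ M o) (hM : ∀ o ∈ S, M o ≤ M' o) :
    ∀ {n : ℕ} {f : EuclideanSpace ℝ ι → O → ℝ}, Tame U S M n f → Tame U S M' n f := by
  have base : ∀ {f : EuclideanSpace ℝ ι → O → ℝ}, PolyBdd U S M f → PolyBdd U S M' f := by
    rintro f ⟨hm, C, k, hC, hb⟩
    refine ⟨hm, C, k, hC, fun o ho θ hθ => (hb o ho θ hθ).trans ?_⟩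
    have := h0 o ho
    have := hM o ho
    gcongr
  intro n
  induction n with
  | zero => exact base
  | succ n ih =>
    rintro f ⟨hb, f', hf', hd⟩
    exact ⟨base hb, f', fun a => ih (hf' a), hd⟩

lemma Tame.exists_abs_le {n : ℕ} {f : EuclideanSpace ℝ ι → O → ℝ}
    (h : Tame U S (fun _ => 0) n f) : ∃ C, ∀ o ∈ S, ∀ θ ∈ U, |f θ o| ≤ C := by
  obtain ⟨-, C, k, -, hb⟩ := h.polyBdd
  exact ⟨C, fun o ho θ hθ => by simpa using hb o ho θ hθ⟩

end TameBounds

section LogLikTame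

variable {d q₁ q₂ q₃ : ℕ} (B : Block d q₁ q₂ q₃)

/-- The function of the observation whose powers dominate the log-likelihood and its derivatives:
the excesses on a logarithmic scale that does not depend on the parameter. -/
def tailBound (o : Obs d q₁ q₂ q₃) : ℝ := ∑ j, boxLog ‖(o.1 j).2.2‖ (excess B o j)

/-- A bounded set of parameters at which the margins are valid, uniformly over the support of the
covariates, which is bounded. -/
structure WellInside (U : Set (Param q₁ q₂ q₃)) : Prop where
  isBounded : Bornology.IsBounded U
  bounded_cov : ∃ R, ∀ z ∈ B.covLaw.support, ‖z‖ ≤ R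
  margins : ∃ c, 0 < c ∧ ∀ θ ∈ U, ∀ z ∈ B.covLaw.support, ∀ j,
    c ≤ shapeRatio θ z j ∧ c ≤ gevArg θ z j (B.thr j)

variable {B} {U : Set (Param q₁ q₂ q₃)}

lemma WellInside.valid (h : WellInside B U) {θ : Param q₁ q₂ q₃} (hθ : θ ∈ U)
    {z : Design d q₁ q₂ q₃} (hz : z ∈ B.covLaw.support) : MarginsValid B θ z := by
  obtain ⟨c, hc, hm⟩ := h.margins
  exact fun j => ⟨hc.trans_le (hm θ hθ z hz j).1, hc.trans_le (hm θ hθ z hz j).2⟩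

/-- Uniformity over a ball comes from compactness of the support of the covariates, and from the
lower bound on the shape that a larger ball in `Θ` provides. -/
lemma wellInside_ball {ρ : ℝ → ℝ → Measure (Fin d → ℝ)} {Θ : Set (Param q₁ q₂ q₃)}
    {θ₀ : Param q₁ q₂ q₃} [IsProbabilityMeasure B.covLaw]
    (h_bdd : ∃ R : ℝ, ∀ᵐ z ∂B.covLaw, ‖z‖ ≤ R)
    (h_BR : ∀ ω ζ : ℝ, IsBrownResnick B.site ω ζ (ρ ω ζ))
    (h_reg : Regular B ρ Θ θ₀) {θ : Param q₁ q₂ q₃} {δ : ℝ} (hδ : 0 < δ)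
    (hΘ : Metric.closedBall θ (2 * δ) ⊆ Θ) : WellInside B (Metric.ball θ δ) := by
  refine ⟨Metric.isBounded_ball, ?_, ?_⟩
  · obtain ⟨R, hR⟩ := (isCompact_support_covLaw h_bdd).isBounded.exists_norm_le
    exact ⟨R, hR⟩
  · obtain ⟨c, hc, h⟩ := exists_le_gevArg h_bdd h_BR h_reg hΘ
    refine ⟨min c (min δ 1), by positivity, fun τ hτ z hz j => ⟨?_, ?_⟩⟩
    · rw [shapeRatio]
      split_ifs with h0
      · exact (min_le_right _ _).trans (min_le_right _ _)
      · refine ((min_le_right _ _).trans (min_le_left _ _)).trans ?_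
        rw [le_div_iff₀ ((norm_nonneg _).lt_of_ne' h0)]
        refine mul_norm_le_gevShape h_BR h_reg hδ (Subset.trans ?_ hΘ) hz j
        refine Metric.closedBall_subset_closedBall' ?_
        rw [Metric.mem_ball] at hτ
        linarith
    · exact (min_le_left _ _).trans (h τ (Metric.ball_subset_closedBall.trans
        (Metric.closedBall_subset_closedBall (by linarith)) hτ) z hz j)

lemma excess_nonneg (o : Obs d q₁ q₂ q₃) (j : Fin d) : 0 ≤ excess B o j := le_max_right _ _

lemma boxLog_excess_nonneg (o : Obs d q₁ q₂ q₃) (j : Fin d) :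
    0 ≤ boxLog ‖(o.1 j).2.2‖ (excess B o j) := boxLog_nonneg (norm_nonneg _) (excess_nonneg o j)

lemma boxLog_excess_le (o : Obs d q₁ q₂ q₃) (j : Fin d) :
    boxLog ‖(o.1 j).2.2‖ (excess B o j) ≤ tailBound B o :=
  Finset.single_le_sum (f := fun j => boxLog ‖(o.1 j).2.2‖ (excess B o j))
    (fun j _ => boxLog_excess_nonneg o j) (Finset.mem_univ j)

lemma tailBound_nonneg (o : Obs d q₁ q₂ q₃) : 0 ≤ tailBound B o :=
  Finset.sum_nonneg fun j _ => boxLog_excess_nonneg o j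

lemma measurable_shapeNorm (j : Fin d) :
    Measurable fun o : Obs d q₁ q₂ q₃ => ‖(o.1 j).2.2‖ :=
  (by fun_prop : Continuous fun o : Obs d q₁ q₂ q₃ => ‖(o.1 j).2.2‖).measurable

lemma measurable_excess (j : Fin d) : Measurable fun o : Obs d q₁ q₂ q₃ => excess B o j :=
  (by unfold excess; fun_prop : Continuous fun o : Obs d q₁ q₂ q₃ => excess B o j).measurable

lemma measurableSet_exceed (j : Fin d) : MeasurableSet {o : Obs d q₁ q₂ q₃ | B.thr j < o.2 j} :=
  (isOpen_lt continuous_const (by fun_prop)).measurableSet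

variable (hU : WellInside B U) (n : ℕ) (j l : Fin d)
include hU

lemma WellInside.tame_linear {κ : Type*} [Fintype κ] (x : κ → Obs d q₁ q₂ q₃ → ℝ)
    (hx : ∀ i, Measurable (x i)) {R : ℝ} (hR : ∀ i, ∀ o ∈ obsSet B, |x i o| ≤ R)
    (a : κ → ParamIdx q₁ q₂ q₃) :
    Tame U (obsSet B) (fun _ => 0) n fun θ o => ∑ i, x i o * θ (a i) :=
  Tame.sum (fun _ _ => le_rfl) _ fun i _ => (Tame.obs_of_bounded (hx i) R (hR i) n).mul
    (fun _ _ => le_rfl) (Tame.coord hU.isBounded (a i) n)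

lemma WellInside.tame_gevLoc :
    Tame U (obsSet B) (fun _ => 0) n fun θ o => gevLoc θ o.1 j := by
  obtain ⟨R, hR⟩ := hU.bounded_cov
  exact hU.tame_linear n (fun i o => (o.1 j).1 i)
    (fun i => (by fun_prop : Continuous fun o : Obs d q₁ q₂ q₃ => (o.1 j).1 i).measurable)
    (R := R) (fun i o ho => (norm_le_pi_norm (o.1 j).1 i).trans ((norm_fst_le (o.1 j)).trans
      ((norm_le_pi_norm o.1 j).trans (hR _ ho.1)))) _

lemma WellInside.tame_logScale :
    Tame U (obsSet B) (fun _ => 0) n fun θ o => logScale θ o.1 j := by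
  obtain ⟨R, hR⟩ := hU.bounded_cov
  exact hU.tame_linear n (fun i o => (o.1 j).2.1 i)
    (fun i => (by fun_prop : Continuous fun o : Obs d q₁ q₂ q₃ => (o.1 j).2.1 i).measurable)
    (R := R) (fun i o ho => (norm_le_pi_norm (o.1 j).2.1 i).trans ((norm_fst_le (o.1 j).2).trans
      ((norm_snd_le (o.1 j)).trans ((norm_le_pi_norm o.1 j).trans (hR _ ho.1))))) _

lemma WellInside.shapeNorm_le : ∃ R, ∀ o ∈ obsSet B, ‖(o.1 j).2.2‖ ≤ R := by
  obtain ⟨R, hR⟩ := hU.bounded_cov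
  exact ⟨R, fun o ho => (norm_snd_le (o.1 j).2).trans
      ((norm_snd_le (o.1 j)).trans ((norm_le_pi_norm o.1 j).trans (hR _ ho.1)))⟩

lemma WellInside.tame_shapeRatio :
    Tame U (obsSet B) (fun _ => 0) n fun θ o => shapeRatio θ o.1 j := by
  have h := Tame.ite (p := fun o : Obs d q₁ q₂ q₃ => ‖(o.1 j).2.2‖ = 0)
    (measurable_shapeNorm j (measurableSet_singleton 0)) (fun _ _ => le_rfl) (Tame.const 1 n)
    (hU.tame_linear n (fun i o => (o.1 j).2.2 i / ‖(o.1 j).2.2‖)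
      (fun i => (by fun_prop : Continuous fun o : Obs d q₁ q₂ q₃ => (o.1 j).2.2 i).measurable.div
        (measurable_shapeNorm j)) (R := 1) (fun i o _ => by
        rw [abs_div, abs_of_nonneg (norm_nonneg (o.1 j).2.2)]
        exact div_le_one_of_le₀ (norm_le_pi_norm (o.1 j).2.2 i) (norm_nonneg _))
      fun i => Sum.inr (Sum.inr (Sum.inr i)))
  convert h using 3 with θ o
  rw [shapeRatio, gevShape, Finset.sum_div]
  simp only [div_mul_eq_mul_div]

lemma WellInside.tame_gevShape :
    Tame U (obsSet B) (fun _ => 0) n fun θ o => gevShape θ o.1 j := by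
  obtain ⟨R, hR⟩ := hU.shapeNorm_le j
  simp only [gevShape_eq_mul_shapeRatio]
  exact (Tame.obs_of_bounded (measurable_shapeNorm j) R (fun o ho => by
    rw [abs_of_nonneg (norm_nonneg _)]; exact hR o ho) n).mul (fun _ _ => le_rfl)
    (hU.tame_shapeRatio n j)

lemma WellInside.tame_inv_shapeRatio :
    Tame U (obsSet B) (fun _ => 0) n fun θ o => (shapeRatio θ o.1 j)⁻¹ := by
  obtain ⟨c, hc, h⟩ := hU.margins
  exact (hU.tame_shapeRatio n j).inv (fun _ _ => le_rfl) hc fun o ho θ hθ => (h θ hθ _ ho.1 j).1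

lemma WellInside.tame_exp_neg_logScale :
    Tame U (obsSet B) (fun _ => 0) n fun θ o => Real.exp (-logScale θ o.1 j) := by
  have h := (hU.tame_logScale n j).neg fun _ _ => le_rfl
  obtain ⟨C, hC⟩ := h.exists_abs_le
  exact h.exp (fun _ _ => le_rfl) fun o ho θ hθ => (le_abs_self _).trans (hC o ho θ hθ)

lemma WellInside.tame_thr :
    Tame U (obsSet B) (fun _ => 0) n fun θ o => shapeRatio θ o.1 j *
      ((B.thr j - gevLoc θ o.1 j) * Real.exp (-logScale θ o.1 j)) :=
  (hU.tame_shapeRatio n j).mul (fun _ _ => le_rfl) ((((Tame.const (B.thr j) n).sub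
    (fun _ _ => le_rfl) (hU.tame_gevLoc n j))).mul (fun _ _ => le_rfl)
      (hU.tame_exp_neg_logScale n j))

lemma WellInside.tame_gevArg :
    Tame U (obsSet B) (fun _ => 0) n fun θ o => gevArg θ o.1 j (B.thr j) := by
  obtain ⟨R, hR⟩ := hU.shapeNorm_le j
  simp only [gevArg_eq]
  exact (Tame.const 1 n).add (fun _ _ => le_rfl) ((Tame.obs_of_bounded (measurable_shapeNorm j) R
    (fun o ho => by rw [abs_of_nonneg (norm_nonneg _)]; exact hR o ho) n).mul (fun _ _ => le_rfl)
    (hU.tame_thr n j))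

lemma WellInside.tame_logRate :
    Tame U (obsSet B) (fun _ => 0) n fun θ o => logRate B θ o.1 j := by
  obtain ⟨c, hc, h⟩ := hU.margins
  have h0 : ∀ o ∈ obsSet B, (0 : ℝ) ≤ (fun _ : Obs d q₁ q₂ q₃ => (0 : ℝ)) o := fun _ _ => le_rfl
  exact (((hU.tame_shapeRatio n j).log h0 hc fun o ho θ hθ => (h θ hθ _ ho.1 j).1).sub h0
    (hU.tame_logScale n j)).sub h0
    ((hU.tame_gevArg n j).log h0 hc fun o ho θ hθ => (h θ hθ _ ho.1 j).2)

lemma WellInside.tame_boxLog_thr :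
    Tame U (obsSet B) (fun _ => 0) n fun θ o => boxLog ‖(o.1 j).2.2‖ (shapeRatio θ o.1 j *
      ((B.thr j - gevLoc θ o.1 j) * Real.exp (-logScale θ o.1 j))) := by
  obtain ⟨c, hc, h⟩ := hU.margins
  obtain ⟨R, hR⟩ := hU.shapeNorm_le j
  refine (hU.tame_thr n j).boxLog (fun _ _ => le_rfl) (measurable_shapeNorm j)
    (fun _ _ => norm_nonneg _) hR hc fun o ho θ hθ => ?_
  rw [← gevArg_eq]
  exact (h θ hθ _ ho.1 j).2

lemma WellInside.upgrade {f : Param q₁ q₂ q₃ → Obs d q₁ q₂ q₃ → ℝ} {n : ℕ}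
    (h : Tame U (obsSet B) (fun _ => 0) n f) : Tame U (obsSet B) (tailBound B) n f :=
  h.mono_bound (fun _ _ => le_rfl) fun o _ => tailBound_nonneg o

lemma WellInside.tame_logFrechet :
    Tame U (obsSet B) (tailBound B) n fun θ o => logFrechet B θ o j := by
  have hM : ∀ o ∈ obsSet B, 0 ≤ tailBound B o := fun o _ => tailBound_nonneg o
  obtain ⟨C, hC⟩ := (hU.tame_logRate n j).exists_abs_le
  refine ((hU.upgrade (hU.tame_boxLog_thr n j)).add hM ?_).mul hM
    (hU.upgrade (hU.tame_inv_shapeRatio n j))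
  exact (hU.upgrade (hU.tame_logRate n j)).boxLog_mul_exp hM (measurable_shapeNorm j)
    (measurable_excess j) (fun _ _ => norm_nonneg _) (fun o _ => excess_nonneg o j)
    (fun o _ => boxLog_excess_le o j) fun o ho θ hθ => (le_abs_self _).trans (hC o ho θ hθ)

/-- On the logarithmic Fréchet scale, outcomes are bounded below by their thresholds. -/
lemma WellInside.exists_le_logFrechet :
    ∃ C, ∀ o ∈ obsSet B, ∀ θ ∈ U, -logFrechet B θ o j ≤ C := by
  obtain ⟨C, hC⟩ := ((hU.tame_boxLog_thr 0 j).mul (fun _ _ => le_rfl)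
    (hU.tame_inv_shapeRatio 0 j)).exists_abs_le
  refine ⟨C, fun o ho θ hθ => ?_⟩
  have h1 := hC o ho θ hθ
  have h2 : 0 ≤ boxLog ‖(o.1 j).2.2‖ (excess B o j * Real.exp (logRate B θ o.1 j)) *
      (shapeRatio θ o.1 j)⁻¹ :=
    mul_nonneg (boxLog_nonneg (norm_nonneg _) (mul_nonneg (excess_nonneg o j) (Real.exp_pos _).le))
      (inv_nonneg.2 (hU.valid hθ ho.1 j).1.le)
  rw [logFrechet, add_mul]
  linarith [(abs_le.1 h1).1]

lemma WellInside.tame_exp_neg_logFrechet :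
    Tame U (obsSet B) (tailBound B) n fun θ o => Real.exp (-logFrechet B θ o j) := by
  obtain ⟨C, hC⟩ := hU.exists_le_logFrechet j
  have hM : ∀ o ∈ obsSet B, 0 ≤ tailBound B o := fun o _ => tailBound_nonneg o
  exact ((hU.tame_logFrechet n j).neg hM).exp hM hC

lemma WellInside.tame_logDep :
    Tame U (obsSet B) (fun _ => 0) n fun θ _ => logDep B θ j l := by
  have h0 : ∀ o ∈ obsSet B, (0 : ℝ) ≤ (fun _ : Obs d q₁ q₂ q₃ => (0 : ℝ)) o := fun _ _ => le_rfl
  exact ((Tame.const _ n).add h0 (((((Tame.coord hU.isBounded (Sum.inl 0) n).logistic h0).const_mul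
    h0 2)).mul h0 ((Tame.const _ n).sub h0 (Tame.coord hU.isBounded (Sum.inl 1) n)))).const_mul h0 _

lemma WellInside.tame_pairArg :
    Tame U (obsSet B) (tailBound B) n fun θ o => pairArg B θ o j l := by
  have hM : ∀ o ∈ obsSet B, 0 ≤ tailBound B o := fun o _ => tailBound_nonneg o
  have h0 : ∀ o ∈ obsSet B, (0 : ℝ) ≤ (fun _ : Obs d q₁ q₂ q₃ => (0 : ℝ)) o := fun _ _ => le_rfl
  have hd := hU.tame_logDep n j l
  obtain ⟨C, hC⟩ := hd.exists_abs_le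
  have h1 := hd.exp h0 fun o ho θ hθ => (le_abs_self _).trans (hC o ho θ hθ)
  have h2 := (hd.neg h0).exp h0 fun o ho θ hθ => (neg_le_abs _).trans (hC o ho θ hθ)
  exact ((hU.upgrade h1).const_mul hM _).add hM
    (((hU.tame_logFrechet n l).sub hM (hU.tame_logFrechet n j)).mul hM (hU.upgrade h2))

lemma WellInside.tame_logMargin :
    Tame U (obsSet B) (tailBound B) n fun θ o => logMargin B θ o j := by
  have hM : ∀ o ∈ obsSet B, 0 ≤ tailBound B o := fun o _ => tailBound_nonneg o
  exact ((((Tame.const 1 n).add hM (hU.upgrade (hU.tame_gevShape n j))).mul hM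
    (hU.tame_logFrechet n j)).neg hM).sub hM (hU.upgrade (hU.tame_logScale n j))

lemma WellInside.tame_pairLogLik :
    Tame U (obsSet B) (tailBound B) n fun θ o => pairLogLik B θ o j l := by
  classical
  have hM : ∀ o ∈ obsSet B, 0 ≤ tailBound B o := fun o _ => tailBound_nonneg o
  have hp := hU.tame_pairArg n j l
  have hq := hU.tame_pairArg n l j
  have hmj := hU.tame_logMargin n j
  have hml := hU.tame_logMargin n l
  have hV := (((hU.tame_exp_neg_logFrechet n j).mul hM (hp.stdNormalCDF hM)).add hM
    ((hU.tame_exp_neg_logFrechet n l).mul hM (hq.stdNormalCDF hM))).neg hM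
  have hboth := (((((hp.log_stdNormalCDF hM).add hM (hq.log_stdNormalCDF hM)).log_exp_add_exp hM
    ((((hU.tame_logFrechet n j).add hM (((hq.mul hM hq).const_mul hM (1 / 2)).neg hM)).add hM
      (Tame.const (Real.log ((√(2 * Real.pi))⁻¹)) n)).sub hM
        (hU.upgrade (hU.tame_logDep n j l)))).add
    hM hmj).add hM hml)
  have := hV.add hM (Tame.ite (measurableSet_exceed (B := B) j) hM
    (Tame.ite (measurableSet_exceed (B := B) l) hM hboth ((hp.log_stdNormalCDF hM).add hM hmj))
    (Tame.ite (measurableSet_exceed (B := B) l) hM ((hq.log_stdNormalCDF hM).add hM hml)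
      (Tame.const 0 n)))
  convert this using 3 with θ o
  rw [pairLogLik]

end LogLikTame

/-! ### Moments of the envelopes -/

lemma IsBrownResnick.integrable_sqrt {d : ℕ} {s : Fin d → EuclideanSpace ℝ (Fin 2)} {ω ζ : ℝ}
    {ρ : Measure (Fin d → ℝ)} (h : IsBrownResnick s ω ζ ρ) (j : Fin d) :
    Integrable (fun x : Fin d → ℝ => √(x j)) ρ := by
  have hp := h.1
  have hm : Measurable fun x : Fin d → ℝ => √(x j) := by fun_prop
  refine ⟨hm.aestronglyMeasurable, ?_⟩
  rw [hasFiniteIntegral_iff_ofReal (Eventually.of_forall fun x => Real.sqrt_nonneg _),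
    lintegral_eq_lintegral_meas_lt ρ (Eventually.of_forall fun x => Real.sqrt_nonneg _)
      hm.aemeasurable, ← Ioc_union_Ioi_eq_Ioi zero_le_one]
  refine (lintegral_union_le _ _ _).trans_lt (ENNReal.add_lt_top.2 ⟨?_, ?_⟩)
  · refine (lintegral_mono fun t => prob_le_one).trans_lt ?_
    simp
  · have hint : IntegrableOn (fun t : ℝ => t ^ (-2 : ℝ)) (Ioi 1) :=
      integrableOn_Ioi_rpow_of_lt (by norm_num) one_pos
    refine lt_of_le_of_lt (setLIntegral_mono' measurableSet_Ioi fun t ht => ?_)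
      ((hasFiniteIntegral_iff_ofReal (ae_restrict_of_forall_mem measurableSet_Ioi fun t ht =>
        Real.rpow_nonneg (zero_le_one.trans (mem_Ioi.1 ht).le) _)).1 hint.2)
    have ht0 : 0 < t := zero_lt_one.trans ht
    have h1 : {x : Fin d → ℝ | t < √(x j)} = {x | x j ≤ t ^ 2}ᶜ := by
      ext x
      simp [Real.lt_sqrt ht0.le]
    have h2 : MeasurableSet {x : Fin d → ℝ | x j ≤ t ^ 2} :=
      measurableSet_le (measurable_pi_apply j) measurable_const
    rw [← ENNReal.ofReal_toReal (measure_ne_top ρ _)]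
    refine ENNReal.ofReal_le_ofReal ?_
    change ρ.real _ ≤ _
    rw [h1, probReal_compl_eq_one_sub h2, h.measureReal_le j (by positivity)]
    have h3 := Real.add_one_le_exp (-(1 / t ^ 2))
    rw [Real.rpow_neg ht0.le, Real.rpow_two, ← one_div]
    linarith

section Moments

variable {d q₁ q₂ q₃ : ℕ} {B : Block d q₁ q₂ q₃} {ρ : ℝ → ℝ → Measure (Fin d → ℝ)}

lemma measurableSet_obsSet : MeasurableSet (obsSet B) := by
  have h : obsSet B = {o | o.1 ∈ B.covLaw.support} ∩ ⋂ j, {o | B.thr j ≤ o.2 j} := by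
    ext o
    simp [obsSet]
  rw [h]
  exact ((Measure.isClosed_support.preimage continuous_fst).inter (isClosed_iInter fun j =>
    isClosed_le continuous_const (by fun_prop))).measurableSet

lemma ae_mem_obsSet [IsProbabilityMeasure B.covLaw]
    (h_BR : ∀ ω ζ : ℝ, IsBrownResnick B.site ω ζ (ρ ω ζ)) (θ : Param q₁ q₂ q₃) :
    ∀ᵐ o ∂obsLaw B ρ θ, o ∈ obsSet B := by
  have := (h_BR (omega θ) (zeta θ)).1
  rw [obsLaw_eq]
  refine (ae_map_iff (p := fun o => o ∈ obsSet B) (measurable_simulate B θ).aemeasurable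
    measurableSet_obsSet).2 ?_
  have h1 : ∀ᵐ z ∂B.covLaw, z ∈ B.covLaw.support := Measure.support_mem_ae
  filter_upwards [Measure.quasiMeasurePreserving_fst.ae h1] with zx hzx
  exact ⟨hzx, fun j => le_max_right _ _⟩

lemma frechetObs_simulate {θ : Param q₁ q₂ q₃} {z : Design d q₁ q₂ q₃} (h : MarginsValid B θ z)
    {x : Fin d → ℝ} {j : Fin d} (hx : 0 < x j) :
    frechetObs θ (simulate B θ (z, x)) j = max (x j) (frechetThr B θ z j) := by
  have hσ := gevScale_pos θ z j
  have hiff := fromFrechet_le_iff (μ := gevLoc θ z j) hσ hx (h j).2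
  change toFrechet (gevLoc θ z j) (gevScale θ z j) (gevShape θ z j)
    (max (fromFrechet (gevLoc θ z j) (gevScale θ z j) (gevShape θ z j) (x j)) (B.thr j)) = _
  rw [frechetThr]
  by_cases hle : fromFrechet (gevLoc θ z j) (gevScale θ z j) (gevShape θ z j) (x j) ≤ B.thr j
  · rw [max_eq_right hle, max_eq_right (hiff.1 hle)]
  · rw [max_eq_left (not_le.1 hle).le, toFrechet_fromFrechet hσ hx,
      max_eq_left (not_le.1 (mt hiff.2 hle)).le]

variable {U : Set (Param q₁ q₂ q₃)}

/-- The excesses on the parameter-free logarithmic scale are dominated by the outcome on the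
logarithmic Fréchet scale. -/
lemma WellInside.exists_boxLog_le (hU : WellInside B U) (j : Fin d) :
    ∃ C D : ℝ, 0 ≤ C ∧ ∀ θ ∈ U, ∀ o ∈ obsSet B,
      boxLog ‖(o.1 j).2.2‖ (excess B o j) ≤ C * (D + logFrechet B θ o j) := by
  obtain ⟨C₀, h₀⟩ := ((hU.tame_boxLog_thr 0 j).mul (fun _ _ => le_rfl)
    (hU.tame_inv_shapeRatio 0 j)).exists_abs_le
  obtain ⟨C₁, h₁⟩ := (hU.tame_logRate 0 j).exists_abs_le
  obtain ⟨E, hE⟩ := (hU.tame_shapeRatio 0 j).exists_abs_le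
  refine ⟨Real.exp |C₁| * |E|, C₀, by positivity, fun θ hθ o ho => ?_⟩
  have hη := (hU.valid hθ ho.1 j).1
  have hr := excess_nonneg (B := B) o j
  have hε : 0 ≤ ‖(o.1 j).2.2‖ := norm_nonneg _
  have e1 : boxLog ‖(o.1 j).2.2‖ (excess B o j) ≤
      Real.exp |C₁| * boxLog ‖(o.1 j).2.2‖ (excess B o j * Real.exp (logRate B θ o.1 j)) := by
    have h2 : excess B o j = Real.exp |C₁| * (Real.exp (-|C₁|) * excess B o j) := by
      rw [← mul_assoc, ← Real.exp_add]
      simp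
    conv_lhs => rw [h2]
    refine (boxLog_mul_le hε (by positivity) (Real.one_le_exp (abs_nonneg _))).trans ?_
    refine mul_le_mul_of_nonneg_left (boxLog_mono hε (by positivity) ?_) (Real.exp_pos _).le
    rw [mul_comm]
    refine mul_le_mul_of_nonneg_left (Real.exp_le_exp.2 ?_) hr
    linarith [(abs_le.1 (h₁ o ho θ hθ)).1, le_abs_self C₁]
  have e2 : boxLog ‖(o.1 j).2.2‖ (excess B o j * Real.exp (logRate B θ o.1 j)) *
      (shapeRatio θ o.1 j)⁻¹ ≤ C₀ + logFrechet B θ o j := by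
    have := (abs_le.1 (h₀ o ho θ hθ)).1
    rw [logFrechet, add_mul]
    linarith
  have e3 : 0 ≤ boxLog ‖(o.1 j).2.2‖ (excess B o j * Real.exp (logRate B θ o.1 j)) :=
    boxLog_nonneg hε (by positivity)
  have e4 : 0 ≤ C₀ + logFrechet B θ o j := le_trans (by positivity) e2
  have e5 := mul_le_mul_of_nonneg_left e2 hη.le
  rw [mul_left_comm, mul_inv_cancel₀ hη.ne', mul_one] at e5
  have e6 : shapeRatio θ o.1 j ≤ |E| :=
    (le_abs_self _).trans ((hE o ho θ hθ).trans (le_abs_self _))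
  calc _ ≤ _ := e1
    _ ≤ Real.exp |C₁| * (|E| * (C₀ + logFrechet B θ o j)) :=
        mul_le_mul_of_nonneg_left (e5.trans (mul_le_mul_of_nonneg_right e6 e4)) (Real.exp_pos _).le
    _ = _ := by ring

lemma WellInside.integrable_exp_half_logFrechet [IsProbabilityMeasure B.covLaw]
    (hU : WellInside B U) (h_BR : ∀ ω ζ : ℝ, IsBrownResnick B.site ω ζ (ρ ω ζ))
    {θ : Param q₁ q₂ q₃} (hθ : θ ∈ U) (j : Fin d) :
    Integrable (fun o => Real.exp (logFrechet B θ o j / 2)) (obsLaw B ρ θ) := by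
  have hBR := h_BR (omega θ) (zeta θ)
  have := hBR.1
  have hlm : Measurable fun o => logFrechet B θ o j := (hU.tame_logFrechet 0 j).polyBdd.1 θ hθ
  have hm : Measurable fun o => Real.exp (logFrechet B θ o j / 2) :=
    Real.measurable_exp.comp (hlm.div_const 2)
  obtain ⟨C, hC⟩ := ((hU.tame_boxLog_thr 0 j).mul (fun _ _ => le_rfl)
    (hU.tame_inv_shapeRatio 0 j)).exists_abs_le
  rw [obsLaw_eq, integrable_map_measure hm.aestronglyMeasurable
    (measurable_simulate B θ).aemeasurable]
  have hint : Integrable (fun zx : Design d q₁ q₂ q₃ × (Fin d → ℝ) =>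
      √(zx.2 j) + √(Real.exp C)) (B.covLaw.prod (ρ (omega θ) (zeta θ))) :=
    ((hBR.integrable_sqrt j).comp_snd _).add (integrable_const _)
  refine hint.mono' (hm.comp (measurable_simulate B θ)).aestronglyMeasurable ?_
  have h1 : ∀ᵐ z ∂B.covLaw, z ∈ B.covLaw.support := Measure.support_mem_ae
  filter_upwards [Measure.quasiMeasurePreserving_fst.ae h1,
    Measure.quasiMeasurePreserving_snd.ae hBR.ae_pos] with zx hz hx
  have hv := hU.valid hθ hz
  have e1 : Real.exp (logFrechet B θ (simulate B θ zx) j) =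
      max (zx.2 j) (frechetThr B θ zx.1 j) := by
    rw [← frechetObs_simulate hv (hx j)]
    exact (frechetObs_eq_exp (o := simulate B θ zx) hv (le_max_right _ _)).symm
  have e2 : frechetThr B θ zx.1 j ≤ Real.exp C := by
    have hmem : ((zx.1, B.thr) : Obs d q₁ q₂ q₃) ∈ obsSet B := ⟨hz, fun _ => le_rfl⟩
    have h2 := frechetObs_eq_exp (o := (zx.1, B.thr)) (j := j) hv le_rfl
    rw [← frechetThr_eq_frechetObs (B := B) rfl] at h2
    rw [h2]
    refine Real.exp_le_exp.2 ?_
    have h3 := (abs_le.1 (hC _ hmem θ hθ)).2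
    simpa [logFrechet, excess, boxLog_zero_right] using h3
  simp only [Function.comp, Real.norm_eq_abs, Real.exp_half]
  rw [e1, abs_of_nonneg (Real.sqrt_nonneg _)]
  rcases max_cases (zx.2 j) (frechetThr B θ zx.1 j) with h | h <;> rw [h.1]
  · linarith [Real.sqrt_nonneg (Real.exp C)]
  · linarith [Real.sqrt_nonneg (zx.2 j), Real.sqrt_le_sqrt e2]

lemma WellInside.memLp_tailBound [IsProbabilityMeasure B.covLaw]
    (hU : WellInside B U) (h_BR : ∀ ω ζ : ℝ, IsBrownResnick B.site ω ζ (ρ ω ζ))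
    {θ : Param q₁ q₂ q₃} (hθ : θ ∈ U) (k : ℕ) : MemLp (tailBound B) k (obsLaw B ρ θ) := by
  have := isProbabilityMeasure_obsLaw h_BR θ
  have hj : ∀ j ∈ Finset.univ,
      MemLp (fun o : Obs d q₁ q₂ q₃ => boxLog ‖(o.1 j).2.2‖ (excess B o j)) k (obsLaw B ρ θ) := by
    intro j _
    have hm : Measurable fun o : Obs d q₁ q₂ q₃ => boxLog ‖(o.1 j).2.2‖ (excess B o j) :=
      measurable_boxLog (measurable_shapeNorm j) (measurable_excess j)
    rcases k.eq_zero_or_pos with rfl | hk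
    · simpa using hm.aestronglyMeasurable
    rw [← integrable_norm_rpow_iff hm.aestronglyMeasurable (by exact_mod_cast hk.ne')
      (ENNReal.natCast_ne_top k)]
    simp only [ENNReal.toReal_natCast, Real.rpow_natCast]
    obtain ⟨C, D, hC, hb⟩ := hU.exists_boxLog_le j
    refine ((hU.integrable_exp_half_logFrechet h_BR hθ j).const_mul
      ((2 * C) ^ k * (k.factorial * Real.exp (D / 2)))).mono'
      (hm.norm.pow_const k).aestronglyMeasurable ?_
    filter_upwards [ae_mem_obsSet h_BR θ] with o ho
    -- powers are dominated through `x ^ k ≤ k! * exp x`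
    have h0 := boxLog_excess_nonneg (B := B) o j
    have h1 := hb θ hθ o ho
    rw [Real.norm_eq_abs, Real.norm_eq_abs, abs_of_nonneg (by positivity), abs_of_nonneg h0]
    rcases hC.eq_or_lt with rfl | hC
    · rw [zero_mul] at h1
      rw [le_antisymm h1 h0]
      simp [hk.ne']
    · have h2 : 0 ≤ (D + logFrechet B θ o j) / 2 := by
        have := (mul_nonneg_iff_of_pos_left hC).1 (h0.trans h1)
        linarith
      calc boxLog ‖(o.1 j).2.2‖ (excess B o j) ^ k
          ≤ (C * (D + logFrechet B θ o j)) ^ k := pow_le_pow_left₀ h0 h1 k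
        _ = (2 * C) ^ k * ((D + logFrechet B θ o j) / 2) ^ k := by rw [← mul_pow]; ring
        _ ≤ (2 * C) ^ k * (k.factorial * Real.exp ((D + logFrechet B θ o j) / 2)) := by
            gcongr
            have := Real.pow_div_factorial_le_exp _ h2 k
            rwa [div_le_iff₀' (by positivity)] at this
        _ = _ := by
            rw [add_div, Real.exp_add]
            ring
  exact memLp_finsetSum _ hj

/-- The envelope has moments of all orders, as the logarithm of a unit Fréchet variable has. -/
lemma WellInside.integrable_pow [IsProbabilityMeasure B.covLaw]
    (hU : WellInside B U) (h_BR : ∀ ω ζ : ℝ, IsBrownResnick B.site ω ζ (ρ ω ζ))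
    {θ : Param q₁ q₂ q₃} (hθ : θ ∈ U) (k : ℕ) :
    Integrable (fun o => (1 + tailBound B o) ^ k) (obsLaw B ρ θ) := by
  have := isProbabilityMeasure_obsLaw h_BR θ
  have h := ((memLp_const (1 : ℝ)).add (hU.memLp_tailBound h_BR hθ k)).integrable_norm_pow'
  refine h.congr (Eventually.of_forall fun o => ?_)
  have := tailBound_nonneg (B := B) o
  simp only [Pi.add_apply, Real.norm_eq_abs]
  rw [abs_of_nonneg (by positivity)]

end Moments

/-! ### The likelihood contribution of a pair is a density -/

section CensoredDensity

/-- The dominating measure for an outcome censored at `u`: an atom at `u` and Lebesgue measure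
above. -/
def censMeasure (u : ℝ) : Measure ℝ := Measure.dirac u + volume.restrict (Ioi u)

instance (u : ℝ) : SFinite (censMeasure u) := by unfold censMeasure; infer_instance

lemma ae_le_censMeasure (u : ℝ) : ∀ᵐ y ∂censMeasure u, u ≤ y := by
  rw [censMeasure, ae_add_measure_iff]
  exact ⟨by simp [ae_dirac_eq], ae_restrict_of_forall_mem measurableSet_Ioi fun y hy => le_of_lt hy⟩

/-- The fundamental theorem of calculus for a distribution function with an atom at `u`. -/
lemma setLIntegral_Iic_censMeasure {u s : ℝ} (hus : u ≤ s) {f f' : ℝ → ℝ} (h0 : 0 ≤ f u)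
    (hd : ∀ y, u ≤ y → HasDerivAt f (f' y) y) (hpos : ∀ y, u ≤ y → 0 ≤ f' y) {k : ℝ → ENNReal}
    (hk : ∀ y, u ≤ y → k y = ENNReal.ofReal (if u < y then f' y else f u)) :
    ∫⁻ y in Iic s, k y ∂censMeasure u = ENNReal.ofReal (f s) := by
  have hint : IntegrableOn f' (Ioc u s) := intervalIntegral.integrableOn_deriv_of_nonneg
    (fun y hy => (hd y hy.1).continuousAt.continuousWithinAt) (fun y hy => hd y hy.1.le)
    fun y hy => hpos y hy.1.le
  have hFTC : ∫ y in Ioc u s, f' y = f s - f u := by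
    rw [← intervalIntegral.integral_of_le hus]
    refine intervalIntegral.integral_eq_sub_of_hasDerivAt (fun y hy => hd y ?_) ?_
    · rw [uIcc_of_le hus] at hy
      exact hy.1
    · exact (intervalIntegrable_iff_integrableOn_Ioc_of_le hus).2 hint
  have hnn : 0 ≤ f s - f u := by
    rw [← hFTC]
    exact setIntegral_nonneg measurableSet_Ioc fun y hy => hpos y hy.1.le
  rw [censMeasure, Measure.restrict_add, lintegral_add_measure, restrict_dirac,
    if_pos (mem_Iic.2 hus), lintegral_dirac, hk u le_rfl, if_neg (lt_irrefl u),
    Measure.restrict_restrict measurableSet_Iic, inter_comm, Ioi_inter_Iic,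
    setLIntegral_congr_fun measurableSet_Ioc fun y hy => by
      rw [hk y hy.1.le, if_pos hy.1], ← ofReal_integral_eq_lintegral_ofReal hint
    (ae_restrict_of_forall_mem measurableSet_Ioc fun y hy => hpos y hy.1.le), hFTC,
    ← ENNReal.ofReal_add h0 hnn, add_sub_cancel]

/-- A bivariate distribution function recovered from its density with respect to the product of two
measures with atoms at the thresholds. -/
lemma setLIntegral_prod_censMeasure {u v s t : ℝ} (hus : u ≤ s) (hvt : v ≤ t)
    {F F₁ F₂ F₁₂ : ℝ → ℝ → ℝ} (h0 : ∀ x y, u ≤ x → v ≤ y → 0 ≤ F x y)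
    (h1 : ∀ x y, u ≤ x → v ≤ y → HasDerivAt (fun x => F x y) (F₁ x y) x)
    (h2 : ∀ x y, u ≤ x → v ≤ y → HasDerivAt (fun y => F x y) (F₂ x y) y)
    (h12 : ∀ x y, u ≤ x → v ≤ y → HasDerivAt (fun x => F₂ x y) (F₁₂ x y) x)
    (n1 : ∀ x y, u ≤ x → v ≤ y → 0 ≤ F₁ x y) (n2 : ∀ x y, u ≤ x → v ≤ y → 0 ≤ F₂ x y)
    (n12 : ∀ x y, u ≤ x → v ≤ y → 0 ≤ F₁₂ x y) {k : ℝ × ℝ → ENNReal} (hkm : Measurable k)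
    (hk : ∀ x y, u ≤ x → v ≤ y → k (x, y) = ENNReal.ofReal
      (if u < x then if v < y then F₁₂ x y else F₁ x v else if v < y then F₂ u y else F u v)) :
    ∫⁻ p in Iic s ×ˢ Iic t, k p ∂(censMeasure u).prod (censMeasure v) =
      ENNReal.ofReal (F s t) := by
  rw [← Measure.prod_restrict, lintegral_prod_symm' _ hkm]
  have hin : ∀ y, v ≤ y → ∫⁻ x in Iic s, k (x, y) ∂censMeasure u =
      ENNReal.ofReal (if v < y then F₂ s y else F s v) := by
    intro y hy
    split_ifs with hvy
    · exact setLIntegral_Iic_censMeasure hus (n2 u y le_rfl hy) (fun x hx => h12 x y hx hy)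
        (fun x hx => n12 x y hx hy) fun x hx => by simp [hk x y hx hy, hvy]
    · obtain rfl : v = y := le_antisymm hy (not_lt.1 hvy)
      exact setLIntegral_Iic_censMeasure hus (h0 u v le_rfl hy) (fun x hx => h1 x v hx hy)
        (fun x hx => n1 x v hx hy) fun x hx => by simp [hk x v hx hy]
  exact setLIntegral_Iic_censMeasure hvt (h0 s v hus le_rfl) (fun y hy => h2 s y hus hy)
    (fun y hy => n2 s y hus hy) hin

/-- Finite measures on the plane that live on a quadrant are determined by their values on
lower-left rectangles with corners in the quadrant. -/
lemma ext_of_Iic_prod {u v : ℝ} {μ ν : Measure (ℝ × ℝ)} [IsProbabilityMeasure μ]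
    (hμ : ∀ᵐ p ∂μ, u ≤ p.1 ∧ v ≤ p.2) (hν : ∀ᵐ p ∂ν, u ≤ p.1 ∧ v ≤ p.2)
    (h : ∀ s t, u ≤ s → v ≤ t → μ (Iic s ×ˢ Iic t) = ν (Iic s ×ˢ Iic t)) : μ = ν := by
  have hall : ∀ s t, μ (Iic s ×ˢ Iic t) = ν (Iic s ×ˢ Iic t) := by
    intro s t
    by_cases hst : u ≤ s ∧ v ≤ t
    · exact h s t hst.1 hst.2
    · have hz : ∀ m : Measure (ℝ × ℝ), (∀ᵐ p ∂m, u ≤ p.1 ∧ v ≤ p.2) → m (Iic s ×ˢ Iic t) = 0 := by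
        intro m hm
        rw [measure_eq_zero_iff_ae_notMem]
        filter_upwards [hm] with p hp hmem
        exact hst ⟨hp.1.trans hmem.1, hp.2.trans hmem.2⟩
      rw [hz μ hμ, hz ν hν]
  have hspan : IsCountablySpanning (range (Iic : ℝ → Set ℝ)) :=
    ⟨fun n : ℕ => Iic (n : ℝ), fun n => ⟨_, rfl⟩, iUnion_Iic_of_not_bddAbove_range (by
      rw [not_bddAbove_iff]
      intro x
      obtain ⟨n, hn⟩ := exists_nat_gt x
      exact ⟨n, ⟨n, rfl⟩, hn⟩)⟩
  have hgen : (Prod.instMeasurableSpace : MeasurableSpace (ℝ × ℝ)) =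
      MeasurableSpace.generateFrom (image2 (· ×ˢ ·) (range (Iic : ℝ → Set ℝ)) (range Iic)) :=
    (generateFrom_eq_prod ((borel_eq_generateFrom_Iic ℝ).symm.trans BorelSpace.measurable_eq.symm)
      ((borel_eq_generateFrom_Iic ℝ).symm.trans BorelSpace.measurable_eq.symm) hspan hspan).symm
  refine Measure.ext_of_generateFrom_of_iUnion _ (fun n : ℕ => Iic (n : ℝ) ×ˢ Iic (n : ℝ)) hgen
    (isPiSystem_Iic.prod isPiSystem_Iic) ?_ (fun n => ⟨_, ⟨_, rfl⟩, _, ⟨_, rfl⟩, rfl⟩)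
    (fun n => measure_ne_top μ _) ?_
  · refine eq_univ_of_forall fun p => mem_iUnion.2 ?_
    obtain ⟨n, hn⟩ := exists_nat_ge (max p.1 p.2)
    exact ⟨n, (le_max_left _ _).trans hn, (le_max_right _ _).trans hn⟩
  · rintro _ ⟨_, ⟨s, rfl⟩, _, ⟨t, rfl⟩, rfl⟩
    exact hall s t

end CensoredDensity

section LikelihoodRatio

variable {d q₁ q₂ q₃ : ℕ} {B : Block d q₁ q₂ q₃} {ρ : ℝ → ℝ → Measure (Fin d → ℝ)}

/-- An observation with given outcomes at two sites, and outcomes at the thresholds elsewhere. -/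
def pairObs (B : Block d q₁ q₂ q₃) (z : Design d q₁ q₂ q₃) (j l : Fin d) (y : ℝ × ℝ) :
    Obs d q₁ q₂ q₃ :=
  (z, Function.update (Function.update B.thr j y.1) l y.2)

lemma measurable_pairObs (z : Design d q₁ q₂ q₃) (j l : Fin d) :
    Measurable (pairObs B z j l) := by
  refine measurable_const.prodMk ?_
  refine measurable_pi_lambda _ fun i => ?_
  simp only [Function.update_apply]
  split_ifs
  · exact measurable_snd
  · exact measurable_fst
  · exact measurable_const

lemma pairObs_right (z : Design d q₁ q₂ q₃) (j l : Fin d) (y : ℝ × ℝ) :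
    (pairObs B z j l y).2 l = y.2 := by simp [pairObs]

lemma pairObs_left (z : Design d q₁ q₂ q₃) {j l : Fin d} (hjl : j ≠ l) (y : ℝ × ℝ) :
    (pairObs B z j l y).2 j = y.1 := by simp [pairObs, Function.update_of_ne hjl]

lemma thr_le_pairObs (z : Design d q₁ q₂ q₃) {j l : Fin d} (y : ℝ × ℝ)
    (h1 : B.thr j ≤ y.1) (h2 : B.thr l ≤ y.2) (i : Fin d) : B.thr i ≤ (pairObs B z j l y).2 i := by
  unfold pairObs
  dsimp only
  by_cases hl : i = l
  · subst hl
    simpa using h2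
  · rw [Function.update_of_ne hl]
    by_cases hj : i = j
    · subst hj
      simpa using h1
    · rw [Function.update_of_ne hj]

lemma pairLogLik_congr {θ : Param q₁ q₂ q₃} {o o' : Obs d q₁ q₂ q₃} {j l : Fin d} (h : o.1 = o'.1)
    (hj : o.2 j = o'.2 j) (hl : o.2 l = o'.2 l) : pairLogLik B θ o j l = pairLogLik B θ o' j l := by
  simp only [pairLogLik, pairArg, logMargin, logFrechet, excess, h, hj, hl]

/-- Given the covariates, the likelihood contribution of a pair is the density of the censored
outcomes at the two sites. -/
lemma map_pair_eq_withDensity {θ : Param q₁ q₂ q₃} {z : Design d q₁ q₂ q₃} (hv : MarginsValid B θ z)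
    (hm : ∀ j l, Measurable fun o => pairLogLik B θ o j l)
    (hBR : IsBrownResnick B.site (omega θ) (zeta θ) (ρ (omega θ) (zeta θ))) {j l : Fin d}
    (hjl : B.site j ≠ B.site l) :
    (ρ (omega θ) (zeta θ)).map
        (fun x => ((simulate B θ (z, x)).2 j, (simulate B θ (z, x)).2 l)) =
      ((censMeasure (B.thr j)).prod (censMeasure (B.thr l))).withDensity fun y =>
        ENNReal.ofReal (Real.exp (pairLogLik B θ (pairObs B z j l y) j l)) := by
  classical
  have hne : j ≠ l := fun h => hjl (by rw [h])
  have hp := hBR.1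
  have hsim : Measurable fun x => simulate B θ (z, x) :=
    (measurable_simulate B θ).comp measurable_prodMk_left
  have hpair : Measurable fun x : Fin d → ℝ =>
      ((simulate B θ (z, x)).2 j, (simulate B θ (z, x)).2 l) :=
    ((measurable_pi_apply j).comp (measurable_snd.comp hsim)).prodMk
      ((measurable_pi_apply l).comp (measurable_snd.comp hsim))
  have := Measure.isProbabilityMeasure_map (μ := ρ (omega θ) (zeta θ)) hpair.aemeasurable
  set a := pairDep B θ j l with ha
  have ha0 : 0 < a := by
    rw [ha, pairDep_eq_exp hjl]
    exact Real.exp_pos _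
  set f : Fin d → ℝ → ℝ := fun i => toFrechet (gevLoc θ z i) (gevScale θ z i) (gevShape θ z i)
    with hf
  set J : Fin d → ℝ → ℝ := fun i => jacobian (gevLoc θ z i) (gevScale θ z i) (gevShape θ z i)
    with hJ
  have hfpos : ∀ i y, B.thr i ≤ y → 0 < f i y := fun i y hy =>
    toFrechet_pos (gevArg_pos_of_le hv hy)
  have hfd : ∀ i y, B.thr i ≤ y → HasDerivAt (f i) (J i y) y := fun i y hy => by
    rw [hJ]
    beta_reduce
    rw [jacobian_eq (gevArg_pos_of_le hv hy)]
    exact hasDerivAt_toFrechet (gevArg_pos_of_le hv hy)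
  have hJpos : ∀ i y, B.thr i ≤ y → 0 < J i y := fun i y hy => by
    rw [hJ]
    beta_reduce
    have h1 := gevArg_pos_of_le hv hy
    rw [jacobian_eq h1]
    exact mul_pos (hfpos i y hy) (mul_pos (inv_pos.2 h1) (inv_pos.2 (gevScale_pos θ z i)))
  have hkm : Measurable fun y : ℝ × ℝ =>
      ENNReal.ofReal (Real.exp (pairLogLik B θ (pairObs B z j l y) j l)) :=
    ENNReal.measurable_ofReal.comp (Real.measurable_exp.comp
      ((hm j l).comp (measurable_pairObs z j l)))
  have hprod : ∀ᵐ p ∂(censMeasure (B.thr j)).prod (censMeasure (B.thr l)),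
      B.thr j ≤ p.1 ∧ B.thr l ≤ p.2 :=
    (Measure.quasiMeasurePreserving_fst.ae (ae_le_censMeasure _)).and
      (Measure.quasiMeasurePreserving_snd.ae (ae_le_censMeasure _))
  refine ext_of_Iic_prod (u := B.thr j) (v := B.thr l) ?_
    (withDensity_absolutelyContinuous _ _ hprod) fun s t hs ht => ?_
  · refine (ae_map_iff (p := fun p : ℝ × ℝ => B.thr j ≤ p.1 ∧ B.thr l ≤ p.2) hpair.aemeasurable
      ?_).2 (Eventually.of_forall fun x => ⟨le_max_right _ _, le_max_right _ _⟩)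
    exact (measurableSet_le measurable_const measurable_fst).inter
      (measurableSet_le measurable_const measurable_snd)
  · rw [withDensity_apply _ (measurableSet_Iic.prod measurableSet_Iic),
      setLIntegral_prod_censMeasure hs ht (F := fun x y => pairCDF a (f j x) (f l y))
      (F₁ := fun x y => pairPartial a (f j x) (f l y) * J j x)
      (F₂ := fun x y => pairPartial a (f l y) (f j x) * J l y)
      (F₁₂ := fun x y => pairDensity a (f j x) (f l y) * J j x * J l y)
      (fun _ _ _ _ => pairCDF_pos.le)
      (fun x y hx hy => (hasDerivAt_pairCDF ha0 (hfpos j x hx) (hfpos l y hy)).comp x (hfd j x hx))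
      (fun x y hx hy =>
        (hasDerivAt_pairCDF_right ha0 (hfpos j x hx) (hfpos l y hy)).comp y (hfd l y hy))
      (fun x y hx hy => ((hasDerivAt_pairPartial ha0 (hfpos j x hx) (hfpos l y hy)).comp x
        (hfd j x hx)).mul_const _)
      (fun x y hx hy => (mul_pos (pairPartial_pos (hfpos j x hx)) (hJpos j x hx)).le)
      (fun x y hx hy => (mul_pos (pairPartial_pos (hfpos l y hy)) (hJpos l y hy)).le)
      (fun x y hx hy => (mul_pos (mul_pos (pairDensity_pos ha0 (hfpos j x hx) (hfpos l y hy))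
        (hJpos j x hx)) (hJpos l y hy)).le) hkm]
    · rw [Measure.map_apply hpair (measurableSet_Iic.prod measurableSet_Iic),
        ← ENNReal.ofReal_toReal (measure_ne_top (ρ (omega θ) (zeta θ)) _)]
      congr 1
      change (ρ (omega θ) (zeta θ)).real _ = _
      rw [ha, pairDep, ← hBR.measureReal_pair hjl (hfpos j s hs) (hfpos l t ht)]
      refine measureReal_congr ?_
      filter_upwards [hBR.ae_pos] with x hx
      have hiff : ∀ i y, B.thr i ≤ y → ((simulate B θ (z, x)).2 i ≤ y ↔ x i ≤ f i y) := by
        intro i y hy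
        change max _ _ ≤ y ↔ _
        rw [max_le_iff, and_iff_left hy]
        exact fromFrechet_le_iff (gevScale_pos θ z i) (hx i) (gevArg_pos_of_le hv hy)
      exact propext (and_congr (hiff j s hs) (hiff l t ht))
    · intro x y hx hy
      congr 1
      have ho := thr_le_pairObs (B := B) z (j := j) (l := l) (x, y) hx hy
      have e := pairLik_eq (θ := θ) (o := pairObs B z j l (x, y)) hjl hv ho
      rw [← pairLik_eq_exp hjl hv ho, e]
      have e1 := pairObs_left (B := B) z hne (x, y)
      have e2 := pairObs_right (B := B) z j l (x, y)
      simp only [frechetObs, jacobianObs, e1, e2]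
      rfl

/-- The likelihood ratio of a pair has expectation one: both densities are positive wherever the
thresholds are not undercut, so that no mass is lost. -/
lemma lintegral_pair_ratio [IsProbabilityMeasure B.covLaw] {U : Set (Param q₁ q₂ q₃)}
    (hU : WellInside B U) (h_BR : ∀ ω ζ : ℝ, IsBrownResnick B.site ω ζ (ρ ω ζ))
    {θ₀ θ : Param q₁ q₂ q₃} (hθ₀ : θ₀ ∈ U) (hθ : θ ∈ U) {j l : Fin d}
    (hjl : B.site j ≠ B.site l) :
    ∫⁻ o, ENNReal.ofReal (Real.exp (pairLogLik B θ o j l - pairLogLik B θ₀ o j l)) ∂obsLaw B ρ θ₀ =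
      1 := by
  have hne : j ≠ l := fun h => hjl (by rw [h])
  have hp₀ := (h_BR (omega θ₀) (zeta θ₀)).1
  have hp := (h_BR (omega θ) (zeta θ)).1
  have hm : ∀ τ ∈ U, ∀ j l, Measurable fun o => pairLogLik B τ o j l := fun τ hτ j l =>
    (hU.tame_pairLogLik 0 j l).polyBdd.1 τ hτ
  have hRm : Measurable fun o =>
      ENNReal.ofReal (Real.exp (pairLogLik B θ o j l - pairLogLik B θ₀ o j l)) :=
    ENNReal.measurable_ofReal.comp (Real.measurable_exp.comp ((hm θ hθ j l).sub (hm θ₀ hθ₀ j l)))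
  have hsim : ∀ τ : Param q₁ q₂ q₃, ∀ z, Measurable fun x => simulate B τ (z, x) := fun τ z =>
    (measurable_simulate B τ).comp measurable_prodMk_left
  have hpair : ∀ τ : Param q₁ q₂ q₃, ∀ z, Measurable fun x : Fin d → ℝ =>
      ((simulate B τ (z, x)).2 j, (simulate B τ (z, x)).2 l) := fun τ z =>
    ((measurable_pi_apply j).comp (measurable_snd.comp (hsim τ z))).prodMk
      ((measurable_pi_apply l).comp (measurable_snd.comp (hsim τ z)))
  have hTonelli := lintegral_prod (μ := B.covLaw) (ν := ρ (omega θ₀) (zeta θ₀))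
    (fun a => ENNReal.ofReal (Real.exp (pairLogLik B θ (simulate B θ₀ a) j l -
      pairLogLik B θ₀ (simulate B θ₀ a) j l))) (hRm.comp (measurable_simulate B θ₀)).aemeasurable
  rw [obsLaw_eq, lintegral_map hRm (measurable_simulate B θ₀), hTonelli]
  have hz : ∀ᵐ z ∂B.covLaw, z ∈ B.covLaw.support := Measure.support_mem_ae
  rw [lintegral_congr_ae (g := fun _ => 1), lintegral_one, measure_univ]
  filter_upwards [hz] with z hz
  set R : ℝ × ℝ → ENNReal := fun y => ENNReal.ofReal (Real.exp
    (pairLogLik B θ (pairObs B z j l y) j l - pairLogLik B θ₀ (pairObs B z j l y) j l)) with hR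
  have hRm' : Measurable R := hRm.comp (measurable_pairObs z j l)
  have hk : ∀ τ ∈ U, Measurable fun y : ℝ × ℝ =>
      ENNReal.ofReal (Real.exp (pairLogLik B τ (pairObs B z j l y) j l)) := fun τ hτ =>
    ENNReal.measurable_ofReal.comp (Real.measurable_exp.comp
      ((hm τ hτ j l).comp (measurable_pairObs z j l)))
  have e1 : ∀ x : Fin d → ℝ, ENNReal.ofReal (Real.exp (pairLogLik B θ (simulate B θ₀ (z, x)) j l -
      pairLogLik B θ₀ (simulate B θ₀ (z, x)) j l)) =
      R ((simulate B θ₀ (z, x)).2 j, (simulate B θ₀ (z, x)).2 l) := by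
    intro x
    have h1 : ∀ τ : Param q₁ q₂ q₃, pairLogLik B τ (simulate B θ₀ (z, x)) j l =
        pairLogLik B τ (pairObs B z j l
          ((simulate B θ₀ (z, x)).2 j, (simulate B θ₀ (z, x)).2 l)) j l := fun τ =>
      pairLogLik_congr rfl
        (pairObs_left z hne ((simulate B θ₀ (z, x)).2 j, (simulate B θ₀ (z, x)).2 l)).symm
        (pairObs_right z j l ((simulate B θ₀ (z, x)).2 j, (simulate B θ₀ (z, x)).2 l)).symm
    rw [hR]
    beta_reduce
    rw [h1, h1]
  simp only [e1]
  rw [← lintegral_map hRm' (hpair θ₀ z), map_pair_eq_withDensity (hU.valid hθ₀ hz) (hm θ₀ hθ₀)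
    (h_BR _ _) hjl, lintegral_withDensity_eq_lintegral_mul _ (hk θ₀ hθ₀) hRm']
  have e2 := congrArg (fun m : Measure (ℝ × ℝ) => m univ)
    (map_pair_eq_withDensity (hU.valid hθ hz) (hm θ hθ) (h_BR _ _) hjl)
  simp only [withDensity_apply _ MeasurableSet.univ, Measure.restrict_univ,
    Measure.map_apply (hpair θ z) MeasurableSet.univ, preimage_univ, measure_univ] at e2
  rw [e2]
  refine lintegral_congr fun y => ?_
  rw [Pi.mul_apply, hR, ← ENNReal.ofReal_mul (Real.exp_pos _).le, ← Real.exp_add]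
  congr 2
  ring

end LikelihoodRatio

/-! ### Taylor expansions with polynomial envelopes -/

section Taylor

variable {ι : Type*} [Fintype ι] {O : Type*} [MeasurableSpace O]
  {U : Set (EuclideanSpace ℝ ι)} {S : Set O} {M : O → ℝ}

lemma norm_covec_le (c : ι → ℝ) : ‖covec c‖ ≤ ∑ a, |c a| := by
  refine ContinuousLinearMap.opNorm_le_bound _ (Finset.sum_nonneg fun a _ => abs_nonneg _)
    fun v => ?_
  rw [covec_apply, Finset.sum_mul]
  refine (norm_sum_le _ _).trans (Finset.sum_le_sum fun a _ => ?_)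
  rw [norm_mul, Real.norm_eq_abs]
  exact mul_le_mul_of_nonneg_left (PiLp.norm_apply_le v a) (abs_nonneg _)

/-- Finitely many polynomial bounds have a common one. -/
lemma exists_sum_le {κ : Type*} [Fintype κ] {C : κ → ℝ} (hC : ∀ a, 0 ≤ C a) (k : κ → ℕ)
    {X : Type*} {F : κ → X → ℝ} {m : X → ℝ} {w : X → ℝ} (hm : ∀ x, 0 ≤ m x) (hw : ∀ x, 0 ≤ w x)
    (h : ∀ a x, F a x ≤ C a * (1 + m x) ^ k a * w x) :
    ∀ x, ∑ a, F a x ≤ (∑ a, C a) * (1 + m x) ^ (∑ a, k a) * w x := by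
  intro x
  rw [Finset.sum_mul, Finset.sum_mul]
  refine Finset.sum_le_sum fun a _ => (h a x).trans ?_
  refine mul_le_mul_of_nonneg_right (mul_le_mul_of_nonneg_left ?_ (hC a)) (hw x)
  exact pow_le_pow_right₀ (by linarith [hm x]) (Finset.single_le_sum (f := k)
    (fun _ _ => Nat.zero_le _) (Finset.mem_univ a))

lemma exists_sum_abs_le {κ : Type*} [Fintype κ] (hM : ∀ o ∈ S, 0 ≤ M o)
    {f : κ → EuclideanSpace ℝ ι → O → ℝ} (hf : ∀ a, PolyBdd U S M (f a)) :
    ∃ C : ℝ, ∃ k : ℕ, 0 ≤ C ∧ ∀ o ∈ S, ∀ θ ∈ U, ∑ a, |f a θ o| ≤ C * (1 + M o) ^ k := by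
  choose hm C k hC hb using hf
  refine ⟨∑ a, C a, ∑ a, k a, Finset.sum_nonneg fun a _ => hC a, fun o ho θ hθ => ?_⟩
  have := exists_sum_le hC k (X := S × U) (F := fun a x => |f a x.2 x.1|) (m := fun x => M x.1)
    (w := fun _ => 1) (fun x => hM _ x.1.2) (fun _ => zero_le_one)
    (fun a x => by simpa using hb a _ x.1.2 _ x.2.2) (⟨o, ho⟩, ⟨θ, hθ⟩)
  simpa using this

lemma exists_lipschitz (hM : ∀ o ∈ S, 0 ≤ M o) (hU : Convex ℝ U) {f : EuclideanSpace ℝ ι → O → ℝ}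
    (hf : Tame U S M 1 f) : ∃ C : ℝ, ∃ k : ℕ, 0 ≤ C ∧ ∀ o ∈ S, ∀ x ∈ U, ∀ y ∈ U,
      |f x o - f y o| ≤ C * (1 + M o) ^ k * ‖x - y‖ := by
  obtain ⟨-, f', hf', hd⟩ := hf
  obtain ⟨C, k, hC, hb⟩ := exists_sum_abs_le hM hf'
  refine ⟨C, k, hC, fun o ho x hx y hy => ?_⟩
  exact hU.norm_image_sub_le_of_norm_hasFDerivWithin_le
    (fun τ hτ => (hd o ho τ hτ).hasFDerivWithinAt)
    (fun τ hτ => (norm_covec_le _).trans (hb o ho τ hτ)) hy hx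

lemma exists_lipschitz_sum {κ : Type*} [Fintype κ] (hM : ∀ o ∈ S, 0 ≤ M o) (hU : Convex ℝ U)
    {f : κ → EuclideanSpace ℝ ι → O → ℝ} (hf : ∀ a, Tame U S M 1 (f a)) :
    ∃ C : ℝ, ∃ k : ℕ, 0 ≤ C ∧ ∀ o ∈ S, ∀ x ∈ U, ∀ y ∈ U,
      ∑ a, |f a x o - f a y o| ≤ C * (1 + M o) ^ k * ‖x - y‖ := by
  choose C k hC hb using fun a => exists_lipschitz hM hU (hf a)
  refine ⟨∑ a, C a, ∑ a, k a, Finset.sum_nonneg fun a _ => hC a, fun o ho x hx y hy => ?_⟩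
  exact exists_sum_le hC k (X := S × U × U) (F := fun a x => |f a x.2.1 x.1 - f a x.2.2 x.1|)
    (m := fun x => M x.1) (w := fun x => ‖(x.2.1 : EuclideanSpace ℝ ι) - x.2.2‖)
    (fun x => hM _ x.1.2) (fun _ => norm_nonneg _)
    (fun a x => hb a _ x.1.2 _ x.2.1.2 _ x.2.2.2) (⟨o, ho⟩, ⟨x, hx⟩, ⟨y, hy⟩)

/-- Increments agree with those of the linearization at `θ₀` up to a second-order error. -/
lemma exists_expansion (hM : ∀ o ∈ S, 0 ≤ M o) (hU : Convex ℝ U) {f : EuclideanSpace ℝ ι → O → ℝ}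
    {f' : ι → EuclideanSpace ℝ ι → O → ℝ} (hf' : ∀ a, Tame U S M 1 (f' a))
    (hd : ∀ o ∈ S, ∀ θ ∈ U, HasFDerivAt (fun τ => f τ o) (covec fun a => f' a θ o) θ)
    {θ₀ : EuclideanSpace ℝ ι} (hθ₀ : θ₀ ∈ U) :
    ∃ C : ℝ, ∃ k : ℕ, 0 ≤ C ∧ ∀ o ∈ S, ∀ x ∈ U, ∀ y ∈ U,
      |f x o - f y o - ∑ b, f' b θ₀ o * (x - y) b| ≤
        C * (1 + M o) ^ k * ((‖x - θ₀‖ + ‖y - θ₀‖) * ‖x - y‖) := by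
  obtain ⟨C, k, hC, hb⟩ := exists_lipschitz_sum hM hU hf'
  refine ⟨C, k, hC, fun o ho x hx y hy => ?_⟩
  have hseg : segment ℝ y x ⊆ U := hU.segment_subset hy hx
  have hnorm : ∀ τ ∈ segment ℝ y x, ‖τ - θ₀‖ ≤ ‖x - θ₀‖ + ‖y - θ₀‖ := by
    intro τ hτ
    have hx' : x ∈ Metric.closedBall θ₀ (‖x - θ₀‖ + ‖y - θ₀‖) := by
      rw [mem_closedBall_iff_norm]
      linarith [norm_nonneg (y - θ₀)]
    have hy' : y ∈ Metric.closedBall θ₀ (‖x - θ₀‖ + ‖y - θ₀‖) := by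
      rw [mem_closedBall_iff_norm]
      linarith [norm_nonneg (x - θ₀)]
    exact mem_closedBall_iff_norm.1 ((convex_closedBall _ _).segment_subset hy' hx' hτ)
  have h0 : 0 ≤ C * (1 + M o) ^ k := mul_nonneg hC (pow_nonneg (by linarith [hM o ho]) k)
  have key := (convex_segment y x).norm_image_sub_le_of_norm_hasFDerivWithin_le
    (f := fun τ => f τ o - covec (fun a => f' a θ₀ o) τ)
    (f' := fun τ => covec (fun a => f' a τ o) - covec (fun a => f' a θ₀ o))
    (C := C * (1 + M o) ^ k * (‖x - θ₀‖ + ‖y - θ₀‖))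
    (fun τ hτ => ((hd o ho τ (hseg hτ)).sub (covec _).hasFDerivAt).hasFDerivWithinAt)
    (fun τ hτ => by
      have h1 : covec (fun a => f' a τ o) - covec (fun a => f' a θ₀ o) =
          covec fun a => f' a τ o - f' a θ₀ o := by
        ext v
        simp [sub_mul, Finset.sum_sub_distrib]
      rw [h1]
      exact ((norm_covec_le _).trans (hb o ho τ (hseg hτ) θ₀ hθ₀)).trans
        (mul_le_mul_of_nonneg_left (hnorm τ hτ) h0))
    (left_mem_segment ℝ y x) (right_mem_segment ℝ y x)
  rw [Real.norm_eq_abs] at key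
  have h2 : f x o - f y o - ∑ b, f' b θ₀ o * (x - y) b =
      (f x o - covec (fun a => f' a θ₀ o) x) - (f y o - covec (fun a => f' a θ₀ o) y) := by
    rw [← covec_apply, map_sub]
    ring
  rw [h2]
  exact key.trans_eq (by ring)

lemma exists_expansion_sum {κ : Type*} [Fintype κ] (hM : ∀ o ∈ S, 0 ≤ M o) (hU : Convex ℝ U)
    {f : κ → EuclideanSpace ℝ ι → O → ℝ} {f' : κ → ι → EuclideanSpace ℝ ι → O → ℝ}
    (hf' : ∀ a b, Tame U S M 1 (f' a b))
    (hd : ∀ a, ∀ o ∈ S, ∀ θ ∈ U, HasFDerivAt (fun τ => f a τ o) (covec fun b => f' a b θ o) θ)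
    {θ₀ : EuclideanSpace ℝ ι} (hθ₀ : θ₀ ∈ U) :
    ∃ C : ℝ, ∃ k : ℕ, 0 ≤ C ∧ ∀ o ∈ S, ∀ x ∈ U, ∀ y ∈ U,
      ∑ a, |f a x o - f a y o - ∑ b, f' a b θ₀ o * (x - y) b| ≤
        C * (1 + M o) ^ k * ((‖x - θ₀‖ + ‖y - θ₀‖) * ‖x - y‖) := by
  choose C k hC hb using fun a => exists_expansion hM hU (hf' a) (hd a) hθ₀
  refine ⟨∑ a, C a, ∑ a, k a, Finset.sum_nonneg fun a _ => hC a, fun o ho x hx y hy => ?_⟩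
  exact exists_sum_le hC k (X := S × U × U)
    (F := fun a x => |f a x.2.1 x.1 - f a x.2.2 x.1 -
      ∑ b, f' a b θ₀ x.1 * ((x.2.1 : EuclideanSpace ℝ ι) - x.2.2) b|)
    (m := fun x => M x.1) (w := fun x => (‖(x.2.1 : EuclideanSpace ℝ ι) - θ₀‖ +
      ‖(x.2.2 : EuclideanSpace ℝ ι) - θ₀‖) * ‖(x.2.1 : EuclideanSpace ℝ ι) - x.2.2‖)
    (fun x => hM _ x.1.2) (fun _ => by positivity)
    (fun a x => hb a _ x.1.2 _ x.2.1.2 _ x.2.2.2) (⟨o, ho⟩, ⟨x, hx⟩, ⟨y, hy⟩)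

/-- The second-order Taylor expansion along a line. -/
lemma exists_taylor (hM : ∀ o ∈ S, 0 ≤ M o) (hU : Convex ℝ U) {f : EuclideanSpace ℝ ι → O → ℝ}
    {f' : ι → EuclideanSpace ℝ ι → O → ℝ} {f'' : ι → ι → EuclideanSpace ℝ ι → O → ℝ}
    (hf'' : ∀ a b, Tame U S M 1 (f'' a b))
    (hd : ∀ o ∈ S, ∀ θ ∈ U, HasFDerivAt (fun τ => f τ o) (covec fun a => f' a θ o) θ)
    (hd' : ∀ a, ∀ o ∈ S, ∀ θ ∈ U,
      HasFDerivAt (fun τ => f' a τ o) (covec fun b => f'' a b θ o) θ)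
    {θ₀ v : EuclideanSpace ℝ ι} (hθ₀ : θ₀ ∈ U) (hv : θ₀ + v ∈ U) :
    ∃ C : ℝ, ∃ k : ℕ, 0 ≤ C ∧ ∀ o ∈ S, ∀ t ∈ Icc (0 : ℝ) 1,
      |f (θ₀ + t • v) o - f θ₀ o - t * ∑ a, f' a θ₀ o * v a -
        t ^ 2 / 2 * ∑ a, (∑ b, f'' a b θ₀ o * v b) * v a| ≤ C * (1 + M o) ^ k * t ^ 3 := by
  obtain ⟨C, k, hC, hb⟩ := exists_expansion_sum hM hU hf'' hd' hθ₀
  refine ⟨C * ‖v‖ ^ 3, k, by positivity, fun o ho t ht => ?_⟩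
  have hmem : ∀ s ∈ Icc (0 : ℝ) 1, θ₀ + s • v ∈ U := fun s hs =>
    hU.add_smul_mem hθ₀ hv hs
  have h0 : 0 ≤ C * (1 + M o) ^ k := mul_nonneg hC (pow_nonneg (by linarith [hM o ho]) k)
  have hder : ∀ s ∈ Icc (0 : ℝ) t, HasDerivWithinAt
      (fun s => f (θ₀ + s • v) o - s * ∑ a, f' a θ₀ o * v a -
        s ^ 2 / 2 * ∑ a, (∑ b, f'' a b θ₀ o * v b) * v a)
      (∑ a, (f' a (θ₀ + s • v) o - f' a θ₀ o - ∑ b, f'' a b θ₀ o * (s • v) b) * v a)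
      (Icc 0 t) s := by
    intro s hs
    have hl : HasDerivAt (fun s : ℝ => θ₀ + s • v) v s := by
      simpa using ((hasDerivAt_id' s).smul_const v).const_add θ₀
    have h1 := (hd o ho _ (hmem s ⟨hs.1, hs.2.trans ht.2⟩)).comp_hasDerivAt s hl
    have h2 := (hasDerivAt_id' s).mul_const (∑ a, f' a θ₀ o * v a)
    have h3 := (((hasDerivAt_id' s).pow 2).div_const 2).mul_const
      (∑ a, (∑ b, f'' a b θ₀ o * v b) * v a)
    refine (((h1.sub h2).sub h3).congr_deriv ?_).hasDerivWithinAt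
    rw [covec_apply]
    simp only [sub_mul, Finset.sum_sub_distrib, PiLp.smul_apply, smul_eq_mul, one_mul]
    congr 1
    rw [Finset.mul_sum]
    refine Finset.sum_congr rfl fun a _ => ?_
    rw [← mul_assoc, Finset.mul_sum]
    congr 1
    refine Finset.sum_congr rfl fun b _ => ?_
    simp
    ring
  have key := (convex_Icc (0 : ℝ) t).norm_image_sub_le_of_norm_hasDerivWithin_le
    (C := C * (1 + M o) ^ k * (t ^ 2 * ‖v‖ ^ 3)) hder (fun s hs => by
      have hs1 : s ∈ Icc (0 : ℝ) 1 := ⟨hs.1, hs.2.trans ht.2⟩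
      have h1 := hb o ho _ (hmem s hs1) θ₀ hθ₀
      simp only [add_sub_cancel_left, sub_self, norm_zero, add_zero, norm_smul,
        Real.norm_eq_abs, abs_of_nonneg hs.1] at h1
      have h2 : s ^ 2 ≤ t ^ 2 := pow_le_pow_left₀ hs.1 hs.2 2
      calc _ ≤ ∑ a, |f' a (θ₀ + s • v) o - f' a θ₀ o - ∑ b, f'' a b θ₀ o * (s • v) b| * ‖v‖ := by
            refine (norm_sum_le _ _).trans (Finset.sum_le_sum fun a _ => ?_)
            rw [norm_mul, Real.norm_eq_abs]
            exact mul_le_mul_of_nonneg_left (PiLp.norm_apply_le v a) (abs_nonneg _)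
        _ ≤ (C * (1 + M o) ^ k * (s * ‖v‖ * (s * ‖v‖))) * ‖v‖ := by
            rw [← Finset.sum_mul]
            exact mul_le_mul_of_nonneg_right h1 (norm_nonneg _)
        _ = C * (1 + M o) ^ k * (s ^ 2 * ‖v‖ ^ 3) := by ring
        _ ≤ _ := by gcongr)
    (left_mem_Icc.2 ht.1) (right_mem_Icc.2 ht.1)
  simp only [Real.norm_eq_abs, zero_smul, add_zero, zero_mul, sub_zero, ne_eq, OfNat.ofNat_ne_zero,
    not_false_eq_true, zero_pow, zero_div, abs_of_nonneg ht.1] at key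
  refine le_trans (le_of_eq ?_) (key.trans_eq (by ring))
  congr 1
  ring

end Taylor

section SmoothLik

variable {d q₁ q₂ q₃ : ℕ}

/-- The partial derivatives `L₁` and `L₂` of first and second order of the log-likelihood of one
replicate on a set of parameters, as functions that are measurable in the observation. -/
structure SmoothLik (B : Block d q₁ q₂ q₃) (U : Set (Param q₁ q₂ q₃))
    (L₁ : ParamIdx q₁ q₂ q₃ → Param q₁ q₂ q₃ → Obs d q₁ q₂ q₃ → ℝ)
    (L₂ : ParamIdx q₁ q₂ q₃ → ParamIdx q₁ q₂ q₃ → Param q₁ q₂ q₃ → Obs d q₁ q₂ q₃ → ℝ) : Prop where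
  tame_one : ∀ a, Tame U (obsSet B) (tailBound B) 2 (L₁ a)
  tame_two : ∀ a b, Tame U (obsSet B) (tailBound B) 1 (L₂ a b)
  hasFDerivAt_logLik : ∀ o ∈ obsSet B, ∀ θ ∈ U,
    HasFDerivAt (fun τ => logLik B τ o) (covec fun a => L₁ a θ o) θ
  hasFDerivAt_one : ∀ a, ∀ o ∈ obsSet B, ∀ θ ∈ U,
    HasFDerivAt (fun τ => L₁ a τ o) (covec fun b => L₂ a b θ o) θ

variable {B : Block d q₁ q₂ q₃} {U : Set (Param q₁ q₂ q₃)}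
  {L₁ : ParamIdx q₁ q₂ q₃ → Param q₁ q₂ q₃ → Obs d q₁ q₂ q₃ → ℝ}
  {L₂ : ParamIdx q₁ q₂ q₃ → ParamIdx q₁ q₂ q₃ → Param q₁ q₂ q₃ → Obs d q₁ q₂ q₃ → ℝ}

lemma WellInside.tame_logLik (hU : WellInside B U) (n : ℕ) :
    Tame U (obsSet B) (tailBound B) n fun θ o =>
      ∑ j : Fin d, ∑ l ∈ Finset.Ioi j, pairLogLik B θ o j l :=
  Tame.sum (fun o _ => tailBound_nonneg o) _ fun j _ =>
    Tame.sum (fun o _ => tailBound_nonneg o) _ fun l _ => hU.tame_pairLogLik n j l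

lemma WellInside.exists_smoothLik (hU : WellInside B U) (hs : Function.Injective B.site)
    (ho : IsOpen U) : ∃ L₁ L₂, SmoothLik B U L₁ L₂ := by
  obtain ⟨-, L₁, h₁, hd₁⟩ := hU.tame_logLik 3
  choose L₂ h₂ hd₂ using fun a => (h₁ a).2
  refine ⟨L₁, L₂, h₁, h₂, fun o ho' θ hθ => (hd₁ o ho' θ hθ).congr_of_eventuallyEq ?_, hd₂⟩
  filter_upwards [ho.mem_nhds hθ] with τ hτ
  exact logLik_eq hs (hU.valid hτ ho'.1) ho'.2

lemma toDual_toLp (c : ParamIdx q₁ q₂ q₃ → ℝ) :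
    InnerProductSpace.toDual ℝ (Param q₁ q₂ q₃) (WithLp.toLp 2 c) = covec c := by
  ext v
  simp [PiLp.inner_apply, mul_comm]

lemma SmoothLik.hasGradientAt (h : SmoothLik B U L₁ L₂) {o : Obs d q₁ q₂ q₃} (ho : o ∈ obsSet B)
    {θ : Param q₁ q₂ q₃} (hθ : θ ∈ U) :
    HasGradientAt (fun τ => logLik B τ o) (WithLp.toLp 2 fun a => L₁ a θ o) θ := by
  rw [hasGradientAt_iff_hasFDerivAt, toDual_toLp]
  exact h.hasFDerivAt_logLik o ho θ hθ

lemma SmoothLik.score_eq (h : SmoothLik B U L₁ L₂) {o : Obs d q₁ q₂ q₃} (ho : o ∈ obsSet B)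
    {θ : Param q₁ q₂ q₃} (hθ : θ ∈ U) : score B θ o = WithLp.toLp 2 fun a => L₁ a θ o :=
  (h.hasGradientAt ho hθ).gradient

lemma SmoothLik.scoreDeriv_eq (h : SmoothLik B U L₁ L₂) (hU : IsOpen U) {o : Obs d q₁ q₂ q₃}
    (ho : o ∈ obsSet B) {θ : Param q₁ q₂ q₃} (hθ : θ ∈ U) (a b : ParamIdx q₁ q₂ q₃) :
    scoreDeriv B θ a b o = L₂ a b θ o := by
  classical
  have h1 : HasFDerivAt (fun τ => (WithLp.toLp 2 fun a => L₁ a τ o : Param q₁ q₂ q₃))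
      ((PiLp.continuousLinearEquiv 2 ℝ
          (fun _ : ParamIdx q₁ q₂ q₃ => ℝ)).symm.toContinuousLinearMap.comp
        (ContinuousLinearMap.pi fun a => covec fun b => L₂ a b θ o)) θ :=
    ((PiLp.continuousLinearEquiv 2 ℝ
      (fun _ : ParamIdx q₁ q₂ q₃ => ℝ)).symm.toContinuousLinearMap.hasFDerivAt).comp θ
      (hasFDerivAt_pi.2 fun a => h.hasFDerivAt_one a o ho θ hθ)
  have h2 : (fun τ => score B τ o) =ᶠ[𝓝 θ] fun τ => WithLp.toLp 2 fun a => L₁ a τ o := by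
    filter_upwards [hU.mem_nhds hθ] with τ hτ
    exact h.score_eq ho hτ
  rw [scoreDeriv, (h1.congr_of_eventuallyEq h2).fderiv]
  simp [Finset.sum_ite_eq', PiLp.single_apply]

end SmoothLik

/-! ### The sensitivity matrix is negative definite -/

section Information

variable {d q₁ q₂ q₃ : ℕ} {B : Block d q₁ q₂ q₃} {ρ : ℝ → ℝ → Measure (Fin d → ℝ)}
  {U : Set (Param q₁ q₂ q₃)} [IsProbabilityMeasure B.covLaw]

lemma WellInside.integrable_of_tame (hU : WellInside B U)
    (h_BR : ∀ ω ζ : ℝ, IsBrownResnick B.site ω ζ (ρ ω ζ)) {θ₀ : Param q₁ q₂ q₃} (hθ₀ : θ₀ ∈ U)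
    {n : ℕ} {f : Param q₁ q₂ q₃ → Obs d q₁ q₂ q₃ → ℝ} (hf : Tame U (obsSet B) (tailBound B) n f)
    {θ : Param q₁ q₂ q₃} (hθ : θ ∈ U) : Integrable (f θ) (obsLaw B ρ θ₀) := by
  obtain ⟨hm, C, k, -, hb⟩ := hf.polyBdd
  refine ((hU.integrable_pow h_BR hθ₀ k).const_mul C).mono' (hm θ hθ).aestronglyMeasurable ?_
  filter_upwards [ae_mem_obsSet h_BR θ₀] with o ho
  exact hb o ho θ hθ

/-- The inequality `(exp (x / 2) - 1) ^ 2 ≤ exp x - 1 - x`, in expectation: the squared Hellinger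
distance is at most the Kullback-Leibler divergence. -/
lemma lintegral_hellinger_le {Ω : Type*} [MeasurableSpace Ω] {μ : Measure Ω}
    [IsProbabilityMeasure μ] {D : Ω → ℝ} (hD : Integrable D μ)
    (h1 : ∫⁻ o, ENNReal.ofReal (Real.exp (D o)) ∂μ = 1) :
    0 ≤ -∫ o, D o ∂μ ∧
      ∫⁻ o, ENNReal.ofReal ((Real.exp (D o / 2) - 1) ^ 2) ∂μ ≤ ENNReal.ofReal (-∫ o, D o ∂μ) := by
  have hexp : Integrable (fun o => Real.exp (D o)) μ := by
    refine ⟨Real.continuous_exp.comp_aestronglyMeasurable hD.1, ?_⟩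
    rw [hasFiniteIntegral_iff_ofReal (Eventually.of_forall fun o => (Real.exp_pos _).le), h1]
    exact ENNReal.one_lt_top
  have hexp1 : ∫ o, Real.exp (D o) ∂μ = 1 := by
    rw [integral_eq_lintegral_of_nonneg_ae (Eventually.of_forall fun o => (Real.exp_pos _).le)
      hexp.1, h1, ENNReal.toReal_one]
  have hle : ∀ o, (Real.exp (D o / 2) - 1) ^ 2 ≤ Real.exp (D o) - 1 - D o := by
    intro o
    have e1 : Real.exp (D o) = Real.exp (D o / 2) ^ 2 := by
      rw [← Real.exp_nat_mul]
      congr 1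
      push_cast
      ring
    have e2 := Real.add_one_le_exp (D o / 2)
    rw [e1]
    linarith [sq_nonneg (Real.exp (D o / 2))]
  have hsub : Integrable (fun o => Real.exp (D o) - 1) μ := hexp.sub (integrable_const 1)
  have hint : Integrable (fun o => Real.exp (D o) - 1 - D o) μ := hsub.sub hD
  have heq : ∫ o, (Real.exp (D o) - 1 - D o) ∂μ = -∫ o, D o ∂μ := by
    rw [integral_sub hsub hD, integral_sub hexp (integrable_const 1),
      hexp1]
    simp
  have hnn : ∀ o, 0 ≤ Real.exp (D o) - 1 - D o := fun o => (sq_nonneg _).trans (hle o)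
  refine ⟨heq ▸ integral_nonneg hnn, ?_⟩
  rw [← heq, ofReal_integral_eq_lintegral_ofReal hint (Eventually.of_forall hnn)]
  exact lintegral_mono fun o => ENNReal.ofReal_le_ofReal (hle o)

/-- If the Kullback–Leibler divergences `-∫ D t` along a curve are of third order in `t`, then the
derivative `D'` of the log-likelihood ratio at `t = 0` vanishes almost surely: by Fatou's lemma,
`(D' / 2) ^ 2` has integral at most the lower limit of the squared Hellinger distances divided by
`t ^ 2`. -/
lemma ae_deriv_eq_zero {Ω : Type*} [MeasurableSpace Ω] {μ : Measure Ω}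
    [IsProbabilityMeasure μ] {D : ℝ → Ω → ℝ} {D' : Ω → ℝ} {C : ℝ}
    (hm : ∀ t ∈ Icc (0 : ℝ) 1, Measurable (D t))
    (hint : ∀ t ∈ Icc (0 : ℝ) 1, Integrable (D t) μ)
    (h1 : ∀ t ∈ Icc (0 : ℝ) 1, ∫⁻ o, ENNReal.ofReal (Real.exp (D t o)) ∂μ = 1)
    (hC : ∀ t ∈ Icc (0 : ℝ) 1, -∫ o, D t o ∂μ ≤ C * t ^ 3)
    (h0 : ∀ o, D 0 o = 0) (hd : ∀ᵐ o ∂μ, HasDerivAt (fun t => D t o) (D' o) 0) :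
    ∀ᵐ o ∂μ, D' o = 0 := by
  set t : ℕ → ℝ := fun n => 1 / ((n : ℝ) + 1) with ht
  have htpos : ∀ n, 0 < t n := fun n => by rw [ht]; positivity
  have htmem : ∀ n, t n ∈ Icc (0 : ℝ) 1 := fun n => ⟨(htpos n).le, by
    rw [ht]
    exact div_le_one_of_le₀ (by simp) (by positivity)⟩
  have ht0 : Tendsto t atTop (𝓝 0) := tendsto_one_div_add_atTop_nhds_zero_nat
  set f : ℕ → Ω → ENNReal := fun n o =>
    ENNReal.ofReal (((t n)⁻¹ * (Real.exp (D (t n) o / 2) - 1)) ^ 2) with hf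
  have hfm : ∀ n, Measurable (f n) := fun n => ENNReal.measurable_ofReal.comp
    ((((Real.measurable_exp.comp ((hm _ (htmem n)).div_const 2)).sub_const 1).const_mul
      _).pow_const 2)
  have hle : ∀ n, ∫⁻ o, f n o ∂μ ≤ ENNReal.ofReal (C * t n) := by
    intro n
    have e1 := (lintegral_hellinger_le (hint _ (htmem n)) (h1 _ (htmem n))).2.trans
      (ENNReal.ofReal_le_ofReal (hC _ (htmem n)))
    have e2 : ∀ o, f n o = ENNReal.ofReal (((t n)⁻¹) ^ 2) *
        ENNReal.ofReal ((Real.exp (D (t n) o / 2) - 1) ^ 2) := fun o => by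
      rw [hf, ← ENNReal.ofReal_mul (sq_nonneg _), ← mul_pow]
    simp only [e2]
    rw [lintegral_const_mul' _ _ ENNReal.ofReal_ne_top]
    refine (mul_le_mul_right e1 _).trans ?_
    rw [← ENNReal.ofReal_mul (sq_nonneg _)]
    refine ENNReal.ofReal_le_ofReal (le_of_eq ?_)
    have := (htpos n).ne'
    field_simp
  have hlim : Tendsto (fun n => ∫⁻ o, f n o ∂μ) atTop (𝓝 0) := by
    refine tendsto_of_tendsto_of_tendsto_of_le_of_le tendsto_const_nhds ?_
      (fun _ => zero_le) hle
    have := ENNReal.tendsto_ofReal (ht0.const_mul C)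
    simpa using this
  have hfatou : ∫⁻ o, liminf (fun n => f n o) atTop ∂μ ≤
      liminf (fun n => ∫⁻ o, f n o ∂μ) atTop := lintegral_liminf_le hfm
  rw [hlim.liminf_eq] at hfatou
  have hlm : Measurable fun o => liminf (fun n => f n o) atTop := Measurable.liminf hfm
  have hz := (lintegral_eq_zero_iff hlm).1 (le_antisymm hfatou zero_le)
  filter_upwards [hz, hd] with o ho hdo
  have hder : HasDerivAt (fun s => Real.exp (D s o / 2)) (D' o / 2) 0 := by
    have := (hdo.div_const 2).exp
    simpa [h0] using this
  have hslope := hder.tendsto_slope_zero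
  have htn : Tendsto t atTop (𝓝[≠] 0) :=
    tendsto_nhdsWithin_iff.2 ⟨ht0, Eventually.of_forall fun n => (htpos n).ne'⟩
  have hlim2 := hslope.comp htn
  have hlim3 : Tendsto (fun n => f n o) atTop (𝓝 (ENNReal.ofReal ((D' o / 2) ^ 2))) := by
    refine (ENNReal.tendsto_ofReal (hlim2.pow 2)).congr fun n => ?_
    simp [hf, h0, Function.comp]
  have h2 : liminf (fun n => f n o) atTop = 0 := ho
  rw [hlim3.liminf_eq, ENNReal.ofReal_eq_zero] at h2
  have h3 := pow_eq_zero_iff (two_ne_zero) |>.1 (le_antisymm h2 (sq_nonneg _))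
  linarith

variable {L₁ : ParamIdx q₁ q₂ q₃ → Param q₁ q₂ q₃ → Obs d q₁ q₂ q₃ → ℝ}
  {L₂ : ParamIdx q₁ q₂ q₃ → ParamIdx q₁ q₂ q₃ → Param q₁ q₂ q₃ → Obs d q₁ q₂ q₃ → ℝ}

/-- A direction in which the expected second derivative is nonnegative is a direction in which the
score vanishes almost surely: the divergences of the pairs are nonnegative and their sum is of third
order along the line, so that `ae_deriv_eq_zero` applies to each pair. -/
lemma SmoothLik.ae_score_eq_zero (h : SmoothLik B U L₁ L₂) (hU : WellInside B U) (hUo : IsOpen U)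
    (hUc : Convex ℝ U)
    (hs : Function.Injective B.site) (h_BR : ∀ ω ζ : ℝ, IsBrownResnick B.site ω ζ (ρ ω ζ))
    {θ₀ v : Param q₁ q₂ q₃} (hθ₀ : θ₀ ∈ U) (hv : θ₀ + v ∈ U)
    (hzero : ∀ a, ∫ o, L₁ a θ₀ o ∂obsLaw B ρ θ₀ = 0)
    (hQ : 0 ≤ ∑ a, (∑ b, (∫ o, L₂ a b θ₀ o ∂obsLaw B ρ θ₀) * v b) * v a) :
    ∀ᵐ o ∂obsLaw B ρ θ₀, ∑ a, L₁ a θ₀ o * v a = 0 := by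
  have hP := isProbabilityMeasure_obsLaw h_BR θ₀
  have hM : ∀ o ∈ obsSet B, 0 ≤ tailBound B o := fun o _ => tailBound_nonneg o
  have hmem : ∀ t ∈ Icc (0 : ℝ) 1, θ₀ + t • v ∈ U := fun t ht => hUc.add_smul_mem hθ₀ hv ht
  have hi1 : ∀ a, Integrable (L₁ a θ₀) (obsLaw B ρ θ₀) := fun a =>
    hU.integrable_of_tame h_BR hθ₀ (h.tame_one a) hθ₀
  have hi2 : ∀ a b, Integrable (L₂ a b θ₀) (obsLaw B ρ θ₀) := fun a b =>
    hU.integrable_of_tame h_BR hθ₀ (h.tame_two a b) hθ₀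
  set D : Fin d → Fin d → ℝ → Obs d q₁ q₂ q₃ → ℝ := fun j l t o =>
    pairLogLik B (θ₀ + t • v) o j l - pairLogLik B θ₀ o j l with hD
  have hDm : ∀ j l, ∀ t ∈ Icc (0 : ℝ) 1, Measurable (D j l t) := fun j l t ht =>
    ((hU.tame_pairLogLik 0 j l).polyBdd.1 _ (hmem t ht)).sub
      ((hU.tame_pairLogLik 0 j l).polyBdd.1 _ hθ₀)
  have hDi : ∀ j l, ∀ t ∈ Icc (0 : ℝ) 1, Integrable (D j l t) (obsLaw B ρ θ₀) := fun j l t ht =>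
    (hU.integrable_of_tame h_BR hθ₀ (hU.tame_pairLogLik 0 j l) (hmem t ht)).sub
      (hU.integrable_of_tame h_BR hθ₀ (hU.tame_pairLogLik 0 j l) hθ₀)
  have hne : ∀ j l : Fin d, l ∈ Finset.Ioi j → B.site j ≠ B.site l := fun j l hl he =>
    (Finset.mem_Ioi.1 hl).ne (hs he)
  have hD1 : ∀ j l, l ∈ Finset.Ioi j → ∀ t ∈ Icc (0 : ℝ) 1,
      ∫⁻ o, ENNReal.ofReal (Real.exp (D j l t o)) ∂obsLaw B ρ θ₀ = 1 := fun j l hl t ht =>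
    lintegral_pair_ratio hU h_BR hθ₀ (hmem t ht) (hne j l hl)
  have hDnn : ∀ j l, l ∈ Finset.Ioi j → ∀ t ∈ Icc (0 : ℝ) 1, 0 ≤ -∫ o, D j l t o ∂obsLaw B ρ θ₀ :=
    fun j l hl t ht => (lintegral_hellinger_le (hDi j l t ht) (hD1 j l hl t ht)).1
  -- The sum over the pairs is of third order, as the expected score vanishes and `0 ≤ Q`.
  obtain ⟨C, k, hC, htaylor⟩ := exists_taylor hM hUc h.tame_two h.hasFDerivAt_logLik
    h.hasFDerivAt_one hθ₀ hv
  set K : ℝ := C * ∫ o, (1 + tailBound B o) ^ k ∂obsLaw B ρ θ₀ with hK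
  have hsum : ∀ t ∈ Icc (0 : ℝ) 1,
      ∑ j, ∑ l ∈ Finset.Ioi j, -∫ o, D j l t o ∂obsLaw B ρ θ₀ ≤ K * t ^ 3 := by
    intro t ht
    have e1 : ∑ j, ∑ l ∈ Finset.Ioi j, -∫ o, D j l t o ∂obsLaw B ρ θ₀ =
        -∫ o, ∑ j, ∑ l ∈ Finset.Ioi j, D j l t o ∂obsLaw B ρ θ₀ := by
      rw [integral_finsetSum _ fun j _ => integrable_finsetSum _ fun l _ => hDi j l t ht,
        ← Finset.sum_neg_distrib]
      refine Finset.sum_congr rfl fun j _ => ?_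
      rw [integral_finsetSum _ fun l _ => hDi j l t ht, ← Finset.sum_neg_distrib]
    have i1 : Integrable (fun o => t * ∑ a, L₁ a θ₀ o * v a) (obsLaw B ρ θ₀) :=
      (integrable_finsetSum _ fun a _ => (hi1 a).mul_const _).const_mul _
    have i2 : Integrable (fun o => t ^ 2 / 2 * ∑ a, (∑ b, L₂ a b θ₀ o * v b) * v a)
        (obsLaw B ρ θ₀) :=
      (integrable_finsetSum _ fun a _ =>
        (integrable_finsetSum _ fun b _ => (hi2 a b).mul_const _).mul_const _).const_mul _
    have i3 : Integrable (fun o => C * (1 + tailBound B o) ^ k * t ^ 3) (obsLaw B ρ θ₀) :=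
      ((hU.integrable_pow h_BR hθ₀ k).const_mul C).mul_const _
    have i12 : Integrable (fun o => t * ∑ a, L₁ a θ₀ o * v a +
        t ^ 2 / 2 * ∑ a, (∑ b, L₂ a b θ₀ o * v b) * v a) (obsLaw B ρ θ₀) := i1.add i2
    have e2 : ∫ o, t * ∑ a, L₁ a θ₀ o * v a ∂obsLaw B ρ θ₀ = 0 := by
      rw [integral_const_mul, integral_finsetSum _ fun a _ => (hi1 a).mul_const _]
      simp [integral_mul_const, hzero]
    have e3 : ∫ o, t ^ 2 / 2 * ∑ a, (∑ b, L₂ a b θ₀ o * v b) * v a ∂obsLaw B ρ θ₀ =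
        t ^ 2 / 2 * ∑ a, (∑ b, (∫ o, L₂ a b θ₀ o ∂obsLaw B ρ θ₀) * v b) * v a := by
      rw [integral_const_mul, integral_finsetSum _ fun a _ =>
        (integrable_finsetSum _ fun b _ => (hi2 a b).mul_const _).mul_const _]
      congr 1
      refine Finset.sum_congr rfl fun a _ => ?_
      rw [integral_mul_const, integral_finsetSum _ fun b _ => (hi2 a b).mul_const _]
      simp only [integral_mul_const]
    have e4 : ∫ o, (t * ∑ a, L₁ a θ₀ o * v a + t ^ 2 / 2 * ∑ a, (∑ b, L₂ a b θ₀ o * v b) * v a -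
        C * (1 + tailBound B o) ^ k * t ^ 3) ∂obsLaw B ρ θ₀ ≤
        ∫ o, ∑ j, ∑ l ∈ Finset.Ioi j, D j l t o ∂obsLaw B ρ θ₀ := by
      refine integral_mono_ae (i12.sub i3)
        (integrable_finsetSum _ fun j _ => integrable_finsetSum _ fun l _ => hDi j l t ht) ?_
      filter_upwards [ae_mem_obsSet h_BR θ₀] with o ho
      have e5 := (abs_le.1 (htaylor o ho t ht)).1
      rw [logLik_eq hs (hU.valid (hmem t ht) ho.1) ho.2,
        logLik_eq hs (hU.valid hθ₀ ho.1) ho.2] at e5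
      simp only [hD, Finset.sum_sub_distrib]
      linarith
    rw [integral_sub i12 i3, integral_add i1 i2, e2, e3, integral_mul_const,
      integral_const_mul] at e4
    rw [e1, hK]
    have : 0 ≤ t ^ 2 / 2 * ∑ a, (∑ b, (∫ o, L₂ a b θ₀ o ∂obsLaw B ρ θ₀) * v b) * v a :=
      mul_nonneg (by positivity) hQ
    linarith
  have hpair : ∀ j l, l ∈ Finset.Ioi j → ∀ t ∈ Icc (0 : ℝ) 1,
      -∫ o, D j l t o ∂obsLaw B ρ θ₀ ≤ K * t ^ 3 := by
    intro j l hl t ht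
    refine le_trans ?_ (hsum t ht)
    exact (Finset.single_le_sum (f := fun l => -∫ o, D j l t o ∂obsLaw B ρ θ₀)
      (fun l hl => hDnn j l hl t ht) hl).trans
      (Finset.single_le_sum (f := fun j => ∑ l ∈ Finset.Ioi j, -∫ o, D j l t o ∂obsLaw B ρ θ₀)
        (fun j _ => Finset.sum_nonneg fun l hl => hDnn j l hl t ht) (Finset.mem_univ j))
  choose G hG hGd using fun j l => (hU.tame_pairLogLik 1 j l).2
  have hline : ∀ s : ℝ, HasDerivAt (fun t : ℝ => θ₀ + t • v) v s := fun s => by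
    simpa using ((hasDerivAt_id' s).smul_const v).const_add θ₀
  have hDd : ∀ j l, ∀ o ∈ obsSet B,
      HasDerivAt (fun t => D j l t o) (∑ a, G j l a θ₀ o * v a) 0 := by
    intro j l o ho
    have e1 := hGd j l o ho (θ₀ + (0 : ℝ) • v) (by simpa using hθ₀)
    have e2 := (e1.comp_hasDerivAt 0 (hline 0)).sub_const (pairLogLik B θ₀ o j l)
    refine e2.congr_deriv ?_
    rw [covec_apply, zero_smul, add_zero]
  have hall : ∀ᵐ o ∂obsLaw B ρ θ₀, ∀ j l, l ∈ Finset.Ioi j → ∑ a, G j l a θ₀ o * v a = 0 := by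
    refine ae_all_iff.2 fun j => ae_all_iff.2 fun l => ?_
    by_cases hl : l ∈ Finset.Ioi j
    · have := ae_deriv_eq_zero (hDm j l) (hDi j l) (hD1 j l hl) (hpair j l hl) (by simp [hD])
        ((ae_mem_obsSet h_BR θ₀).mono fun o ho => hDd j l o ho)
      exact this.mono fun o ho _ => ho
    · exact Eventually.of_forall fun o h => absurd h hl
  filter_upwards [hall, ae_mem_obsSet h_BR θ₀] with o hzo ho
  have e1 : HasDerivAt (fun t : ℝ => logLik B (θ₀ + t • v) o) (∑ a, L₁ a θ₀ o * v a) 0 := by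
    have e2 := h.hasFDerivAt_logLik o ho (θ₀ + (0 : ℝ) • v) (by simpa using hθ₀)
    refine (e2.comp_hasDerivAt 0 (hline 0)).congr_deriv ?_
    rw [covec_apply, zero_smul, add_zero]
  have e4 : HasDerivAt (fun t : ℝ => logLik B θ₀ o + ∑ j, ∑ l ∈ Finset.Ioi j, D j l t o)
      (∑ j, ∑ l ∈ Finset.Ioi j, ∑ a, G j l a θ₀ o * v a) 0 :=
    (HasDerivAt.fun_sum fun j _ => HasDerivAt.fun_sum fun l _ => hDd j l o ho).const_add _
  have e5 : (fun t : ℝ => logLik B (θ₀ + t • v) o) =ᶠ[𝓝 0]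
      fun t : ℝ => logLik B θ₀ o + ∑ j, ∑ l ∈ Finset.Ioi j, D j l t o := by
    have hc : Continuous fun t : ℝ => θ₀ + t • v := by fun_prop
    have : ∀ᶠ t in 𝓝 (0 : ℝ), θ₀ + t • v ∈ U :=
      hc.continuousAt.eventually (by simpa using hUo.mem_nhds hθ₀)
    filter_upwards [this] with t ht
    rw [logLik_eq hs (hU.valid ht ho.1) ho.2, logLik_eq hs (hU.valid hθ₀ ho.1) ho.2]
    simp only [hD, Finset.sum_sub_distrib]
    ring
  rw [e1.unique (e4.congr_of_eventuallyEq e5)]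
  exact Finset.sum_eq_zero fun j _ => Finset.sum_eq_zero fun l hl => hzo j l hl

lemma SmoothLik.sensitivity_eq (h : SmoothLik B U L₁ L₂) (hUo : IsOpen U)
    (h_BR : ∀ ω ζ : ℝ, IsBrownResnick B.site ω ζ (ρ ω ζ)) {θ₀ : Param q₁ q₂ q₃} (hθ₀ : θ₀ ∈ U)
    (a b : ParamIdx q₁ q₂ q₃) :
    sensitivity B ρ θ₀ a b = ∫ o, L₂ a b θ₀ o ∂obsLaw B ρ θ₀ := by
  rw [sensitivity, Matrix.of_apply]
  exact integral_congr_ae ((ae_mem_obsSet h_BR θ₀).mono fun o ho => h.scoreDeriv_eq hUo ho hθ₀ a b)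

lemma SmoothLik.integral_score_eq_zero {Θ : Set (Param q₁ q₂ q₃)} {θ₀ : Param q₁ q₂ q₃}
    (h : SmoothLik B U L₁ L₂)
    (h_BR : ∀ ω ζ : ℝ, IsBrownResnick B.site ω ζ (ρ ω ζ)) (h_reg : Regular B ρ Θ θ₀)
    (hθ₀ : θ₀ ∈ U) (a : ParamIdx q₁ q₂ q₃) : ∫ o, L₁ a θ₀ o ∂obsLaw B ρ θ₀ = 0 := by
  obtain ⟨hi, h0⟩ := (h_reg.unique_zero θ₀ (interior_subset h_reg.interior)).2 rfl
  have e1 := (EuclideanSpace.proj (𝕜 := ℝ) a).integral_comp_comm hi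
  rw [h0, map_zero] at e1
  rw [← e1]
  refine integral_congr_ae ((ae_mem_obsSet h_BR θ₀).mono fun o ho => ?_)
  simp [h.score_eq ho hθ₀]

/-- The sensitivity matrix is negative definite at the true value: in any other direction the score
would vanish almost surely, whereas it has positive variance in every direction. -/
lemma SmoothLik.sensitivity_neg {Θ : Set (Param q₁ q₂ q₃)} {θ₀ : Param q₁ q₂ q₃}
    (h : SmoothLik B U L₁ L₂) (hU : WellInside B U) (hUo : IsOpen U)
    (hUc : Convex ℝ U) (hs : Function.Injective B.site)
    (h_BR : ∀ ω ζ : ℝ, IsBrownResnick B.site ω ζ (ρ ω ζ)) (h_reg : Regular B ρ Θ θ₀)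
    (hθ₀ : θ₀ ∈ U) {v : Param q₁ q₂ q₃} (hv : v ≠ 0) :
    ∑ a, (∑ b, sensitivity B ρ θ₀ a b * v b) * v a < 0 := by
  have hP := isProbabilityMeasure_obsLaw h_BR θ₀
  have hΘ := interior_subset h_reg.interior
  have hobs := ae_mem_obsSet h_BR θ₀
  have hsens := h.sensitivity_eq hUo h_BR hθ₀
  have hzero := h.integral_score_eq_zero h_BR h_reg hθ₀
  by_contra hcon
  push Not at hcon
  -- Shrink the direction so that the line stays in `U`.
  obtain ⟨t, htU, ht0⟩ : ∃ t : ℝ, θ₀ + t • v ∈ U ∧ 0 < t := by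
    have hc : Continuous fun t : ℝ => θ₀ + t • v := by fun_prop
    have h1 : ∀ᶠ t in 𝓝[>] (0 : ℝ), θ₀ + t • v ∈ U :=
      (hc.continuousAt.eventually (by simpa using hUo.mem_nhds hθ₀)).filter_mono nhdsWithin_le_nhds
    exact (h1.and self_mem_nhdsWithin).exists
  have hQ : 0 ≤ ∑ a, (∑ b, (∫ o, L₂ a b θ₀ o ∂obsLaw B ρ θ₀) * (t • v) b) * (t • v) a := by
    have e1 : ∑ a, (∑ b, (∫ o, L₂ a b θ₀ o ∂obsLaw B ρ θ₀) * (t • v) b) * (t • v) a =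
        t ^ 2 * ∑ a, (∑ b, sensitivity B ρ θ₀ a b * v b) * v a := by
      simp only [hsens, PiLp.smul_apply, smul_eq_mul, Finset.mul_sum, Finset.sum_mul]
      refine Finset.sum_congr rfl fun a _ => Finset.sum_congr rfl fun b _ => ?_
      ring
    rw [e1]
    exact mul_nonneg (sq_nonneg t) hcon
  have hz := h.ae_score_eq_zero hU hUo hUc hs h_BR hθ₀ htU hzero hQ
  have hz' : (fun o => ∑ b, v b * score B θ₀ o b) =ᵐ[obsLaw B ρ θ₀] fun _ => 0 := by
    filter_upwards [hz, hobs] with o ho hmem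
    have e1 : ∑ a, L₁ a θ₀ o * (t • v) a = t * ∑ b, v b * score B θ₀ o b := by
      rw [Finset.mul_sum, h.score_eq hmem hθ₀]
      refine Finset.sum_congr rfl fun a _ => ?_
      simp only [PiLp.smul_apply, smul_eq_mul]
      ring
    rw [e1] at ho
    exact (mul_eq_zero_iff_left ht0.ne').1 ho
  have hmem : ∀ a, MemLp (fun o => score B θ₀ o a) 2 (obsLaw B ρ θ₀) := fun a =>
    (EuclideanSpace.proj (𝕜 := ℝ) a).comp_memLp' (h_reg.var_finite θ₀ hΘ)
  have hmul : Matrix.mulVec (variability B ρ θ₀) v.ofLp = 0 := by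
    ext a
    have e1 : ∑ b, cov[fun o => score B θ₀ o a, fun o => v b * score B θ₀ o b;
        obsLaw B ρ θ₀] = 0 := by
      rw [← covariance_fun_sum_right (fun b => (hmem b).const_mul (v b)) (hmem a)]
      rw [covariance, integral_congr_ae (g := fun _ => 0), integral_zero]
      filter_upwards [hz'] with o ho
      simp only [ho]
      rw [integral_congr_ae hz', integral_zero]
      simp
    rw [Pi.zero_apply, ← e1, Matrix.mulVec, dotProduct]
    refine Finset.sum_congr rfl fun b _ => ?_
    rw [covariance_const_mul_right, variability, Matrix.of_apply, mul_comm]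
  have hpos := (h_reg.var_posDef θ₀ hΘ).dotProduct_mulVec_pos
    (x := v.ofLp) (fun h0 => hv (by ext a; exact congrFun h0 a))
  rw [hmul] at hpos
  simp at hpos

end Information

/-! ### Matrices as linear maps -/

section LinearMap

variable {ι : Type*} [Fintype ι]

lemma norm_le_sum_abs (x : EuclideanSpace ℝ ι) : ‖x‖ ≤ ∑ a, |x a| := by
  classical
  have h := (EuclideanSpace.basisFun ι ℝ).sum_repr x
  calc ‖x‖ = ‖∑ a, x a • EuclideanSpace.basisFun ι ℝ a‖ := by
        conv_lhs => rw [← h]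
        simp
    _ ≤ ∑ a, ‖x a • EuclideanSpace.basisFun ι ℝ a‖ := norm_sum_le _ _
    _ = ∑ a, |x a| := by simp [norm_smul]

variable [DecidableEq ι]

lemma toEuclideanCLM_eq_sum (M : Matrix ι ι ℝ) : Matrix.toEuclideanCLM (n := ι) (𝕜 := ℝ) M =
    ∑ a, ∑ b, M a b • Matrix.toEuclideanCLM (n := ι) (𝕜 := ℝ) (Matrix.single a b 1) := by
  conv_lhs => rw [Matrix.matrix_eq_sum_single M]
  simp only [map_sum]
  refine Finset.sum_congr rfl fun a _ => Finset.sum_congr rfl fun b _ => ?_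
  rw [← map_smul, Matrix.smul_single, smul_eq_mul, mul_one]

lemma integrable_sum_smul {O V : Type*} [MeasurableSpace O] {μ : Measure O} [NormedAddCommGroup V]
    [NormedSpace ℝ V] {M : O → Matrix ι ι ℝ} (h : ∀ a b, Integrable (fun o => M o a b) μ)
    (E : ι → ι → V) : Integrable (fun o => ∑ a, ∑ b, M o a b • E a b) μ :=
  integrable_finsetSum _ fun a _ => integrable_finsetSum _ fun b _ => (h a b).smul_const _

lemma integrable_toEuclideanCLM {O : Type*} [MeasurableSpace O] {μ : Measure O}
    {M : O → Matrix ι ι ℝ} (h : ∀ a b, Integrable (fun o => M o a b) μ) :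
    Integrable (fun o => Matrix.toEuclideanCLM (n := ι) (𝕜 := ℝ) (M o)) μ := by
  exact (integrable_sum_smul h _).congr
    (Eventually.of_forall fun o => (toEuclideanCLM_eq_sum (M o)).symm)

lemma integral_toEuclideanCLM {O : Type*} [MeasurableSpace O] {μ : Measure O}
    {M : O → Matrix ι ι ℝ} (h : ∀ a b, Integrable (fun o => M o a b) μ) :
    ∫ o, Matrix.toEuclideanCLM (n := ι) (𝕜 := ℝ) (M o) ∂μ =
      Matrix.toEuclideanCLM (n := ι) (𝕜 := ℝ) (Matrix.of fun a b => ∫ o, M o a b ∂μ) := by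
  rw [toEuclideanCLM_eq_sum (Matrix.of _), funext fun o => toEuclideanCLM_eq_sum (M o),
    integral_finsetSum _ fun a _ =>
    integrable_finsetSum _ fun b _ => (h a b).smul_const _]
  refine Finset.sum_congr rfl fun a _ => ?_
  rw [integral_finsetSum _ fun b _ => (h a b).smul_const _]
  exact Finset.sum_congr rfl fun b _ => integral_smul_const _ _

lemma toEuclideanCLM_apply_coord (M : Matrix ι ι ℝ) (v : EuclideanSpace ℝ ι) (a : ι) :
    Matrix.toEuclideanCLM (n := ι) (𝕜 := ℝ) M v a = ∑ b, M a b * v b := rfl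

lemma inner_toEuclideanCLM_self (M : Matrix ι ι ℝ) (v : EuclideanSpace ℝ ι) :
    inner ℝ (Matrix.toEuclideanCLM (n := ι) (𝕜 := ℝ) M v) v = ∑ a, (∑ b, M a b * v b) * v a := by
  simp only [PiLp.inner_apply, toEuclideanCLM_apply_coord, RCLike.inner_apply, conj_trivial,
    mul_comm]

/-- By compactness of the unit sphere, a negative definite form is bounded away from zero. -/
lemma exists_coercive {M : Matrix ι ι ℝ}
    (h : ∀ v : EuclideanSpace ℝ ι, v ≠ 0 → ∑ a, (∑ b, M a b * v b) * v a < 0) :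
    ∃ c : ℝ, 0 < c ∧ ∀ v, inner ℝ (Matrix.toEuclideanCLM (n := ι) (𝕜 := ℝ) M v) v ≤
      -c * ‖v‖ ^ 2 := by
  set L := Matrix.toEuclideanCLM (n := ι) (𝕜 := ℝ) M with hL
  have hneg : ∀ v : EuclideanSpace ℝ ι, v ≠ 0 → inner ℝ (L v) v < 0 := fun v hv => by
    rw [hL, inner_toEuclideanCLM_self]
    exact h v hv
  obtain ⟨c, hc, hs⟩ : ∃ c : ℝ, 0 < c ∧ ∀ v ∈ Metric.sphere (0 : EuclideanSpace ℝ ι) 1,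
      inner ℝ (L v) v ≤ -c := by
    rcases (Metric.sphere (0 : EuclideanSpace ℝ ι) 1).eq_empty_or_nonempty with he | hne
    · exact ⟨1, one_pos, by simp [he]⟩
    · obtain ⟨w, hw, hmax⟩ := (isCompact_sphere (0 : EuclideanSpace ℝ ι) 1).exists_isMaxOn hne
        (f := fun v => inner ℝ (L v) v) (by fun_prop)
      have hw0 : w ≠ 0 := by
        rintro rfl
        simp at hw
      exact ⟨-inner ℝ (L w) w, neg_pos.2 (hneg w hw0), fun v hv => by
        rw [neg_neg]
        exact hmax hv⟩
  refine ⟨c, hc, fun v => ?_⟩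
  rcases eq_or_ne v 0 with rfl | hv
  · simp
  · have hn : 0 < ‖v‖ := norm_pos_iff.2 hv
    have h1 := hs (‖v‖⁻¹ • v) (by simp [norm_smul, hn.ne'])
    rw [map_smul, inner_smul_left, inner_smul_right, conj_trivial] at h1
    have h2 := mul_le_mul_of_nonneg_right h1 (sq_nonneg ‖v‖)
    have h3 : ‖v‖⁻¹ * (‖v‖⁻¹ * inner ℝ (L v) v) * ‖v‖ ^ 2 = inner ℝ (L v) v := by
      field_simp
    linarith

lemma isUnit_det_of_neg {M : Matrix ι ι ℝ}
    (h : ∀ v : EuclideanSpace ℝ ι, v ≠ 0 → ∑ a, (∑ b, M a b * v b) * v a < 0) :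
    IsUnit M.det := by
  rw [isUnit_iff_ne_zero]
  intro h0
  obtain ⟨v, hv, hMv⟩ := Matrix.exists_mulVec_eq_zero_iff.2 h0
  have h1 := h (WithLp.toLp 2 v) (fun he => hv (by simpa using congrArg WithLp.ofLp he))
  have h2 : ∀ a, ∑ b, M a b * v b = 0 := fun a => congrFun hMv a
  simp [h2] at h1

/-- The image of a centred Gaussian vector with covariance matrix `C` under `-M⁻¹`. -/
lemma map_neg_symm_multivariateGaussian {M C : Matrix ι ι ℝ} (hM : IsUnit M.det) (hC : C.PosDef)
    {L : EuclideanSpace ℝ ι ≃L[ℝ] EuclideanSpace ℝ ι}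
    (hL : (L : EuclideanSpace ℝ ι →L[ℝ] EuclideanSpace ℝ ι) =
      Matrix.toEuclideanCLM (n := ι) (𝕜 := ℝ) M) :
    (multivariateGaussian 0 C).map (fun x => -L.symm x) =
      multivariateGaussian 0 ((M.transpose * C⁻¹ * M)⁻¹) := by
  have hsymm : ∀ x, L.symm x = Matrix.toEuclideanCLM (n := ι) (𝕜 := ℝ) M⁻¹ x := by
    intro x
    rw [ContinuousLinearEquiv.symm_apply_eq]
    have h1 : L (Matrix.toEuclideanCLM (n := ι) (𝕜 := ℝ) M⁻¹ x) =
        Matrix.toEuclideanCLM (n := ι) (𝕜 := ℝ) M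
          (Matrix.toEuclideanCLM (n := ι) (𝕜 := ℝ) M⁻¹ x) := by
      rw [← hL]
      rfl
    rw [h1]
    ext a
    rw [Matrix.ofLp_toEuclideanCLM, Matrix.ofLp_toEuclideanCLM, Matrix.mulVec_mulVec,
      Matrix.mul_nonsing_inv _ hM, Matrix.one_mulVec]
  have hinv : (M.transpose * C⁻¹ * M)⁻¹ = M⁻¹ * C * M⁻¹.transpose := by
    rw [Matrix.mul_inv_rev, Matrix.mul_inv_rev,
      Matrix.nonsing_inv_nonsing_inv _ ((Matrix.isUnit_iff_isUnit_det _).1 hC.isUnit),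
      Matrix.transpose_nonsing_inv,
      Matrix.mul_assoc]
  have hS : (M⁻¹ * C * M⁻¹.transpose).PosSemidef := by
    simpa [Matrix.conjTranspose_eq_transpose_of_trivial] using
      hC.posSemidef.mul_mul_conjTranspose_same M⁻¹
  have hmeas : Measurable fun x => -L.symm x := by fun_prop
  have : IsProbabilityMeasure ((multivariateGaussian 0 C).map fun x => -L.symm x) :=
    Measure.isProbabilityMeasure_map hmeas.aemeasurable
  rw [hinv]
  refine Measure.ext_of_charFun (funext fun t => ?_)
  set s : EuclideanSpace ℝ ι := -WithLp.toLp 2 (Matrix.mulVec M⁻¹.transpose t) with hs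
  have hinner : ∀ x, inner ℝ (-L.symm x) t = inner ℝ x s := by
    intro x
    rw [hsymm, hs, inner_neg_left, inner_neg_right, real_inner_comm, Matrix.inner_toEuclideanCLM,
      Matrix.dotProduct_mulVec, ← Matrix.mulVec_transpose, EuclideanSpace.inner_eq_star_dotProduct]
    simp
  have h1 : charFun ((multivariateGaussian 0 C).map fun x => -L.symm x) t =
      charFun (multivariateGaussian 0 C) s := by
    rw [charFun_apply, charFun_apply, integral_map hmeas.aemeasurable (by fun_prop)]
    simp only [hinner]
  rw [h1, charFun_multivariateGaussian hC.posSemidef, charFun_multivariateGaussian hS]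
  have h2 : s.ofLp ⬝ᵥ Matrix.mulVec C s.ofLp =
      t.ofLp ⬝ᵥ Matrix.mulVec (M⁻¹ * C * M⁻¹.transpose) t.ofLp := by
    rw [← Matrix.mulVec_mulVec, ← Matrix.mulVec_mulVec, Matrix.dotProduct_mulVec t.ofLp,
      ← Matrix.mulVec_transpose]
    simp [hs, Matrix.mulVec_neg]
  rw [h2]
  simp

end LinearMap

/-! ### Limit theory for the composite score -/

section Sample

variable {d q₁ q₂ q₃ : ℕ} {B : Block d q₁ q₂ q₃} {ρ : ℝ → ℝ → Measure (Fin d → ℝ)}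

/-- The likelihood sees an outcome only through its censored version. -/
lemma logLik_censor (θ : Param q₁ q₂ q₃) (o : Obs d q₁ q₂ q₃) :
    logLik B θ (censor B o) = logLik B θ o := by
  have e1 : ∀ j, (B.thr j < (censor B o).2 j) ↔ B.thr j < o.2 j := fun j => by
    simp [censor]
  have e2 : ∀ j, B.thr j < o.2 j → (censor B o).2 j = o.2 j := fun j hj => max_eq_left hj.le
  have e3 : ∀ j, B.thr j < o.2 j → frechetObs θ (censor B o) j = frechetObs θ o j := fun j hj => by
    rw [frechetObs, frechetObs, e2 j hj]
    rfl
  have e4 : ∀ j, B.thr j < o.2 j → jacobianObs θ (censor B o) j = jacobianObs θ o j :=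
      fun j hj => by
    rw [jacobianObs, jacobianObs, e2 j hj]
    rfl
  have e5 : (censor B o).1 = o.1 := rfl
  refine Finset.sum_congr rfl fun j _ => Finset.sum_congr rfl fun l _ => ?_
  congr 1
  simp only [pairLik, e1, e5]
  by_cases hj : B.thr j < o.2 j <;> by_cases hl : B.thr l < o.2 l <;>
    simp [hj, hl, e3, e4]

lemma score_censor (θ : Param q₁ q₂ q₃) (o : Obs d q₁ q₂ q₃) :
    score B θ (censor B o) = score B θ o := by
  simp only [score, logLik_censor]

lemma measurable_censor : Measurable (censor B) :=
  measurable_fst.prodMk (measurable_pi_lambda _ fun j =>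
    ((measurable_pi_apply j).comp measurable_snd).max measurable_const)

variable {Ω : Type*} [MeasurableSpace Ω] {P : Measure Ω} {D : ℕ → Ω → Obs d q₁ q₂ q₃}

lemma compositeScore_eq_sampleMean (θ : Param q₁ q₂ q₃) (n : ℕ) (ω : Ω) :
    compositeScore B (fun i : Fin n => D i ω) θ =
      sampleMean (fun i ω => censor B (D i ω)) (score B θ) n ω := by
  simp only [compositeScore, sampleMean, score_censor]
  rw [Finset.sum_range fun i => score B θ (D i ω)]

variable {U : Set (Param q₁ q₂ q₃)}
  {L₁ : ParamIdx q₁ q₂ q₃ → Param q₁ q₂ q₃ → Obs d q₁ q₂ q₃ → ℝ}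
  {L₂ : ParamIdx q₁ q₂ q₃ → ParamIdx q₁ q₂ q₃ → Param q₁ q₂ q₃ → Obs d q₁ q₂ q₃ → ℝ}

lemma SmoothLik.hasGradientAt_ccl (h : SmoothLik B U L₁ L₂) {n : ℕ} {ω : Ω}
    (ho : ∀ i, censor B (D i ω) ∈ obsSet B) {θ : Param q₁ q₂ q₃} (hθ : θ ∈ U) :
    HasGradientAt (ccl B fun i : Fin n => D i ω)
      (sampleMean (fun i ω => censor B (D i ω)) (score B θ) n ω) θ := by
  have h1 : ∀ i : Fin n, HasGradientAt (fun τ => logLik B τ (D i ω)) (score B θ (D i ω)) θ := by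
    intro i
    have h2 := h.hasGradientAt (ho i) hθ
    simp only [logLik_censor] at h2
    rwa [← h.score_eq (ho i) hθ, score_censor] at h2
  rw [← compositeScore_eq_sampleMean]
  have h2 := HasFDerivAt.fun_sum fun (i : Fin n) (_ : i ∈ Finset.univ) => (h1 i).hasFDerivAt
  have h3 := h2.const_mul (n : ℝ)⁻¹
  rw [hasGradientAt_iff_hasFDerivAt, compositeScore, map_smul, map_sum]
  exact h3

variable [IsProbabilityMeasure P] [IsProbabilityMeasure B.covLaw] {Z : ℕ → Ω → Obs d q₁ q₂ q₃}

/-- Near `θ₀` the mean score is linear, up to a small relative error. -/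
lemma SmoothLik.exists_whp_nearlyLinear {θ₀ : Param q₁ q₂ q₃} {δ₀ : ℝ} (hδ₀ : 0 < δ₀)
    (hU : WellInside B (Metric.ball θ₀ δ₀)) (h : SmoothLik B (Metric.ball θ₀ δ₀) L₁ L₂)
    (h_BR : ∀ ω ζ : ℝ, IsBrownResnick B.site ω ζ (ρ ω ζ))
    (hZ : IsSample P Z (obsLaw B ρ θ₀)) {η : ℝ} (hη : 0 < η) :
    ∃ δ, 0 < δ ∧ δ ≤ δ₀ ∧ Whp P fun n ω =>
      NearlyLinear (Matrix.toEuclideanCLM (𝕜 := ℝ) (sensitivity B ρ θ₀)) θ₀ δ η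
        fun θ => sampleMean Z (score B θ) n ω := by
  have hθ₀ : θ₀ ∈ Metric.ball θ₀ δ₀ := Metric.mem_ball_self hδ₀
  have hi : ∀ a b, Integrable (L₂ a b θ₀) (obsLaw B ρ θ₀) := fun a b =>
    hU.integrable_of_tame h_BR hθ₀ (h.tame_two a b) hθ₀
  obtain ⟨C, k, hC, hexp⟩ := exists_expansion_sum (fun o _ => tailBound_nonneg o)
    (convex_ball θ₀ δ₀) h.tame_two h.hasFDerivAt_one hθ₀
  have hA := integrable_toEuclideanCLM (M := fun o => Matrix.of fun a b => L₂ a b θ₀ o) hi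
  have hAe : ∫ o, Matrix.toEuclideanCLM (𝕜 := ℝ) (Matrix.of fun a b => L₂ a b θ₀ o)
      ∂obsLaw B ρ θ₀ = Matrix.toEuclideanCLM (𝕜 := ℝ) (sensitivity B ρ θ₀) := by
    rw [integral_toEuclideanCLM (M := fun o => Matrix.of fun a b => L₂ a b θ₀ o) hi]
    congr 1
    ext a b
    exact (h.sensitivity_eq Metric.isOpen_ball h_BR hθ₀ a b).symm
  rw [← hAe]
  refine hZ.exists_whp_nearlyLinear hδ₀ hA
    (F := fun o => C * (1 + tailBound B o) ^ k) ((hU.integrable_pow h_BR hθ₀ k).const_mul C) ?_ hη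
  filter_upwards [ae_mem_obsSet h_BR θ₀] with o ho x hx y hy
  refine (norm_le_sum_abs _).trans ?_
  rw [h.score_eq ho hx, h.score_eq ho hy]
  refine (le_of_eq ?_).trans ((hexp o ho x hx y hy).trans (le_of_eq (by ring)))
  rfl

/-- Uniformly on compact sets of parameters other than `θ₀`, the mean score does not vanish. -/
lemma whp_sampleMean_score_ne_zero {Θ K : Set (Param q₁ q₂ q₃)} {θ₀ : Param q₁ q₂ q₃}
    (hs : Function.Injective B.site) (h_bdd : ∃ R : ℝ, ∀ᵐ z ∂B.covLaw, ‖z‖ ≤ R)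
    (h_BR : ∀ ω ζ : ℝ, IsBrownResnick B.site ω ζ (ρ ω ζ)) (h_reg : Regular B ρ Θ θ₀)
    (hU : WellInside B U) (hθ₀ : θ₀ ∈ U)
    (hZ : IsSample P Z (obsLaw B ρ θ₀)) (hK : IsCompact K) (hKΘ : K ⊆ interior Θ)
    (hne : θ₀ ∉ K) : Whp P fun n ω => ∀ θ ∈ K, sampleMean Z (score B θ) n ω ≠ 0 := by
  have hloc : ∀ θ ∈ K, ∃ δ, 0 < δ ∧ ∃ L₁ L₂, SmoothLik B (Metric.ball θ δ) L₁ L₂ := by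
    intro θ hθ
    obtain ⟨δ, hδ, hb⟩ := Metric.nhds_basis_closedBall.mem_iff.1
      (mem_interior_iff_mem_nhds.1 (hKΘ hθ))
    have hW := wellInside_ball h_bdd h_BR h_reg (θ := θ) (half_pos hδ)
      (by rwa [mul_div_cancel₀ _ (two_ne_zero)])
    exact ⟨δ / 2, half_pos hδ, hW.exists_smoothLik hs Metric.isOpen_ball⟩
  have hint : ∀ θ ∈ K, Integrable (score B θ) (obsLaw B ρ θ₀) := by
    intro θ hθ
    obtain ⟨δ, hδ, L₁, L₂, h⟩ := hloc θ hθ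
    have hθb : θ ∈ Metric.ball θ δ := Metric.mem_ball_self hδ
    have h1 : Integrable (fun o => (WithLp.toLp 2 fun a => L₁ a θ o : Param q₁ q₂ q₃))
        (obsLaw B ρ θ₀) := by
      refine Integrable.of_eval_piLp fun a => ?_
      obtain ⟨hm, C, k, -, hb⟩ := (h.tame_one a).polyBdd
      refine ((hU.integrable_pow h_BR hθ₀ k).const_mul C).mono' (hm θ hθb).aestronglyMeasurable ?_
      filter_upwards [ae_mem_obsSet h_BR θ₀] with o ho
      exact hb o ho θ hθb
    refine h1.congr ?_
    filter_upwards [ae_mem_obsSet h_BR θ₀] with o ho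
    exact (h.score_eq ho hθb).symm
  refine hZ.whp_ne_zero_on hK hint (fun θ hθ h0 => hne ?_) fun θ hθ => ?_
  · rwa [← (h_reg.unique_zero θ (interior_subset (hKΘ hθ))).1 ⟨hint θ hθ, h0⟩]
  · obtain ⟨δ, hδ, L₁, L₂, h⟩ := hloc θ hθ
    obtain ⟨C, k, hC, hl⟩ := exists_lipschitz_sum (fun o _ => tailBound_nonneg o)
      (convex_ball θ δ) fun a => (h.tame_one a).pred
    refine ⟨δ, hδ, fun o => C * (1 + tailBound B o) ^ k,
      (hU.integrable_pow h_BR hθ₀ k).const_mul C, ?_⟩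
    filter_upwards [ae_mem_obsSet h_BR θ₀] with o ho x hx
    have hθb : θ ∈ Metric.ball θ δ := Metric.mem_ball_self hδ
    rw [h.score_eq ho hx, h.score_eq ho hθb]
    exact (norm_le_sum_abs _).trans (hl o ho x hx θ hθb)

end Sample

/-! ### Existence, consistency and asymptotic normality -/

lemma tendstoInDistribution_id_of_map_eq {Ω E : Type*} [MeasurableSpace Ω] {P : Measure Ω}
    [IsProbabilityMeasure P] [TopologicalSpace E] [MeasurableSpace E] [OpensMeasurableSpace E]
    {X : ℕ → Ω → E} {f : E → E} {G H : Measure E} [IsProbabilityMeasure G] [IsProbabilityMeasure H]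
    (h : TendstoInDistribution X atTop f (fun _ => P) G) (hH : G.map f = H) :
    TendstoInDistribution X atTop id (fun _ => P) H := by
  subst hH
  refine ⟨h.forall_aemeasurable, aemeasurable_id, ?_⟩
  have h1 := h.tendsto
  simp only [Measure.map_id]
  exact h1

section Main

variable {d q₁ q₂ q₃ : ℕ} {B : Block d q₁ q₂ q₃} {ρ : ℝ → ℝ → Measure (Fin d → ℝ)}
  {Θ : Set (Param q₁ q₂ q₃)} {θ₀ : Param q₁ q₂ q₃}
  {Ω : Type*} [MeasurableSpace Ω] {P : Measure Ω} [IsProbabilityMeasure P]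
  [IsProbabilityMeasure B.covLaw] {D : ℕ → Ω → Obs d q₁ q₂ q₃} {δ₀ c : ℝ}
  {L₁ : ParamIdx q₁ q₂ q₃ → Param q₁ q₂ q₃ → Obs d q₁ q₂ q₃ → ℝ}
  {L₂ : ParamIdx q₁ q₂ q₃ → ParamIdx q₁ q₂ q₃ → Param q₁ q₂ q₃ → Obs d q₁ q₂ q₃ → ℝ}

/-- Consistent roots of the score equation exist as statistics: near `θ₀` the mean score is a small
perturbation of a coercive linear map, so that it has exactly one zero there once it is small at
`θ₀`; its monotonicity makes the zero a local maximum. -/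
lemma SmoothLik.exists_consistent_root (hδ₀ : 0 < δ₀) (hΘ : Metric.ball θ₀ δ₀ ⊆ Θ)
    (hU : WellInside B (Metric.ball θ₀ δ₀)) (h : SmoothLik B (Metric.ball θ₀ δ₀) L₁ L₂)
    (h_BR : ∀ ω ζ : ℝ, IsBrownResnick B.site ω ζ (ρ ω ζ)) (h_reg : Regular B ρ Θ θ₀)
    (hZ : IsSample P (fun i ω => censor B (D i ω)) (obsLaw B ρ θ₀)) (hc : 0 < c)
    (hL : ∀ v, inner ℝ (Matrix.toEuclideanCLM (𝕜 := ℝ) (sensitivity B ρ θ₀) v) v ≤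
      -c * ‖v‖ ^ 2) :
    ∃ T : ∀ n : ℕ, (Fin n → Obs d q₁ q₂ q₃) → Param q₁ q₂ q₃, (∀ n, Measurable (T n)) ∧
      (Whp P fun n ω => T n (fun i => D i ω) ∈ Θ ∧
        compositeScore B (fun i : Fin n => D i ω) (T n fun i => D i ω) = 0 ∧
        IsLocalMax (ccl B fun i : Fin n => D i ω) (T n fun i => D i ω)) ∧
      TendstoInMeasure P (fun (n : ℕ) ω => T n fun i => D i ω) atTop fun _ => θ₀ := by
  obtain ⟨δ, hδ, hδle, hlin⟩ := h.exists_whp_nearlyLinear hδ₀ hU h_BR hZ (η := c / 4)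
    (by positivity)
  have hball : Metric.ball θ₀ δ ⊆ Metric.ball θ₀ δ₀ := Metric.ball_subset_ball hδle
  set G : ∀ n : ℕ, Param q₁ q₂ q₃ → (Fin n → Obs d q₁ q₂ q₃) → Param q₁ q₂ q₃ := fun n θ x =>
    (n : ℝ)⁻¹ • ∑ i, WithLp.toLp 2 fun a => L₁ a θ (censor B (x i)) with hG
  have hGm : ∀ n, ∀ θ ∈ Metric.ball θ₀ δ, Measurable (G n θ) := by
    intro n θ hθ
    have hm : ∀ i : Fin n, Measurable fun x : Fin n → Obs d q₁ q₂ q₃ =>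
        (WithLp.toLp 2 fun a => L₁ a θ (censor B (x i)) : Param q₁ q₂ q₃) := fun i => ?_
    · have hsum := Finset.measurable_fun_sum Finset.univ fun i _ => hm i
      exact hsum.const_smul ((n : ℝ)⁻¹)
    refine (PiLp.continuous_toLp 2 _).measurable.comp (measurable_pi_lambda _ fun a => ?_)
    exact ((h.tame_one a).polyBdd.1 θ (hball hθ)).comp
      (measurable_censor.comp (measurable_pi_apply i))
  choose T hTm hT using fun n => exists_measurable_solution (G n) hδ (hGm n)
  have hobs := hZ.ae_forall (ae_mem_obsSet h_BR θ₀)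
  have hGeq : ∀ ω, (∀ i, censor B (D i ω) ∈ obsSet B) → ∀ n, ∀ θ ∈ Metric.ball θ₀ δ,
      G n θ (fun i => D i ω) = sampleMean (fun i ω => censor B (D i ω)) (score B θ) n ω := by
    intro ω hω n θ hθ
    rw [hG, sampleMean, Finset.sum_range fun i => score B θ (censor B (D i ω))]
    exact congrArg _ (Finset.sum_congr rfl fun i _ => (h.score_eq (hω i) (hball hθ)).symm)
  have hint := (h_reg.unique_zero θ₀ (interior_subset h_reg.interior)).2 rfl
  have hlln := hZ.tendstoInMeasure_sampleMean hint.1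
  rw [hint.2] at hlln
  have hkey : ∀ ε, 0 < ε → ε < δ → Whp P fun n ω =>
      T n (fun i => D i ω) ∈ Metric.closedBall θ₀ ε ∧
      compositeScore B (fun i : Fin n => D i ω) (T n fun i => D i ω) = 0 ∧
      IsLocalMax (ccl B fun i : Fin n => D i ω) (T n fun i => D i ω) := by
    intro ε hε hεδ
    have h1 := whp_norm_sub_lt hlln (show 0 < c / 2 * ε by positivity)
    refine ((hlin.and h1).and (Whp.of_ae fun _ => hobs)).mono (Eventually.of_forall ?_)
    rintro n ω ⟨⟨hn, h0⟩, hω⟩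
    rw [sub_zero] at h0
    obtain ⟨θ, hθε, hθ0⟩ := hn.exists_zero hc hL hε.le hεδ h0.le
    have hθ : θ ∈ Metric.ball θ₀ δ := Metric.closedBall_subset_ball hεδ hθε
    have hnG : NearlyLinear (Matrix.toEuclideanCLM (𝕜 := ℝ) (sensitivity B ρ θ₀)) θ₀ δ (c / 4)
        fun θ => G n θ fun i => D i ω := by
      intro x hx y hy
      simp only [hGeq ω hω n x hx, hGeq ω hω n y hy]
      exact hn x hx y hy
    rw [hT n c _ hc hL _ hnG θ hθ ((hGeq ω hω n θ hθ).trans hθ0)]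
    refine ⟨hθε, (compositeScore_eq_sampleMean θ n ω).trans hθ0, ?_⟩
    exact isLocalMax_of_gradient hθ (fun τ hτ => h.hasGradientAt_ccl hω (hball hτ))
      (fun τ hτ => hn.inner_sub_nonpos hL hc hτ hθ) hθ0
  refine ⟨T, hTm, ?_, tendstoInMeasure_of_whp fun ε hε => ?_⟩
  · refine (hkey (δ / 2) (by positivity) (by linarith)).mono (Eventually.of_forall ?_)
    rintro n ω ⟨h1, h2⟩
    exact ⟨hΘ (hball (Metric.closedBall_subset_ball (by linarith) h1)), h2⟩
  · refine (hkey (min (ε / 2) (δ / 2)) (by positivity)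
      ((min_le_right _ _).trans_lt (by linarith))).mono (Eventually.of_forall ?_)
    rintro n ω ⟨h1, -⟩
    rw [← dist_eq_norm]
    exact (Metric.mem_closedBall.1 h1).trans_lt ((min_le_left _ _).trans_lt (by linarith))

/-- Roots of the score equation that stay in compact subsets of the interior of `Θ` are consistent,
as the mean score does not vanish on compact sets without `θ₀`. -/
lemma tendstoInMeasure_of_root {U : Set (Param q₁ q₂ q₃)}
    (hs : Function.Injective B.site) (h_bdd : ∃ R : ℝ, ∀ᵐ z ∂B.covLaw, ‖z‖ ≤ R)
    (h_BR : ∀ ω ζ : ℝ, IsBrownResnick B.site ω ζ (ρ ω ζ)) (h_reg : Regular B ρ Θ θ₀)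
    (hU : WellInside B U) (hθ₀ : θ₀ ∈ U) {Z : ℕ → Ω → Obs d q₁ q₂ q₃}
    (hZ : IsSample P Z (obsLaw B ρ θ₀)) {θhat : ℕ → Ω → Param q₁ q₂ q₃}
    (hzero : Whp P fun n ω => sampleMean Z (score B (θhat n ω)) n ω = 0)
    (htight : ∀ ε : ENNReal, 0 < ε → ∃ K : Set (Param q₁ q₂ q₃),
      IsCompact K ∧ K ⊆ interior Θ ∧ ∀ᶠ n in atTop, P {ω | θhat n ω ∉ K} ≤ ε) :
    TendstoInMeasure P θhat atTop fun _ => θ₀ := by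
  refine tendstoInMeasure_of_whp fun r hr => Whp.of_forall_pos fun ε hε => ?_
  obtain ⟨K, hK, hKΘ, hKP⟩ := htight ε hε
  refine ⟨fun n ω => θhat n ω ∈ K, hKP, ?_⟩
  have h1 := whp_sampleMean_score_ne_zero hs h_bdd h_BR h_reg hU hθ₀ hZ
    (hK.diff (Metric.isOpen_ball (x := θ₀) (ε := r))) (sdiff_subset.trans hKΘ)
    (fun h => h.2 (Metric.mem_ball_self hr))
  refine (h1.and hzero).mono (Eventually.of_forall ?_)
  rintro n ω ⟨h2, h3⟩ h4
  by_contra hcon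
  refine h2 _ ⟨h4, fun h5 => hcon ?_⟩ h3
  rwa [← dist_eq_norm]

/-- Consistent roots of the score equation are asymptotically normal. -/
lemma SmoothLik.tendstoInDistribution_root (hδ₀ : 0 < δ₀)
    (hU : WellInside B (Metric.ball θ₀ δ₀)) (h : SmoothLik B (Metric.ball θ₀ δ₀) L₁ L₂)
    (h_BR : ∀ ω ζ : ℝ, IsBrownResnick B.site ω ζ (ρ ω ζ)) (h_reg : Regular B ρ Θ θ₀)
    {Z : ℕ → Ω → Obs d q₁ q₂ q₃} (hZ : IsSample P Z (obsLaw B ρ θ₀)) (hc : 0 < c)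
    (hdet : IsUnit (sensitivity B ρ θ₀).det)
    (hL : ∀ v, inner ℝ (Matrix.toEuclideanCLM (𝕜 := ℝ) (sensitivity B ρ θ₀) v) v ≤
      -c * ‖v‖ ^ 2)
    {θhat : ℕ → Ω → Param q₁ q₂ q₃} (hmeas : ∀ n, AEMeasurable (θhat n) P)
    (hzero : Whp P fun n ω => sampleMean Z (score B (θhat n ω)) n ω = 0)
    (hcons : TendstoInMeasure P θhat atTop fun _ => θ₀) :
    (∀ ε : ENNReal, 0 < ε → ∃ R : ℝ, ∀ᶠ n : ℕ in atTop,
      P {ω | R < √(n : ℝ) * ‖θhat n ω - θ₀‖} ≤ ε) ∧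
    TendstoInDistribution (fun (n : ℕ) ω => √(n : ℝ) • (θhat n ω - θ₀)) atTop id (fun _ => P)
      (multivariateGaussian 0
        ((sensitivity B ρ θ₀).transpose * (variability B ρ θ₀)⁻¹ * sensitivity B ρ θ₀)⁻¹) := by
  have hθΘ := interior_subset h_reg.interior
  have hprob := isProbabilityMeasure_obsLaw h_BR θ₀
  obtain ⟨e, he⟩ := exists_inverse hc hL
  have hclt := hZ.tendstoInDistribution_sampleMean (h_reg.var_finite θ₀ hθΘ)
    ((h_reg.unique_zero θ₀ hθΘ).2 rfl).2 (h_reg.var_posDef θ₀ hθΘ).posSemidef fun _ _ => rfl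
  rw [← he] at hL
  obtain ⟨h1, h2⟩ := tendstoInDistribution_of_consistent (ψ := score B) hc hL (fun η hη => by
    obtain ⟨δ, hδ, -, hn⟩ := h.exists_whp_nearlyLinear hδ₀ hU h_BR hZ hη
    exact ⟨δ, hδ, by rwa [he]⟩) hclt hmeas hzero hcons
  exact ⟨h1, tendstoInDistribution_id_of_map_eq h2
    (map_neg_symm_multivariateGaussian hdet (h_reg.var_posDef θ₀ hθΘ) he)⟩

end Main

end MaxStable

end

theorem theorem1 {d q₁ q₂ q₃ : ℕ} (B : MaxStable.Block d q₁ q₂ q₃)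
    (h_site : Function.Injective B.site)
    (h_cov : IsProbabilityMeasure B.covLaw)
    (h_bdd : ∃ R : ℝ, ∀ᵐ z ∂B.covLaw, ‖z‖ ≤ R)
    (ρ : ℝ → ℝ → Measure (Fin d → ℝ))
    (h_BR : ∀ ω ζ : ℝ, MaxStable.IsBrownResnick B.site ω ζ (ρ ω ζ))
    (Θ : Set (MaxStable.Param q₁ q₂ q₃)) (θ₀ : MaxStable.Param q₁ q₂ q₃)
    (h_reg : MaxStable.Regular B ρ Θ θ₀)
    {Ω : Type*} [MeasurableSpace Ω] (P : Measure Ω) [IsProbabilityMeasure P]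
    (D : ℕ → Ω → MaxStable.Obs d q₁ q₂ q₃)
    (hD_meas : ∀ i, Measurable (D i))
    (hD_indep : iIndepFun (fun i ω => MaxStable.censor B (D i ω)) P)
    (hD_law : ∀ i, P.map (fun ω => MaxStable.censor B (D i ω)) = MaxStable.obsLaw B ρ θ₀) :
    -- The limiting covariance matrix is not degenerate.
    IsUnit (MaxStable.sensitivity B ρ θ₀).det ∧
    -- The estimator exists: consistent statistics solve the score equation, and maximize the
    -- censored composite likelihood locally, with probability tending to one.
    (∃ T : ∀ n : ℕ, (Fin n → MaxStable.Obs d q₁ q₂ q₃) → MaxStable.Param q₁ q₂ q₃,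
      (∀ n, Measurable (T n)) ∧
      Tendsto (fun n : ℕ => P {ω | ¬ (
          T n (fun i => D i ω) ∈ Θ ∧
          MaxStable.compositeScore B (fun i : Fin n => D i ω) (T n (fun i => D i ω)) = 0 ∧
          IsLocalMax (MaxStable.ccl B (fun i : Fin n => D i ω)) (T n (fun i => D i ω)))})
        atTop (𝓝 0) ∧
      TendstoInMeasure P (fun (n : ℕ) ω => T n (fun i => D i ω)) atTop (fun _ => θ₀)) ∧
    -- Every sequence of solutions that stays, up to small probability, in a compact part of the
    -- interior of the parameter space is consistent, `√n`-consistent and asymptotically normal.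
    (∀ θhat : ℕ → Ω → MaxStable.Param q₁ q₂ q₃,
      (∀ n, AEMeasurable (θhat n) P) →
      Tendsto (fun n : ℕ => P {ω | ¬ (
          θhat n ω ∈ Θ ∧
          MaxStable.compositeScore B (fun i : Fin n => D i ω) (θhat n ω) = 0)})
        atTop (𝓝 0) →
      (∀ ε : ENNReal, 0 < ε → ∃ K : Set (MaxStable.Param q₁ q₂ q₃),
        IsCompact K ∧ K ⊆ interior Θ ∧ ∀ᶠ n in atTop, P {ω | θhat n ω ∉ K} ≤ ε) →
      TendstoInMeasure P θhat atTop (fun _ => θ₀) ∧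
      (∀ ε : ENNReal, 0 < ε → ∃ M : ℝ, ∀ᶠ n : ℕ in atTop,
        P {ω | M < Real.sqrt n * ‖θhat n ω - θ₀‖} ≤ ε) ∧
      TendstoInDistribution (fun (n : ℕ) ω => Real.sqrt n • (θhat n ω - θ₀)) atTop id
        (fun _ => P)
        (multivariateGaussian 0
          ((MaxStable.sensitivity B ρ θ₀).transpose * (MaxStable.variability B ρ θ₀)⁻¹ *
            MaxStable.sensitivity B ρ θ₀)⁻¹)) := by
  obtain ⟨δ, hδ, hb⟩ := Metric.nhds_basis_closedBall.mem_iff.1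
    (mem_interior_iff_mem_nhds.1 h_reg.interior)
  have hδ₀ : 0 < δ / 2 := half_pos hδ
  have hU := MaxStable.wellInside_ball h_bdd h_BR h_reg hδ₀
    (by rwa [mul_div_cancel₀ _ (two_ne_zero)])
  have hmem : θ₀ ∈ Metric.ball θ₀ (δ / 2) := Metric.mem_ball_self hδ₀
  obtain ⟨L₁, L₂, h⟩ := hU.exists_smoothLik h_site Metric.isOpen_ball
  have hneg := fun (v : MaxStable.Param q₁ q₂ q₃) (hv : v ≠ 0) =>
    h.sensitivity_neg hU Metric.isOpen_ball (convex_ball _ _) h_site h_BR h_reg hmem hv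
  have hdet := MaxStable.isUnit_det_of_neg hneg
  obtain ⟨c, hc, hL⟩ := MaxStable.exists_coercive hneg
  have hZ : MaxStable.IsSample P (fun i ω => MaxStable.censor B (D i ω))
      (MaxStable.obsLaw B ρ θ₀) :=
    ⟨fun i => MaxStable.measurable_censor.comp (hD_meas i), hD_indep, hD_law⟩
  refine ⟨hdet, h.exists_consistent_root hδ₀ ((Metric.ball_subset_closedBall.trans
    (Metric.closedBall_subset_closedBall (by linarith))).trans hb) hU h_BR h_reg hZ hc hL,
    fun θhat hmeas hsol htight => ?_⟩
  have hzero : MaxStable.Whp P fun n ω =>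
      MaxStable.sampleMean (fun i ω => MaxStable.censor B (D i ω))
        (MaxStable.score B (θhat n ω)) n ω = 0 :=
    MaxStable.Whp.mono hsol (Eventually.of_forall fun n ω hω =>
      (MaxStable.compositeScore_eq_sampleMean _ n ω).symm.trans hω.2)
  have hcons := MaxStable.tendstoInMeasure_of_root h_site h_bdd h_BR h_reg hU hmem hZ hzero htight
  exact ⟨hcons, h.tendstoInDistribution_root hδ₀ hU h_BR h_reg hZ hc hdet hL hmeas hzero hcons⟩
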